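/- Work over an algebraically closed field $k$ of characteristic zero. Let $x\in X$ be the germ at a closed point of a smooth threefold, and let $\mathfrak a=\prod_j\mathfrak a_j^{r_j}$ be an $\mathbf R$-ideal on $X$ (a finite formal product of ideals $\mathfrak a_j$ with real exponents $r_j>0$). For a divisor $E$ over $X$, realised on a normal variety $Y$ with a birational morphism $Y\to X$, put $a_E(X,\mathfrak a)=1+\operatorname{ord}_EK_{Y/X}-\sum_jr_j\operatorname{ord}_E\mathfrak a_j$, and let $\operatorname{mld}_x(X,\mathfrak a)$ be the infimum of $a_E(X,\mathfrak a)$ over all divisors $E$ over $X$ with centre $x$. Divisors over $X$ are identified if they define the same valuation on the function field. For a regular system of parameters $x_1,x_2,x_3$ in $\mathscr O_{X,x}$ and positive integers $w_1,w_2,w_3$, the weighted blow-up of $X$ with $\operatorname{wt}(x_1,x_2,x_3)=(w_1,w_2,w_3)$ is $\operatorname{Proj}_X\bigoplus_{n\ge0}\mathscr I_n\to X$, where $\mathscr I_n$ is generated by the monomials $x_1^{s_1}x_2^{s_2}x_3^{s_3}$ with $\sum_iw_is_i\ge n$. Suppose that $\operatorname{mld}_x(X,\mathfrak a)=1$. Let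 $Y\to X$ be the weighted blow-up with $\operatorname{wt}(x_1,x_2,x_3)=(w_1,w_2,1)$, where $w_1\ge w_2\ge1$ are integers, and let $E$ be its exceptional divisor. Assume that $a_E(X,\mathfrak a)=1$. Let $y\in Y$ be the point above $x$ in the strict transform of the curve in $X$ defined by $(x_1,x_2)\mathscr O_X$. Let $Z\to Y$ be the weighted blow-up of the germ $y\in Y$ with $\operatorname{wt}(y_1,y_2,x_3)=(v_1,v_2,1)$, where $v_1\ge v_2\ge1$ are integers and $y_1,y_2,x_3$ is a regular system of parameters in $\mathscr O_{Y,y}$, and let $F$ be its exceptional divisor. Assume that $a_F(Y,\mathfrak a_Y)=1$, where $\mathfrak a_Y=\prod_j\bigl(\mathfrak a_j\mathscr O_Y((\operatorname{ord}_E\mathfrak a_j)E)\bigr)^{r_j}$ is the weak transform of $\mathfrak a$ in the germ $y\in Y$. If $$\Bigl\lfloor\frac{v_1-1}{v_2}\Bigr\rfloor\le\frac{w_1-v_1^2}{w_2},$$ then there exist an integer $d$ with $0\le d\le v_1-v_2$ and elements $x_1',x_2'\in\mathscr O_{X,x}$ such that $x_1',x_2',x_3$ is a regular system of parameters in $\mathscr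 O_{X,x}$ and the divisor $F$ over $X$ is the exceptional divisor of the weighted blow-up of $X$ with $\operatorname{wt}(x_1',x_2',x_3)=(w_1+v_1-d,\,w_2+v_2+d,\,1)$. -/

import Mathlib

noncomputable section

open Polynomial AlgebraicGeometry IsLocalRing
open scoped KaehlerDifferential

namespace WeightedBlowup

/-! ### Weighted blow-ups of an affine scheme -/

section Proj

variable {R : Type*} [CommRing R] {d : ℕ}

/-- The ideal `I_n` generated by the monomials `x₁^{s₁} ⋯ x_d^{s_d}` with `∑ wᵢ sᵢ ≥ n`. -/
def weightedIdeal (x : Fin d → R) (w : Fin d → ℕ) (n : ℕ) : Ideal R :=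
  Ideal.span {m | ∃ s : Fin d → ℕ, n ≤ ∑ i, w i * s i ∧ m = ∏ i, x i ^ s i}

theorem weightedIdeal_zero (x : Fin d → R) (w : Fin d → ℕ) : weightedIdeal x w 0 = ⊤ :=
  (Ideal.eq_top_iff_one _).2 (Ideal.subset_span ⟨0, by simp, by simp⟩)

theorem weightedIdeal_mul_le (x : Fin d → R) (w : Fin d → ℕ) (m n : ℕ) :
    weightedIdeal x w m * weightedIdeal x w n ≤ weightedIdeal x w (m + n) := by
  rw [weightedIdeal, weightedIdeal, Ideal.span_mul_span', Ideal.span_le]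
  rintro _ ⟨_, ⟨s, hs, rfl⟩, _, ⟨t, ht, rfl⟩, rfl⟩
  refine Ideal.subset_span ⟨s + t, ?_, ?_⟩
  · simpa [mul_add, Finset.sum_add_distrib] using add_le_add hs ht
  · simp [pow_add, Finset.prod_mul_distrib]

/-- The graded algebra `⨁ₙ I_n`, realised as the subalgebra `⨁ₙ I_n tⁿ` of `R[t]`. -/
def weightedRees (x : Fin d → R) (w : Fin d → ℕ) : Subalgebra R R[X] where
  carrier := {f | ∀ n, f.coeff n ∈ weightedIdeal x w n}
  mul_mem' {f g} hf hg n := by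
    rw [coeff_mul]
    refine Ideal.sum_mem _ ?_
    rintro ⟨i, j⟩ e
    rw [← Finset.HasAntidiagonal.mem_antidiagonal.mp e]
    exact weightedIdeal_mul_le x w i j (Ideal.mul_mem_mul (hf i) (hg j))
  add_mem' {f g} hf hg n := by
    rw [coeff_add]
    exact Ideal.add_mem _ (hf n) (hg n)
  algebraMap_mem' r n := by
    rw [Polynomial.algebraMap_apply, coeff_C]
    split_ifs with h
    · subst h
      simp [weightedIdeal_zero]
    · simp

/-- The degree `n` part `I_n tⁿ` of `⨁ₙ I_n tⁿ`. -/
def weightedGrading (x : Fin d → R) (w : Fin d → ℕ) (n : ℕ) :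
    Submodule R (weightedRees x w) where
  carrier := {f | ∀ m, m ≠ n → (f : R[X]).coeff m = 0}
  add_mem' {f g} hf hg m hm := by simp [hf m hm, hg m hm]
  zero_mem' m _ := by simp
  smul_mem' r f hf m hm := by simp [hf m hm]

/-- The homogeneous component of degree `n`. -/
def weightedComponent (x : Fin d → R) (w : Fin d → ℕ) (n : ℕ) (f : weightedRees x w) :
    weightedGrading x w n :=
  ⟨⟨monomial n ((f : R[X]).coeff n), fun m => by
    rw [coeff_monomial]
    split_ifs with h
    · subst h
      exact f.2 n
    · exact Ideal.zero_mem _⟩, fun m hm => by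
    simp [coeff_monomial, hm.symm]⟩

instance weightedGrading.gradedMonoid (x : Fin d → R) (w : Fin d → ℕ) :
    SetLike.GradedMonoid (weightedGrading x w) where
  one_mem m hm := by simp [coeff_one, hm]
  mul_mem i j f g hf hg m hm := by
    simp only [MulMemClass.coe_mul, coeff_mul]
    refine Finset.sum_eq_zero ?_
    rintro ⟨a, b⟩ e
    rw [Finset.HasAntidiagonal.mem_antidiagonal] at e
    by_cases ha : a = i
    · have hb : b ≠ j := by
        rintro rfl
        exact hm (by rw [← e, ha])
      simp [hg b hb]
    · simp [hf a ha]

theorem coeff_coeAddMonoidHom (x : Fin d → R) (w : Fin d → ℕ)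
    (z : DirectSum ℕ fun n => weightedGrading x w n) (n : ℕ) :
    (DirectSum.coeAddMonoidHom (weightedGrading x w) z : R[X]).coeff n =
      ((z n : weightedRees x w) : R[X]).coeff n := by
  induction z using DirectSum.induction_on with
  | zero => simp
  | of i f =>
    rw [DirectSum.coeAddMonoidHom_of]
    by_cases h : i = n
    · subst h
      simp
    · rw [DirectSum.of_eq_of_ne _ _ _ (Ne.symm h), f.2 n (Ne.symm h)]
      simp
  | add a b ha hb => simp [ha, hb]

instance weightedGrading.decomposition (x : Fin d → R) (w : Fin d → ℕ) :
    DirectSum.Decomposition (weightedGrading x w) where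
  decompose' f := ∑ n ∈ (f : R[X]).support, DirectSum.of _ n (weightedComponent x w n f)
  left_inv f := by
    apply Subtype.ext
    simp only [map_sum, DirectSum.coeAddMonoidHom_of, AddSubmonoidClass.coe_finsetSum]
    exact (f : R[X]).as_sum_support.symm
  right_inv z := by
    have key : ∀ y z : DirectSum ℕ fun n => weightedGrading x w n,
        DirectSum.coeAddMonoidHom (weightedGrading x w) y =
          DirectSum.coeAddMonoidHom (weightedGrading x w) z → y = z := by
      intro y z h
      refine DFinsupp.ext fun n => Subtype.ext (Subtype.ext (Polynomial.ext fun m => ?_))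
      by_cases hm : m = n
      · subst hm
        rw [← coeff_coeAddMonoidHom, ← coeff_coeAddMonoidHom, h]
      · rw [(y n).2 m hm, (z n).2 m hm]
    apply key
    apply Subtype.ext
    simp only [map_sum, DirectSum.coeAddMonoidHom_of, AddSubmonoidClass.coe_finsetSum]
    exact (DirectSum.coeAddMonoidHom (weightedGrading x w) z : R[X]).as_sum_support.symm

instance weightedGrading.gradedAlgebra (x : Fin d → R) (w : Fin d → ℕ) :
    GradedAlgebra (weightedGrading x w) where

/-- The weighted blow-up `Proj (⨁ₙ I_n)` of `Spec R` with `wt(x₁, …, x_d) = (w₁, …, w_d)`. -/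
abbrev weightedBlowup (x : Fin d → R) (w : Fin d → ℕ) : Scheme :=
  Proj (weightedGrading x w)

/-- The homogeneous prime ideal of `⨁ₙ I_n tⁿ` which is the point `P` of the weighted blow-up. -/
def pointIdeal {x : Fin d → R} {w : Fin d → ℕ} (P : weightedBlowup x w) :
    Ideal (weightedRees x w) :=
  (show ProjectiveSpectrum (weightedGrading x w) from P).asHomogeneousIdeal.toIdeal

/-- The prime ideal of `R` which is the image of the point `P` in `Spec R`. -/
def belowIdeal {x : Fin d → R} {w : Fin d → ℕ} (P : weightedBlowup x w) : Ideal R :=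
  (pointIdeal P).comap (algebraMap R (weightedRees x w))

/-- The inverse image in the weighted blow-up of the closed subset `x₁ = ⋯ = x_d = 0`. When
`x₁, …, x_d` is a regular system of parameters of a local ring, it is the fibre over the closed
point. -/
def exceptionalLocus (x : Fin d → R) (w : Fin d → ℕ) : Set (weightedBlowup x w) :=
  {P | ∀ i, x i ∈ belowIdeal P}

/-- The strict transform in the weighted blow-up of the closed subset of `Spec R` defined by the
ideal `J`: the closure of the part of the inverse image outside the exceptional locus. -/
def strictTransform (x : Fin d → R) (w : Fin d → ℕ) (J : Ideal R) : Set (weightedBlowup x w) :=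
  closure ({P | J ≤ belowIdeal P} \ exceptionalLocus x w)

end Proj

/-! ### Germs, divisors and local rings inside a function field -/

variable {k K : Type*} [Field k] [Field K] [Algebra k K]

/-- The subalgebra `A` of `K` is the local ring `𝒪_{X,x}` at a closed point `x` of a smooth
variety `X` of dimension `d` over `k` with function field `K` (where `k` is algebraically
closed). -/
structure IsSmoothGerm (d : ℕ) (A : Subalgebra k K) : Prop where
  isFractionRing : IsFractionRing A K
  isLocalRing : IsLocalRing A
  essFiniteType : Algebra.EssFiniteType k A
  smooth : Algebra.FormallySmooth k A
  ringKrullDim_eq : ringKrullDim A = d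
  residueField : Function.Surjective (algebraMap k (ResidueField A))

/-- `x₁, …, x_d` is a regular system of parameters in the local ring `A`, of dimension `d`. -/
def IsRegularSystem {R : Type*} [CommRing R] {d : ℕ} (x : Fin d → R) : Prop :=
  ∃ _ : IsLocalRing R, ringKrullDim R = d ∧ Ideal.span (Set.range x) = maximalIdeal R

section LocalRing

variable {A : Subalgebra k K} {d : ℕ} {x : Fin d → A} {w : Fin d → ℕ}

/-- The value in `K` of an element of `⨁ₙ I_n tⁿ` at `t = 1`. -/
def evalOne (f : weightedRees x w) : K := ((f : A[X]).eval 1 : A)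

theorem evalOne_ne_zero {P : weightedBlowup x w} {n : ℕ} {g : weightedRees x w}
    (hg : g ∈ weightedGrading x w n) (hgP : g ∉ pointIdeal P) : evalOne g ≠ 0 := by
  intro h
  apply hgP
  have h0 : (g : A[X]) = monomial n ((g : A[X]).coeff n) := by
    ext m
    rw [coeff_monomial]
    split_ifs with e
    · rw [e]
    · rw [hg m (Ne.symm e)]
  have h1 : (g : A[X]).coeff n = 0 := by
    have h2 : (g : A[X]).eval 1 = 0 := Subtype.ext h
    rw [h0] at h2
    simpa using h2
  have h3 : g = 0 := Subtype.ext (by rw [h0, h1]; simp)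
  rw [h3]
  exact Ideal.zero_mem _

/-- The local ring of the weighted blow-up of `Spec A` at the point `P`, that is, the ring of the
fractions `f / g` of homogeneous elements of the same degree with `g` outside `P`, as a subring of
the function field `K`. -/
def localRingAt (P : weightedBlowup x w) : Subalgebra k K where
  carrier := {z | ∃ (n : ℕ) (f g : weightedRees x w), f ∈ weightedGrading x w n ∧
    g ∈ weightedGrading x w n ∧ g ∉ pointIdeal P ∧ z = evalOne f / evalOne g}
  mul_mem' := by
    rintro _ _ ⟨m, f, g, hf, hg, hgP, rfl⟩ ⟨n, f', g', hf', hg', hgP', rfl⟩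
    have hP : (pointIdeal P).IsPrime := ProjectiveSpectrum.isPrime _
    refine ⟨m + n, f * f', g * g', SetLike.mul_mem_graded hf hf', SetLike.mul_mem_graded hg hg',
      fun h => (hP.mem_or_mem h).elim hgP hgP', ?_⟩
    simp [evalOne, div_mul_div_comm]
  add_mem' := by
    rintro _ _ ⟨m, f, g, hf, hg, hgP, rfl⟩ ⟨n, f', g', hf', hg', hgP', rfl⟩
    have hP : (pointIdeal P).IsPrime := ProjectiveSpectrum.isPrime _
    refine ⟨m + n, f * g' + g * f', g * g',
      add_mem (SetLike.mul_mem_graded hf hg') (SetLike.mul_mem_graded hg hf'),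
      SetLike.mul_mem_graded hg hg', fun h => (hP.mem_or_mem h).elim hgP hgP', ?_⟩
    rw [div_add_div _ _ (evalOne_ne_zero hg hgP) (evalOne_ne_zero hg' hgP')]
    simp [evalOne]
  algebraMap_mem' c := by
    have hP : (pointIdeal P).IsPrime := ProjectiveSpectrum.isPrime _
    refine ⟨0, algebraMap A _ (algebraMap k A c), 1, ?_, SetLike.one_mem_graded _,
      fun h => hP.ne_top ((Ideal.eq_top_iff_one _).2 h), ?_⟩
    · intro m hm
      simp [coeff_C, hm]
    · simp [evalOne]

end LocalRing

variable (k K) in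
/-- A prime divisor on some normal variety over `k` with function field `K`, given by its local
ring, which is a discrete valuation ring of `K` essentially of finite type over `k`. Two divisors
which define the same valuation on `K` are identified. -/
@[ext]
structure Divisor where
  ring : Subalgebra k K
  isFractionRing : IsFractionRing ring K
  isDVR : IsDiscreteValuationRing ring
  essFiniteType : Algebra.EssFiniteType k ring

instance (E : Divisor k K) : IsDiscreteValuationRing E.ring := E.isDVR

/-- `E` is a divisor over the germ `x ∈ X` with local ring `A` and its centre on `X` is `x`: the
local ring of `E` dominates `A`. -/
def Divisor.HasCentre (E : Divisor k K) (A : Subalgebra k K) : Prop :=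
  A ≤ E.ring ∧ ∀ (a : A) (b : E.ring), (a : K) = b → IsUnit b → IsUnit a

/-- The order `ord_E I` of an ideal `I` in `A`: the supremum of the `ν` such that `I` is contained
in the `ν`-th power of the maximal ideal of the local ring of `E`. -/
def Divisor.ord (E : Divisor k K) {A : Subalgebra k K} (I : Ideal A) : ℕ∞ :=
  ⨆ (ν : ℕ) (_ : ∀ f ∈ I, ∃ g ∈ maximalIdeal E.ring ^ ν, (g : K) = f), (ν : ℕ∞)

/-- An `ℝ`-ideal: a formal product `∏ⱼ 𝔞ⱼ^{rⱼ}` of finitely many ideals with positive real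
exponents. -/
structure RIdeal (R : Type*) [CommRing R] where
  length : ℕ
  ideal : Fin length → Ideal R
  exponent : Fin length → ℝ
  exponent_pos : ∀ j, 0 < exponent j

/-- The order `ord_E 𝔞 = ∑ⱼ rⱼ ord_E 𝔞ⱼ` of an `ℝ`-ideal. -/
def Divisor.ordRIdeal (E : Divisor k K) {A : Subalgebra k K} (𝔞 : RIdeal A) : ENNReal :=
  ∑ j, ENNReal.ofReal (𝔞.exponent j) * (E.ord (𝔞.ideal j) : ENNReal)

/-- The order along `E` of the relative canonical divisor `K_Y - π^* K_X`, for a model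
`π : E ⊂ Y → X` of a divisor `E` over the germ `X` of a smooth threefold with local ring `A`: the
order of vanishing along `E` of the pull-back `π^* ω_X → ω_Y` of regular `3`-forms. -/
def Divisor.canonicalOrder (E : Divisor k K) (A : Subalgebra k K) : ℕ∞ :=
  ⨆ (ν : ℕ) (_ : ∀ a : Fin 3 → E.ring, (∀ i, (a i : K) ∈ A) →
      exteriorPower.ιMulti E.ring 3 (fun i => KaehlerDifferential.D k E.ring (a i)) ∈
        (maximalIdeal E.ring ^ ν •
          (⊤ : Submodule E.ring (⋀[E.ring]^3 Ω[E.ring⁄k])))), (ν : ℕ∞)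

/-- The log discrepancy `a_E(X, 𝔞) = 1 + ord_E K_{Y/X} - ord_E 𝔞` on the germ of a smooth
threefold with local ring `A`. -/
def logDiscrepancy (A : Subalgebra k K) (𝔞 : RIdeal A) (E : Divisor k K) : EReal :=
  1 + ((E.canonicalOrder A : ENNReal) : EReal) - (E.ordRIdeal 𝔞 : EReal)

/-- The minimal log discrepancy `mld_x(X, 𝔞)` on the germ of a smooth threefold with local ring
`A`. -/
def mld (A : Subalgebra k K) (𝔞 : RIdeal A) : EReal :=
  sInf {a | ∃ E : Divisor k K, E.HasCentre A ∧ a = logDiscrepancy A 𝔞 E}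

/-- `E` is the exceptional divisor of the weighted blow-up of the germ with local ring `A` with
`wt(x₁, …, x_d) = (w₁, …, w_d)`: its local ring is the local ring at the generic point of the
exceptional locus. -/
def IsExceptionalDivisor {A : Subalgebra k K} {d : ℕ} (x : Fin d → A) (w : Fin d → ℕ)
    (E : Divisor k K) : Prop :=
  ∃ η : weightedBlowup x w, IsGenericPoint η (exceptionalLocus x w) ∧ E.ring = localRingAt η

/-- The ideal `𝒪_Y(-mE)` in the local ring `B` of `Y`. -/
def divisorialIdeal (E : Divisor k K) (B : Subalgebra k K) (m : ℕ∞) : Ideal B :=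
  Ideal.span {g | m ≤ E.ord (Ideal.span {g})}

/-- The weak transform `𝔟 = 𝔞 𝒪_Y((ord_E 𝔞) E)` in the local ring `B` of `Y` of an ideal `𝔞` of
`A`, formed as the ideal quotient of `𝔞 𝒪_Y` by `𝒪_Y(-(ord_E 𝔞) E)`. -/
def weakTransformIdeal (E : Divisor k K) {A : Subalgebra k K} (B : Subalgebra k K)
    (I : Ideal A) : Ideal B :=
  (Ideal.span {b : B | ∃ a ∈ I, (b : K) = a}).colon (divisorialIdeal E B (E.ord I) : Set B)

/-- The weak transform `∏ⱼ (𝔞_{jY})^{rⱼ}` of an `ℝ`-ideal `∏ⱼ 𝔞ⱼ^{rⱼ}`. -/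
def weakTransform (E : Divisor k K) {A : Subalgebra k K} (B : Subalgebra k K)
    (𝔞 : RIdeal A) : RIdeal B where
  length := 𝔞.length
  ideal j := weakTransformIdeal E B (𝔞.ideal j)
  exponent := 𝔞.exponent
  exponent_pos := 𝔞.exponent_pos

end WeightedBlowup

end

/-! Put t = x_3. Near y the germ Y has coordinates u_1 = x_1/t^{w_1}, u_2 = x_2/t^{w_2}, t, and F is
a monomial valuation of weights (v_1, v_2, 1) in y_1, y_2, t. It suffices to find a triangular
change x_2' = x_2 - τ(t), x_1' = x_1 - η(x_2', t) such that x_1', x_2' have orders at least α =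
w_1+v_1-d and β = w_2+v_2+d along F. Such a change does not affect the Jacobian with respect to y_1,
y_2, which is a unit times t^{w_1+w_2}. Since α+β = w_1+w_2+v_1+v_2, the elements x_1'/t^α and
x_2'/t^β have unit Jacobian for the derivations t^{v_i}∂/∂y_i of the valuation ring. In
characteristic zero their residues are then algebraically independent, so F is monomial in x_1',
x_2', t (`BlowupTower.isExceptionalDivisor`).

The numerical hypothesis says that a w_2 + v_1^2 ≤ w_1 whenever a v_2 < v_1. It ensures that t^{w_1}
times a suitable polynomial in the new second coordinate of Y is a polynomial in x_2' and t. There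
are three cases. (1) If v_1 = v_2, both u_i are polynomials in t up to order v_1, and d = 0. (2) If
∂u_2/∂y_2 is a unit, then s = u_2 - τ(t) serves as the coordinate of weight v_2 and u_1 is a
polynomial in s, t up to order v_1; again d = 0. (3) Otherwise v_2 < v_1 and s = u_1 - τ_0(t) has
weight v_2, while u_2 = τ_1(t) + p(s,t) + y with y of order at least v_1, every term of p being
divisible by s and of weight less than v_1. If p = 0, then d = v_1 - v_2. Otherwise one shows that
the initial term of p is s t^j with j ≥ 1 and that the Newton polygon of p stays above the line
joining (1, j) to (v_1/v_2, 0). Then U = p + y has order at least v_2 + j, the relation U = c s t^j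
+ ... can be inverted for s up to order v_1 - j, and d = j.

The heart is the claim about the polygon in case (3), the only place where mld = 1 is used for a
third divisor (`no_steep_initial_form`). Suppose that a face of too small weight contains an
exponent of degree at least 2 in s. Let G be given by weights (w_1-j-1, w_2, 1) in x_1 - t^{w_1}τ_0,
x_2 - t^{w_2}τ_1, t. For f in one of the ideals, compare the initial form of f along the face with
that of p, and let M be the multiplicity of the latter as a root of the former. A large order of f
along F forces M to be large, whereas (X - p)^M contributes degree at least 2M in s, which is
limited by the orders along E and G (`exists_slope_data`). Eliminating M gives an inequality linear
in the orders along E, F and G. Summed with the exponents of the R-ideal, it contradicts a_E = a_F =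
1 and a_G ≥ 1.

The foundations rest on derivations dual to a regular system of parameters, which exist by
smoothness. They show that the graded ring of the filtration I_n is a polynomial ring, identify
exceptional divisors with monomial valuations (`IsMonomial`) and compute relative canonical orders.
-/

noncomputable section

open Polynomial AlgebraicGeometry IsLocalRing

namespace WeightedBlowup

variable {k K : Type*} [Field k] [Field K] [Algebra k K]

/-! ### Weighted ideals -/

section WeightedIdeal

variable {R : Type*} [CommRing R] {d : ℕ} (x : Fin d → R) (w : Fin d → ℕ)

theorem weightedIdeal_antitone : Antitone (weightedIdeal x w) := fun _ _ h =>
  Ideal.span_mono fun _ ⟨s, hs, e⟩ => ⟨s, h.trans hs, e⟩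

theorem monomial_mem_weightedIdeal {n : ℕ} (s : Fin d → ℕ) (h : n ≤ ∑ i, w i * s i) :
    ∏ i, x i ^ s i ∈ weightedIdeal x w n :=
  Ideal.subset_span ⟨s, h, rfl⟩

theorem mul_mem_weightedIdeal {m n : ℕ} {f g : R} (hf : f ∈ weightedIdeal x w m)
    (hg : g ∈ weightedIdeal x w n) : f * g ∈ weightedIdeal x w (m + n) :=
  weightedIdeal_mul_le x w m n (Ideal.mul_mem_mul hf hg)

theorem coord_mem_weightedIdeal (i : Fin d) : x i ∈ weightedIdeal x w (w i) := by
  have := monomial_mem_weightedIdeal x w (n := w i) (Pi.single i 1) (by simp [Pi.single_apply])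
  simpa [Pi.single_apply, pow_ite] using this

theorem pow_mem_weightedIdeal {m : ℕ} {f : R} (hf : f ∈ weightedIdeal x w m) (n : ℕ) :
    f ^ n ∈ weightedIdeal x w (n * m) := by
  induction n with
  | zero => simp [weightedIdeal_zero]
  | succ n ih =>
    rw [pow_succ, add_mul, one_mul]
    exact mul_mem_weightedIdeal x w ih hf

theorem weightedIdeal_one_eq_span (hw : ∀ i, 0 < w i) :
    weightedIdeal x w 1 = Ideal.span (Set.range x) := by
  apply le_antisymm
  · rw [weightedIdeal, Ideal.span_le]
    rintro _ ⟨s, hs, rfl⟩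
    obtain ⟨i, -, hi⟩ : ∃ i ∈ Finset.univ, w i * s i ≠ 0 :=
      Finset.exists_ne_zero_of_sum_ne_zero (by omega)
    have hi : s i ≠ 0 := right_ne_zero_of_mul hi
    have h1 : x i ∈ Ideal.span (Set.range x) := Ideal.subset_span ⟨i, rfl⟩
    exact Ideal.mem_of_dvd _ ((dvd_pow_self (x i) hi).trans
      (Finset.dvd_prod_of_mem (fun i => x i ^ s i) (Finset.mem_univ i))) h1
  · rw [Ideal.span_le]
    rintro _ ⟨i, rfl⟩
    exact weightedIdeal_antitone x w (hw i) (coord_mem_weightedIdeal x w i)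

end WeightedIdeal

/-! ### Coordinate systems with dual derivations -/

/-- `x₁, x₂, x₃` generate the maximal ideal of the local ring `A` with residue field `k`, and
`D₁, D₂, D₃` are derivations of `K` preserving `A` which are dual to `x₁, x₂, x₃`. -/
structure CoordSystem (A : Subalgebra k K) (x : Fin 3 → A) (D : Fin 3 → Derivation k K K) :
    Prop where
  mem_span_iff : ∀ a : A, a ∈ Ideal.span (Set.range x) ↔ ¬ IsUnit a
  exists_const : ∀ a : A, ∃ c : k, a - algebraMap k A c ∈ Ideal.span (Set.range x)
  map_mem : ∀ i, ∀ a ∈ A, D i a ∈ A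
  map_coord : ∀ i j, D i (x j) = if i = j then 1 else 0

/-- The restriction to `A` of a derivation of `K` which preserves `A`. -/
def restrictDerivation (A : Subalgebra k K) (D : Derivation k K K) (h : ∀ a ∈ A, D a ∈ A) :
    Derivation k A A :=
  Derivation.mk'
    { toFun := fun a => ⟨D a, h a a.2⟩
      map_add' := fun a b => Subtype.ext (by simp)
      map_smul' := fun c a => Subtype.ext (by simp) }
    fun a b => Subtype.ext (by simp)

theorem aeval_derivation {S : Type*} [CommRing S] [Algebra k S] {σ : Type*} [Fintype σ]
    (D : Derivation k S S) (u : σ → S) (P : MvPolynomial σ k) :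
    D (MvPolynomial.aeval u P) =
      ∑ i, MvPolynomial.aeval u (MvPolynomial.pderiv i P) * D (u i) := by
  classical
  induction P using MvPolynomial.induction_on with
  | C a => simp [← MvPolynomial.algebraMap_eq]
  | add p q hp hq => simp [hp, hq, add_mul, Finset.sum_add_distrib]
  | mul_X p j hp =>
    simp only [map_mul, MvPolynomial.aeval_X, Derivation.leibniz, hp, MvPolynomial.pderiv_X,
      map_add, smul_eq_mul, add_mul, Finset.sum_add_distrib, Finset.mul_sum]
    congr 1
    · rw [Finset.sum_eq_single j]
      · simp
      · intro i _ hi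
        simp [hi.symm]
      · simp
    · exact Finset.sum_congr rfl fun i _ => by ring

theorem eq_C_of_pderiv_eq_zero {σ : Type*} [CharZero k] (P : MvPolynomial σ k)
    (h : ∀ i, MvPolynomial.pderiv i P = 0) : P = MvPolynomial.C (P.coeff 0) := by
  classical
  ext m
  rw [MvPolynomial.coeff_C]
  split_ifs with hm
  · rw [hm]
  · obtain ⟨i, hi⟩ : ∃ i, m i ≠ 0 := by
      by_contra! h0
      exact hm (Finsupp.ext fun i => (h0 i).symm)
    have h1 := MvPolynomial.coeff_pderiv (i := i) P (m - Finsupp.single i 1)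
    rw [h i, MvPolynomial.coeff_zero, tsub_add_cancel_of_le (by
      rw [Finsupp.single_le_iff]; omega)] at h1
    have h2 := mul_eq_zero.1 h1.symm
    refine h2.resolve_right ?_
    norm_cast

theorem aeval_mem_weightedIdeal {A : Subalgebra k K} (x : Fin 3 → A) (w : Fin 3 → ℕ) {n : ℕ}
    {P : MvPolynomial (Fin 3) k} (hP : ∀ s ∈ P.support, n ≤ ∑ i, w i * s i) :
    MvPolynomial.aeval x P ∈ weightedIdeal x w n := by
  rw [MvPolynomial.aeval_def, MvPolynomial.eval₂_eq']
  refine Ideal.sum_mem _ fun s hs => ?_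
  exact Ideal.mul_mem_left _ _ (monomial_mem_weightedIdeal x w s (hP s hs))

theorem weight_eq_sum (w : Fin 3 → ℕ) (s : Fin 3 →₀ ℕ) :
    Finsupp.weight w s = ∑ i, w i * s i := by
  rw [Finsupp.weight_apply, Finsupp.sum_fintype _ _ (by simp)]
  simp [mul_comm]

theorem aeval_mem_weightedIdeal_of_isWeightedHomogeneous {A : Subalgebra k K} (x : Fin 3 → A)
    (w : Fin 3 → ℕ) {n : ℕ} {P : MvPolynomial (Fin 3) k} (hP : P.IsWeightedHomogeneous w n) :
    MvPolynomial.aeval x P ∈ weightedIdeal x w n :=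
  aeval_mem_weightedIdeal x w fun s hs => by
    rw [← weight_eq_sum, hP (MvPolynomial.mem_support_iff.1 hs)]

/-! ### The associated graded ring of the weighted filtration. -/

namespace CoordSystem

variable {A : Subalgebra k K} {x : Fin 3 → A} {D : Fin 3 → Derivation k K K}

/-- The restrictions of the dual derivations to `A`. -/
def der (h : CoordSystem A x D) (i : Fin 3) : Derivation k A A :=
  restrictDerivation A (D i) (h.map_mem i)

theorem coe_der (h : CoordSystem A x D) (i : Fin 3) (a : A) : (h.der i a : K) = D i a := rfl

theorem der_coord (h : CoordSystem A x D) (i j : Fin 3) :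
    h.der i (x j) = if i = j then 1 else 0 :=
  Subtype.ext (by rw [coe_der, h.map_coord]; split_ifs <;> rfl)

theorem der_aeval (h : CoordSystem A x D) (i : Fin 3) (P : MvPolynomial (Fin 3) k) :
    h.der i (MvPolynomial.aeval x P) = MvPolynomial.aeval x (MvPolynomial.pderiv i P) := by
  rw [aeval_derivation, Finset.sum_eq_single i]
  · simp [der_coord]
  · intro j _ hj
    simp [der_coord, hj.symm]
  · simp

theorem der_mem_weightedIdeal (h : CoordSystem A x D) (w : Fin 3 → ℕ) (i : Fin 3) {n : ℕ} {f : A}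
    (hf : f ∈ weightedIdeal x w n) : h.der i f ∈ weightedIdeal x w (n - w i) := by
  induction hf using Submodule.span_induction with
  | mem f hf =>
    obtain ⟨s, hs, rfl⟩ := hf
    have e : ∏ j, x j ^ s j = MvPolynomial.aeval x
        (MvPolynomial.monomial (Finsupp.equivFunOnFinite.symm s) (1 : k)) := by
      simp [MvPolynomial.aeval_monomial, Finsupp.prod_fintype]
    rw [e, der_aeval, MvPolynomial.pderiv_monomial]
    refine aeval_mem_weightedIdeal x w fun t ht => ?_
    classical
    have ht := MvPolynomial.support_monomial_subset ht
    rw [Finset.mem_singleton] at ht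
    -- When `s i = 0` the derivative is zero, but truncated subtraction leaves the exponent `s`,
    -- which still satisfies the weight bound.
    by_cases hi : s i = 0
    · have : (Finsupp.equivFunOnFinite.symm s - Finsupp.single i 1 : Fin 3 →₀ ℕ) =
          Finsupp.equivFunOnFinite.symm s := by
        ext j
        by_cases hj : i = j
        · subst hj; simp [hi]
        · simp [hj]
      rw [ht, this]
      exact (Nat.sub_le _ _).trans hs
    · have h1 : Finsupp.weight w t + w i =
          Finsupp.weight w (Finsupp.equivFunOnFinite.symm s) := by
        have h2 : t + Finsupp.single i 1 = Finsupp.equivFunOnFinite.symm s := by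
          rw [ht, tsub_add_cancel_of_le]
          rw [Finsupp.single_le_iff]
          exact Nat.one_le_iff_ne_zero.2 hi
        rw [← h2, map_add]
        simp [Finsupp.weight_single]
      rw [weight_eq_sum, weight_eq_sum] at h1
      have h3 : ∑ j, w j * (Finsupp.equivFunOnFinite.symm s) j = ∑ j, w j * s j := rfl
      omega
  | zero => simp
  | add f g _ _ hf hg => rw [map_add]; exact add_mem hf hg
  | smul a f hf' hf =>
    rw [smul_eq_mul, Derivation.leibniz, smul_eq_mul, smul_eq_mul]
    exact add_mem (Ideal.mul_mem_left _ _ hf)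
      (Ideal.mul_mem_right _ _ (weightedIdeal_antitone x w (Nat.sub_le _ _) hf'))

/-- The residue field is k and the maximal ideal is I_1, so modulo I_{n+1} a coefficient matters
only through its constant term, and I_n/I_{n+1} is spanned over k by the monomials of weight exactly
n. -/
theorem exists_homogeneous (h : CoordSystem A x D) {w : Fin 3 → ℕ} (hw : ∀ i, 0 < w i) {n : ℕ}
    {f : A} (hf : f ∈ weightedIdeal x w n) :
    ∃ P : MvPolynomial (Fin 3) k, P.IsWeightedHomogeneous w n ∧
      f - MvPolynomial.aeval x P ∈ weightedIdeal x w (n + 1) := by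
  induction hf using Submodule.span_induction with
  | mem f hf =>
    obtain ⟨s, hs, rfl⟩ := hf
    rcases hs.eq_or_lt with hs | hs
    · refine ⟨MvPolynomial.monomial (Finsupp.equivFunOnFinite.symm s) 1,
        MvPolynomial.isWeightedHomogeneous_monomial _ _ _ ?_, ?_⟩
      · rw [weight_eq_sum]
        exact hs.symm
      · simp [MvPolynomial.aeval_monomial, Finsupp.prod_fintype]
    · refine ⟨0, MvPolynomial.isWeightedHomogeneous_zero _ _ _, ?_⟩
      rw [map_zero, sub_zero]
      exact monomial_mem_weightedIdeal x w s hs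
  | zero => exact ⟨0, MvPolynomial.isWeightedHomogeneous_zero _ _ _, by simp⟩
  | add f g _ _ hf hg =>
    obtain ⟨P, hP, hP'⟩ := hf
    obtain ⟨Q, hQ, hQ'⟩ := hg
    refine ⟨P + Q, hP.add hQ, ?_⟩
    rw [map_add, add_sub_add_comm]
    exact add_mem hP' hQ'
  | smul a f hf' hf =>
    obtain ⟨P, hP, hP'⟩ := hf
    obtain ⟨c, hc⟩ := h.exists_const a
    refine ⟨MvPolynomial.C c * P, hP.C_mul c, ?_⟩
    rw [← weightedIdeal_one_eq_span x w hw] at hc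
    have := add_mem (mul_mem_weightedIdeal x w hf' hc)
      (Ideal.mul_mem_left _ (algebraMap k A c) hP')
    rw [map_mul, ← MvPolynomial.algebraMap_eq, AlgHom.commutes, smul_eq_mul]
    convert this using 1
    ring

/-- Monomials of weight n are independent in I_n/I_{n+1}. Differentiation by `der i` commutes with
evaluation and lowers the weight by w_i, so induction kills every partial derivative of P; in
characteristic zero P is constant, and a nonzero constant is a unit outside I_1. -/
theorem eq_zero_of_aeval_mem [CharZero k] (h : CoordSystem A x D) {w : Fin 3 → ℕ}
    (hw : ∀ i, 0 < w i) (n : ℕ) (P : MvPolynomial (Fin 3) k) (hP : P.IsWeightedHomogeneous w n)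
    (hx : MvPolynomial.aeval x P ∈ weightedIdeal x w (n + 1)) : P = 0 := by
  induction n using Nat.strong_induction_on generalizing P with
  | _ n ih =>
  have hd : ∀ i, MvPolynomial.pderiv i P = 0 := by
    intro i
    rcases le_or_gt (w i) n with hi | hi
    · refine ih (n - w i) (by have := hw i; omega) _ (hP.pderiv (by omega)) ?_
      rw [← h.der_aeval, show n - w i + 1 = n + 1 - w i by omega]
      exact h.der_mem_weightedIdeal w i hx
    · apply MvPolynomial.pderiv_eq_zero_of_notMem_vars
      rw [MvPolynomial.mem_vars_iff_mem_support]
      rintro ⟨s, hs, hi'⟩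
      have h1 := hP (MvPolynomial.mem_support_iff.1 hs)
      rw [weight_eq_sum] at h1
      have h2 : w i * s i ≤ ∑ i, w i * s i :=
        Finset.single_le_sum (f := fun i => w i * s i) (fun _ _ => Nat.zero_le _)
          (Finset.mem_univ i)
      have h3 : 1 ≤ s i := Nat.one_le_iff_ne_zero.2 (Finsupp.mem_support_iff.1 hi')
      nlinarith
  have hC := eq_C_of_pderiv_eq_zero P hd
  by_contra h0
  have hc : P.coeff 0 ≠ 0 := fun hc => h0 (by rw [hC, hc, map_zero])
  have h1 : MvPolynomial.aeval x P ∈ Ideal.span (Set.range x) := by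
    rw [← weightedIdeal_one_eq_span x w hw]
    exact weightedIdeal_antitone x w (by omega) hx
  rw [hC, ← MvPolynomial.algebraMap_eq, AlgHom.commutes, h.mem_span_iff] at h1
  exact h1 ((IsUnit.mk0 _ hc).map (algebraMap k A))

/-- The graded ring is a polynomial ring, hence a domain: the product of the initial forms of f and
g vanishes only if one of them does. -/
theorem mem_or_mem_of_mul_mem [CharZero k] (h : CoordSystem A x D) {w : Fin 3 → ℕ}
    (hw : ∀ i, 0 < w i) {m n : ℕ} {f g : A} (hf : f ∈ weightedIdeal x w m)
    (hg : g ∈ weightedIdeal x w n) (hfg : f * g ∈ weightedIdeal x w (m + n + 1)) :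
    f ∈ weightedIdeal x w (m + 1) ∨ g ∈ weightedIdeal x w (n + 1) := by
  obtain ⟨P, hP, hP'⟩ := h.exists_homogeneous hw hf
  obtain ⟨Q, hQ, hQ'⟩ := h.exists_homogeneous hw hg
  have h1 : MvPolynomial.aeval x (P * Q) ∈ weightedIdeal x w (m + n + 1) := by
    have h2 := mul_mem_weightedIdeal x w hf hQ'
    have h3 := mul_mem_weightedIdeal x w
      (aeval_mem_weightedIdeal_of_isWeightedHomogeneous x w hQ) hP'
    rw [← add_assoc] at h2
    rw [show n + (m + 1) = m + n + 1 by ring] at h3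
    have := sub_mem (sub_mem hfg h2) h3
    rw [map_mul]
    convert this using 1
    ring
  rcases mul_eq_zero.1 (h.eq_zero_of_aeval_mem hw _ _ (hP.mul hQ) h1) with h0 | h0
  · left
    simpa [h0] using hP'
  · right
    simpa [h0] using hQ'

theorem one_notMem (h : CoordSystem A x D) {w : Fin 3 → ℕ} (hw : ∀ i, 0 < w i) :
    (1 : A) ∉ weightedIdeal x w 1 := by
  rw [weightedIdeal_one_eq_span x w hw, h.mem_span_iff]
  simp

theorem coord_notMem [CharZero k] (h : CoordSystem A x D) {w : Fin 3 → ℕ} (hw : ∀ i, 0 < w i)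
    (i : Fin 3) : x i ∉ weightedIdeal x w (w i + 1) := by
  intro hi
  have := h.der_mem_weightedIdeal w i hi
  rw [der_coord, if_pos rfl, show w i + 1 - w i = 1 by omega] at this
  exact h.one_notMem hw this

end CoordSystem

end WeightedBlowup

end

noncomputable section

open Polynomial AlgebraicGeometry IsLocalRing

namespace WeightedBlowup

/-! ### Points of weighted blow-ups -/

section Rees

variable {R : Type*} [CommRing R] {d : ℕ} {x : Fin d → R} {w : Fin d → ℕ}

/-- The homogeneous element `f tⁿ` of `⨁ₙ I_n tⁿ`. -/
def reesMonomial {n : ℕ} {f : R} (hf : f ∈ weightedIdeal x w n) : weightedRees x w :=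
  ⟨monomial n f, fun m => by
    rw [coeff_monomial]
    split_ifs with h
    · subst h
      exact hf
    · exact Ideal.zero_mem _⟩

theorem coe_reesMonomial {n : ℕ} {f : R} (hf : f ∈ weightedIdeal x w n) :
    (reesMonomial hf : R[X]) = monomial n f := rfl

theorem reesMonomial_mem {n : ℕ} {f : R} (hf : f ∈ weightedIdeal x w n) :
    reesMonomial hf ∈ weightedGrading x w n := fun m hm => by
  rw [coe_reesMonomial, coeff_monomial, if_neg hm.symm]

theorem eq_reesMonomial {n : ℕ} {f : weightedRees x w} (hf : f ∈ weightedGrading x w n) :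
    f = reesMonomial (f.2 n) := by
  apply Subtype.ext
  ext m
  rw [coe_reesMonomial, coeff_monomial]
  split_ifs with h
  · rw [h]
  · exact hf m (Ne.symm h)

theorem reesMonomial_mul {m n : ℕ} {f g : R} (hf : f ∈ weightedIdeal x w m)
    (hg : g ∈ weightedIdeal x w n) :
    reesMonomial hf * reesMonomial hg = reesMonomial (mul_mem_weightedIdeal x w hf hg) :=
  Subtype.ext (monomial_mul_monomial m n f g)

theorem reesMonomial_pow {m : ℕ} {f : R} (hf : f ∈ weightedIdeal x w m) (n : ℕ) :
    reesMonomial hf ^ n = reesMonomial (pow_mem_weightedIdeal x w hf n) :=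
  Subtype.ext (by
    rw [SubmonoidClass.coe_pow, coe_reesMonomial, coe_reesMonomial, monomial_pow, mul_comm])

theorem coe_decompose (f : weightedRees x w) (n : ℕ) :
    (DirectSum.decompose (weightedGrading x w) f n : weightedRees x w) =
      reesMonomial (f.2 n) := by
  have h := eq_reesMonomial (DirectSum.decompose (weightedGrading x w) f n).2
  rw [h]
  have h1 := coeff_coeAddMonoidHom x w (DirectSum.decompose (weightedGrading x w) f) n
  have h2 : DirectSum.coeAddMonoidHom (weightedGrading x w)
      (DirectSum.decompose (weightedGrading x w) f) = f :=
    (DirectSum.decompose (weightedGrading x w)).symm_apply_apply f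
  rw [h2] at h1
  apply Subtype.ext
  rw [coe_reesMonomial, coe_reesMonomial, h1]

/-- `g` is an element of `I_n` such that `g tⁿ` does not vanish at the point `P`. -/
def IsDenominator (P : weightedBlowup x w) (n : ℕ) (g : R) : Prop :=
  ∃ hg : g ∈ weightedIdeal x w n, reesMonomial hg ∉ pointIdeal P

theorem pointIdeal_isPrime (P : weightedBlowup x w) : (pointIdeal P).IsPrime :=
  ProjectiveSpectrum.isPrime _

theorem IsDenominator.mul {P : weightedBlowup x w} {m n : ℕ} {f g : R}
    (hf : IsDenominator P m f) (hg : IsDenominator P n g) : IsDenominator P (m + n) (f * g) :=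
  ⟨mul_mem_weightedIdeal x w hf.1 hg.1, fun h => by
    rw [← reesMonomial_mul hf.1 hg.1] at h
    exact ((pointIdeal_isPrime P).mem_or_mem h).elim hf.2 hg.2⟩

theorem IsDenominator.one (P : weightedBlowup x w) : IsDenominator P 0 (1 : R) :=
  ⟨by simp [weightedIdeal_zero], fun h => (pointIdeal_isPrime P).ne_top
    ((Ideal.eq_top_iff_one _).2 h)⟩

theorem IsDenominator.pow {P : weightedBlowup x w} {m : ℕ} {f : R}
    (hf : IsDenominator P m f) (n : ℕ) : IsDenominator P (n * m) (f ^ n) := by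
  induction n with
  | zero => simpa using IsDenominator.one P
  | succ n ih =>
    rw [pow_succ, add_mul, one_mul]
    exact ih.mul hf

theorem IsDenominator.ne_zero {P : weightedBlowup x w} {m : ℕ} {f : R}
    (hf : IsDenominator P m f) : f ≠ 0 := by
  rintro rfl
  refine hf.2 ?_
  have : reesMonomial hf.1 = 0 := Subtype.ext (by simp [coe_reesMonomial])
  rw [this]
  exact Ideal.zero_mem _

theorem isDenominator_zero_iff {P : weightedBlowup x w} {f : R} :
    IsDenominator P 0 f ↔ f ∉ belowIdeal P := by
  have h : f ∈ weightedIdeal x w 0 := by simp [weightedIdeal_zero]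
  have e : reesMonomial h = algebraMap R (weightedRees x w) f := Subtype.ext (by
    rw [coe_reesMonomial, monomial_zero_left]; rfl)
  constructor
  · rintro ⟨h1, h2⟩ h3
    exact h2 (by rw [e]; exact h3)
  · intro h1
    exact ⟨h, fun h2 => h1 (by rw [e] at h2; exact h2)⟩

theorem le_iff_specializes {P Q : weightedBlowup x w} :
    pointIdeal P ≤ pointIdeal Q ↔ P ⤳ Q := by
  rw [specializes_iff_mem_closure]
  exact ProjectiveSpectrum.le_iff_mem_closure (𝒜 := weightedGrading x w) P Q

/-- The ideal of the elements `∑ fₙ tⁿ` with `fₙ ∈ I_{n+1}`. -/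
def initialIdeal (x : Fin d → R) (w : Fin d → ℕ) : Ideal (weightedRees x w) where
  carrier := {f | ∀ n, (f : R[X]).coeff n ∈ weightedIdeal x w (n + 1)}
  add_mem' {f g} hf hg n := by
    rw [AddMemClass.coe_add, coeff_add]
    exact add_mem (hf n) (hg n)
  zero_mem' n := by simp
  smul_mem' a f hf n := by
    rw [smul_eq_mul, MulMemClass.coe_mul, coeff_mul]
    refine Ideal.sum_mem _ ?_
    rintro ⟨i, j⟩ e
    rw [← Finset.HasAntidiagonal.mem_antidiagonal.mp e, add_assoc]
    exact mul_mem_weightedIdeal x w (a.2 i) (hf j)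

theorem mem_initialIdeal {f : weightedRees x w} :
    f ∈ initialIdeal x w ↔ ∀ n, (f : R[X]).coeff n ∈ weightedIdeal x w (n + 1) := Iff.rfl

theorem reesMonomial_mem_initialIdeal {n : ℕ} {f : R} (hf : f ∈ weightedIdeal x w n) :
    reesMonomial hf ∈ initialIdeal x w ↔ f ∈ weightedIdeal x w (n + 1) := by
  rw [mem_initialIdeal]
  simp only [coe_reesMonomial, coeff_monomial]
  constructor
  · intro h
    simpa using h n
  · intro h m
    split_ifs with e
    · exact e ▸ h
    · exact Ideal.zero_mem _

theorem initialIdeal_isHomogeneous : (initialIdeal x w).IsHomogeneous (weightedGrading x w) := by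
  intro n f hf
  rw [coe_decompose, reesMonomial_mem_initialIdeal]
  exact hf n

/-- The power w_i is chosen so that splitting off one factor x_i costs the weight of x^s at most
one. Prime ideals detect membership on powers, which makes this enough to place monomials in a point
of Proj. -/
theorem exists_monomial_pow_eq (hw : ∀ i, 0 < w i) (s : Fin d → ℕ) (hs : ∑ i, w i * s i ≠ 0) :
    ∃ (i : Fin d) (m : Fin d → ℕ), (∏ j, x j ^ s j) ^ w i = x i * ∏ j, x j ^ m j ∧
      ∑ j, w j * m j + w i = w i * ∑ j, w j * s j := by
  obtain ⟨i, -, hi⟩ := Finset.exists_ne_zero_of_sum_ne_zero hs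
  have hi : s i ≠ 0 := right_ne_zero_of_mul hi
  have key : ∀ j, (w i * s j - if i = j then 1 else 0) + (if i = j then 1 else 0) = w i * s j := by
    intro j
    split_ifs with e
    · subst e
      have := Nat.mul_pos (hw i) (Nat.pos_of_ne_zero hi)
      omega
    · omega
  refine ⟨i, fun j => w i * s j - if i = j then 1 else 0, ?_, ?_⟩
  · have h2 : x i = ∏ j, x j ^ (if i = j then 1 else 0) := by simp [pow_ite]
    conv_rhs => rw [h2]
    rw [← Finset.prod_pow, ← Finset.prod_mul_distrib]
    refine Finset.prod_congr rfl fun j _ => ?_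
    rw [← pow_mul, ← pow_add, add_comm, key, mul_comm]
  · have h5 : w i = ∑ j, w j * (if i = j then 1 else 0) := by simp
    conv_lhs => rw [h5]
    rw [← Finset.sum_add_distrib, Finset.mul_sum]
    refine Finset.sum_congr rfl fun j _ => ?_
    rw [← h5, ← mul_add, key]
    ring

/-- A prime ideal containing `x₁, …, x_d` contains the monomials `x^s tⁿ` with `∑ wᵢ sᵢ > n`. -/
theorem initialIdeal_le (hw : ∀ i, 0 < w i) (P : weightedBlowup x w)
    (hP : P ∈ exceptionalLocus x w) : initialIdeal x w ≤ pointIdeal P := by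
  have hprime := pointIdeal_isPrime P
  have key : ∀ n (f : R), f ∈ weightedIdeal x w (n + 1) →
      ∃ hf : f ∈ weightedIdeal x w n, reesMonomial hf ∈ pointIdeal P := by
    intro n f hf
    induction hf using Submodule.span_induction with
    | mem f hf =>
      obtain ⟨s, hs, rfl⟩ := hf
      refine ⟨monomial_mem_weightedIdeal x w s (by omega), ?_⟩
      obtain ⟨i, m, h1, h2⟩ := exists_monomial_pow_eq (x := x) hw s (by omega)
      -- The excess of x^s over n is multiplied by w_i, which pays for removing x_i. Hence x_i can
      -- be put in degree 0, where it lies in the prime.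
      have h3 : w i * n ≤ ∑ j, w j * m j := by
        have h6 : w i * (n + 1) ≤ w i * ∑ j, w j * s j := Nat.mul_le_mul_left _ hs
        rw [← h2, mul_add] at h6
        omega
      apply hprime.mem_of_pow_mem (w i)
      rw [reesMonomial_pow]
      have h7 : x i ∈ weightedIdeal x w 0 := by simp [weightedIdeal_zero]
      have h8 : reesMonomial h7 ∈ pointIdeal P := by
        by_contra h9
        exact isDenominator_zero_iff.1 ⟨h7, h9⟩ (hP i)
      have h10 : reesMonomial (pow_mem_weightedIdeal x w (monomial_mem_weightedIdeal x w s
          (show n ≤ ∑ j, w j * s j by omega)) (w i)) =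
          reesMonomial h7 * reesMonomial (monomial_mem_weightedIdeal x w _ h3) := by
        apply Subtype.ext
        rw [reesMonomial_mul, coe_reesMonomial, coe_reesMonomial, h1, zero_add]
      rw [h10]
      exact Ideal.mul_mem_right _ _ h8
    | zero =>
      refine ⟨Ideal.zero_mem _, ?_⟩
      convert Ideal.zero_mem (pointIdeal P)
      exact Subtype.ext (by simp [coe_reesMonomial])
    | add f g _ _ hf hg =>
      obtain ⟨hf, hf'⟩ := hf
      obtain ⟨hg, hg'⟩ := hg
      refine ⟨add_mem hf hg, ?_⟩
      convert add_mem hf' hg' using 1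
      exact Subtype.ext (by simp [coe_reesMonomial])
    | smul a f _ hf =>
      obtain ⟨hf, hf'⟩ := hf
      refine ⟨Ideal.mul_mem_left _ _ hf, ?_⟩
      convert Ideal.mul_mem_left _ (algebraMap R (weightedRees x w) a) hf' using 1
      exact Subtype.ext (by simp [coe_reesMonomial, C_mul_monomial])
  intro f hf
  classical
  have h1 := DirectSum.sum_support_decompose (weightedGrading x w) f
  rw [← h1]
  refine Ideal.sum_mem _ fun n _ => ?_
  rw [coe_decompose]
  exact (key n _ (hf n)).2

end Rees

variable {k K : Type*} [Field k] [Field K] [Algebra k K]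

section

variable {A : Subalgebra k K} {d : ℕ} {x : Fin d → A} {w : Fin d → ℕ}

theorem evalOne_reesMonomial {n : ℕ} {f : A} (hf : f ∈ weightedIdeal x w n) :
    evalOne (reesMonomial hf) = f := by
  simp [evalOne, coe_reesMonomial]

theorem mem_localRingAt_iff {P : weightedBlowup x w} {z : K} :
    z ∈ localRingAt P ↔ ∃ (n : ℕ) (f g : A), f ∈ weightedIdeal x w n ∧ IsDenominator P n g ∧
      z = f / g := by
  constructor
  · rintro ⟨n, f, g, hf, hg, hgP, rfl⟩
    rw [eq_reesMonomial hf, eq_reesMonomial hg, evalOne_reesMonomial, evalOne_reesMonomial]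
    exact ⟨n, _, _, f.2 n, ⟨g.2 n, by rwa [← eq_reesMonomial hg]⟩, rfl⟩
  · rintro ⟨n, f, g, hf, hg, rfl⟩
    exact ⟨n, reesMonomial hf, reesMonomial hg.1, reesMonomial_mem _, reesMonomial_mem _, hg.2, by
      rw [evalOne_reesMonomial, evalOne_reesMonomial]⟩

theorem le_localRingAt (P : weightedBlowup x w) : A ≤ localRingAt P := fun a ha =>
  mem_localRingAt_iff.2 ⟨0, ⟨a, ha⟩, 1, by simp [weightedIdeal_zero], IsDenominator.one P, by simp⟩

theorem div_mem_localRingAt {P : weightedBlowup x w} {n : ℕ} {f g : A}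
    (hf : f ∈ weightedIdeal x w n) (hg : IsDenominator P n g) : (f / g : K) ∈ localRingAt P :=
  mem_localRingAt_iff.2 ⟨n, f, g, hf, hg, rfl⟩

end

/-! ### The generic point of the exceptional locus. -/

namespace CoordSystem

variable {A : Subalgebra k K} {x : Fin 3 → A} {D : Fin 3 → Derivation k K K} {w : Fin 3 → ℕ}

theorem initialIdeal_isPrime [CharZero k] (h : CoordSystem A x D) (hw : ∀ i, 0 < w i) :
    (initialIdeal x w).IsPrime := by
  refine Ideal.IsHomogeneous.isPrime_of_homogeneous_mem_or_mem initialIdeal_isHomogeneous ?_ ?_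
  · intro h0
    rw [Ideal.eq_top_iff_one, mem_initialIdeal] at h0
    have := h0 0
    simp only [OneMemClass.coe_one, coeff_one_zero, zero_add] at this
    exact h.one_notMem hw this
  · rintro f g ⟨m, hf⟩ ⟨n, hg⟩ hfg
    rw [eq_reesMonomial hf, eq_reesMonomial hg] at hfg ⊢
    rw [reesMonomial_mul, reesMonomial_mem_initialIdeal] at hfg
    rw [reesMonomial_mem_initialIdeal, reesMonomial_mem_initialIdeal]
    exact h.mem_or_mem_of_mul_mem hw (f.2 m) (g.2 n) hfg

/-- The generic point of the exceptional locus of a weighted blow-up. -/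
def genericPoint [CharZero k] (h : CoordSystem A x D) (hw : ∀ i, 0 < w i) :
    weightedBlowup x w :=
  show ProjectiveSpectrum (weightedGrading x w) from
  { asHomogeneousIdeal := ⟨initialIdeal x w, initialIdeal_isHomogeneous⟩
    isPrime := h.initialIdeal_isPrime hw
    not_irrelevant_le := fun h0 => by
      refine h.coord_notMem hw 0 ((reesMonomial_mem_initialIdeal
        (coord_mem_weightedIdeal x w 0)).1 (h0 ?_))
      change reesMonomial _ ∈ HomogeneousIdeal.irrelevant (weightedGrading x w)
      rw [HomogeneousIdeal.mem_irrelevant_iff, GradedRing.proj_apply, coe_decompose]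
      apply Subtype.ext
      simp [coe_reesMonomial, coeff_monomial, (hw 0).ne'] }

theorem isDenominator_genericPoint [CharZero k] (h : CoordSystem A x D) (hw : ∀ i, 0 < w i)
    {n : ℕ} {g : A} : IsDenominator (h.genericPoint hw) n g ↔
      g ∈ weightedIdeal x w n ∧ g ∉ weightedIdeal x w (n + 1) := by
  constructor
  · rintro ⟨h1, h2⟩
    exact ⟨h1, fun h3 => h2 ((reesMonomial_mem_initialIdeal h1).2 h3)⟩
  · rintro ⟨h1, h2⟩
    exact ⟨h1, fun h3 => h2 ((reesMonomial_mem_initialIdeal h1).1 h3)⟩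

theorem isGenericPoint [CharZero k] (h : CoordSystem A x D) (hw : ∀ i, 0 < w i) :
    IsGenericPoint (h.genericPoint hw) (exceptionalLocus x w) := by
  have h0 : h.genericPoint hw ∈ exceptionalLocus x w := by
    intro i
    by_contra hi
    rw [← isDenominator_zero_iff, isDenominator_genericPoint] at hi
    exact hi.2 (weightedIdeal_antitone x w (hw i) (coord_mem_weightedIdeal x w i))
  rw [isGenericPoint_iff_specializes]
  intro P
  rw [← le_iff_specializes]
  constructor
  · intro hP i
    exact hP (h0 i)
  · intro hP
    exact initialIdeal_le hw P hP

/-- A generic point is unique in Proj, so the one in the definition of the exceptional divisor may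
be taken to be `initialIdeal`. -/
theorem isExceptionalDivisor_iff [CharZero k] (h : CoordSystem A x D) (hw : ∀ i, 0 < w i)
    (E : Divisor k K) :
    IsExceptionalDivisor x w E ↔ E.ring = localRingAt (h.genericPoint hw) := by
  constructor
  · rintro ⟨η, hη, e⟩
    rw [e, hη.eq (h.isGenericPoint hw)]
  · intro e
    exact ⟨_, h.isGenericPoint hw, e⟩

end CoordSystem

end WeightedBlowup

end

noncomputable section

open Polynomial AlgebraicGeometry IsLocalRing

namespace WeightedBlowup

/-! ### The Jacobian criterion for algebraic independence of residues -/

section Jacobian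

variable {k R : Type*} [Field k] [CommRing R] [Algebra k R]

/-- The derivations kill t, so they act modulo t. By the chain rule, a relation P(S) ≡ 0 modulo t
yields a linear system for the values of the partial derivatives of P with invertible matrix. These
are then relations of smaller degree, and induction leaves a constant, which the nonunit t divides
only if it is zero. -/
theorem eq_zero_of_dvd_aeval [CharZero k] {t : R} (ht : ¬ IsUnit t)
    (δ : Fin 2 → Derivation k R R) (hδ : ∀ l, δ l t = 0) (S : Fin 2 → R)
    (hdet : IsUnit (Matrix.of fun l i => δ l (S i)).det) (P : MvPolynomial (Fin 2) k)
    (h : t ∣ MvPolynomial.aeval S P) : P = 0 := by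
  suffices key : ∀ (n : ℕ) (P : MvPolynomial (Fin 2) k), (∀ s ∈ P.support, s.degree < n) →
      t ∣ MvPolynomial.aeval S P → P = 0 from
    key (P.support.sup Finsupp.degree + 1) P
      (fun s hs => Nat.lt_succ_of_le (Finset.le_sup hs)) h
  intro n
  induction n with
  | zero =>
    intro P hP _
    rw [← MvPolynomial.support_eq_empty, Finset.eq_empty_iff_forall_notMem]
    exact fun s hs => absurd (hP s hs) (Nat.not_lt_zero _)
  | succ n ih =>
    intro P hP hdvd
    have h1 : ∀ l, t ∣ ∑ i, MvPolynomial.aeval S (MvPolynomial.pderiv i P) * δ l (S i) := by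
      intro l
      rw [← aeval_derivation]
      obtain ⟨r, hr⟩ := hdvd
      rw [hr, Derivation.leibniz, hδ]
      simp
    have h2 : ∀ i, t ∣ MvPolynomial.aeval S (MvPolynomial.pderiv i P) := by
      intro i
      set M : Matrix (Fin 2) (Fin 2) R := Matrix.of fun l i => δ l (S i) with hM
      set v : Fin 2 → R := fun i => MvPolynomial.aeval S (MvPolynomial.pderiv i P) with hv
      have h3 : ∀ l, t ∣ M.mulVec v l := by
        intro l
        have := h1 l
        simp only [hM, hv, Matrix.mulVec, dotProduct, Matrix.of_apply]
        simpa only [mul_comm] using this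
      -- Cramer's rule: the adjugate isolates each partial derivative, up to the unit determinant.
      have h4 : t ∣ M.det * v i := by
        have h5 : (M.adjugate.mulVec (M.mulVec v)) i = M.det * v i := by
          rw [Matrix.mulVec_mulVec, Matrix.adjugate_mul]
          simp [Matrix.smul_mulVec]
        rw [← h5]
        change t ∣ ∑ l, M.adjugate i l * M.mulVec v l
        exact Finset.dvd_sum fun l _ => Dvd.dvd.mul_left (h3 l) _
      exact (hdet.dvd_mul_left).1 h4
    have h6 : ∀ i, MvPolynomial.pderiv i P = 0 := by
      intro i
      refine ih _ (fun s hs => ?_) (h2 i)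
      rw [MvPolynomial.mem_support_iff, MvPolynomial.coeff_pderiv] at hs
      have := hP _ (MvPolynomial.mem_support_iff.2 (left_ne_zero_of_mul hs))
      rw [map_add, Finsupp.degree_single] at this
      omega
    have h7 := eq_C_of_pderiv_eq_zero P h6
    by_contra h0
    have hc : P.coeff 0 ≠ 0 := fun hc => h0 (by rw [h7, hc, map_zero])
    rw [h7, ← MvPolynomial.algebraMap_eq, AlgHom.commutes] at hdvd
    exact ht (isUnit_of_dvd_unit hdvd ((IsUnit.mk0 _ hc).map (algebraMap k R)))

/-- If m is the least weight in g, the terms of weight m add up to t^m P(S), where P is nonzero: as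
the third weight is one, exponents of equal weight are separated by their first two entries. If m <
n, then t would divide P(S). -/
theorem le_weight_of_pow_dvd_aeval [IsDomain R] {t : R} (ht : t ≠ 0) {S : Fin 2 → R}
    (hS : ∀ P : MvPolynomial (Fin 2) k, t ∣ MvPolynomial.aeval S P → P = 0)
    {w : Fin 3 → ℕ} (hw : w 2 = 1) {y : Fin 3 → R} (hy₀ : y 0 = t ^ w 0 * S 0)
    (hy₁ : y 1 = t ^ w 1 * S 1) (hy₂ : y 2 = t) {n : ℕ} {g : MvPolynomial (Fin 3) k}
    (hg : t ^ n ∣ MvPolynomial.aeval y g) : ∀ s ∈ g.support, n ≤ ∑ i, w i * s i := by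
  classical
  by_contra! hcon
  obtain ⟨s₀, hs₀, hlt⟩ := hcon
  obtain ⟨s₁, hs₁, hmin⟩ := Finset.exists_min_image g.support
    (fun s : Fin 3 →₀ ℕ => ∑ i, w i * s i) ⟨s₀, hs₀⟩
  set m := ∑ i, w i * s₁ i with hm
  have hmn : m < n := (hmin s₀ hs₀).trans_lt hlt
  have hexp : MvPolynomial.aeval y g = t ^ m * ∑ s ∈ g.support,
      algebraMap k R (g.coeff s) * t ^ (∑ i, w i * s i - m) * (S 0 ^ s 0 * S 1 ^ s 1) := by
    rw [MvPolynomial.aeval_def, MvPolynomial.eval₂_eq', Finset.mul_sum]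
    refine Finset.sum_congr rfl fun s hs => ?_
    have h1 : t ^ (∑ i, w i * s i) = t ^ m * t ^ (∑ i, w i * s i - m) := by
      rw [← pow_add, Nat.add_sub_cancel' (hmin s hs)]
    have h2 : ∏ i, y i ^ s i = t ^ (∑ i, w i * s i) * (S 0 ^ s 0 * S 1 ^ s 1) := by
      rw [Fin.prod_univ_three, Fin.sum_univ_three, hy₀, hy₁, hy₂, hw]
      ring
    rw [h2, h1]
    ring
  rw [hexp] at hg
  have hg' : t ∣ ∑ s ∈ g.support,
      algebraMap k R (g.coeff s) * t ^ (∑ i, w i * s i - m) * (S 0 ^ s 0 * S 1 ^ s 1) := by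
    have h1 : t ^ m * t ∣ t ^ n := by
      rw [← pow_succ]
      exact pow_dvd_pow t hmn
    exact (mul_dvd_mul_iff_left (pow_ne_zero m ht)).1 (h1.trans hg)
  rw [← Finset.sum_filter_add_sum_filter_not _ (fun s : Fin 3 →₀ ℕ => ∑ i, w i * s i = m)] at hg'
  have h3 : t ∣ ∑ s ∈ g.support.filter (fun s => ¬ ∑ i, w i * s i = m),
      algebraMap k R (g.coeff s) * t ^ (∑ i, w i * s i - m) * (S 0 ^ s 0 * S 1 ^ s 1) := by
    refine Finset.dvd_sum fun s hs => ?_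
    rw [Finset.mem_filter] at hs
    have h4 := hmin s hs.1
    have h5 := hs.2
    refine Dvd.dvd.mul_right (Dvd.dvd.mul_left (dvd_pow_self t ?_) _) _
    omega
  rw [dvd_add_left h3] at hg'
  let e : (Fin 3 →₀ ℕ) → (Fin 2 →₀ ℕ) := fun s => Finsupp.equivFunOnFinite.symm ![s 0, s 1]
  let P : MvPolynomial (Fin 2) k := ∑ s ∈ g.support.filter (fun s => ∑ i, w i * s i = m),
    MvPolynomial.monomial (e s) (g.coeff s)
  have hP : P = 0 := by
    apply hS
    convert hg' using 1
    simp only [P, map_sum]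
    refine Finset.sum_congr rfl fun s hs => ?_
    rw [Finset.mem_filter] at hs
    rw [MvPolynomial.aeval_monomial, Finsupp.prod_fintype _ _ (by simp), Fin.prod_univ_two, hs.2]
    simp [e]
  have h6 : P.coeff (e s₁) = g.coeff s₁ := by
    simp only [P, MvPolynomial.coeff_sum, MvPolynomial.coeff_monomial]
    rw [Finset.sum_eq_single s₁]
    · simp
    · intro s hs hne
      rw [if_neg]
      intro he
      apply hne
      rw [Finset.mem_filter] at hs
      have h7 := hs.2
      have he0 : s 0 = s₁ 0 := by simpa [e] using DFunLike.congr_fun he 0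
      have he1 : s 1 = s₁ 1 := by simpa [e] using DFunLike.congr_fun he 1
      rw [hm, Fin.sum_univ_three, Fin.sum_univ_three, he0, he1, hw] at h7
      ext i
      fin_cases i
      · exact he0
      · exact he1
      · simp only [Fin.reduceFinMk]; omega
    · intro h
      exact (h (by rw [Finset.mem_filter]; exact ⟨hs₁, hm.symm⟩)).elim
  rw [hP, MvPolynomial.coeff_zero] at h6
  exact MvPolynomial.mem_support_iff.1 hs₁ h6.symm

end Jacobian

variable {k K : Type*} [Field k] [Field K] [Algebra k K]

/-! ### Derivations of the local rings of a weighted blow-up -/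

section Derivations

variable {A : Subalgebra k K} {x : Fin 3 → A} {D : Fin 3 → Derivation k K K} {w : Fin 3 → ℕ}

/-- The coordinates `x₁ / x₃^{w₁}, x₂ / x₃^{w₂}, x₃` of a weighted blow-up. -/
def blowupCoord (x : Fin 3 → A) (w : Fin 3 → ℕ) : Fin 3 → K :=
  ![x 0 / (x 2 : K) ^ w 0, x 1 / (x 2 : K) ^ w 1, x 2]

/-- The derivations dual to the coordinates `x₁ / x₃^{w₁}, x₂ / x₃^{w₂}, x₃`. -/
def blowupDer (x : Fin 3 → A) (D : Fin 3 → Derivation k K K) (w : Fin 3 → ℕ) :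
    Fin 3 → Derivation k K K :=
  ![(x 2 : K) ^ w 0 • D 0, (x 2 : K) ^ w 1 • D 1,
    (x 2 : K)⁻¹ • ∑ i, ((w i : K) * x i) • D i]

theorem coord_two_ne_zero (h : CoordSystem A x D) (i : Fin 3) : (x i : K) ≠ 0 := by
  intro h0
  have := h.map_coord i i
  rw [h0] at this
  simp at this

theorem derivation_div (δ : Derivation k K K) (a b : K) (hb : b ≠ 0) :
    δ (a / b) = (δ a * b - a * δ b) / (b * b) := by
  have h := δ.leibniz (a / b) b
  rw [div_mul_cancel₀ _ hb, smul_eq_mul, smul_eq_mul] at h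
  have h' : b * δ (a / b) = δ a - a / b * δ b := by rw [h]; ring
  field_simp at h' ⊢
  exact h'

theorem blowupDer_coord (h : CoordSystem A x D) (hw2 : w 2 = 1) (i j : Fin 3) :
    blowupDer x D w i (blowupCoord x w j) = if i = j then 1 else 0 := by
  have ht := coord_two_ne_zero h 2
  have hpow : ∀ (δ : Derivation k K K) (n : ℕ), δ ((x 2 : K) ^ n) =
      n * (x 2 : K) ^ n / x 2 * δ (x 2) := by
    intro δ n
    rw [Derivation.leibniz_pow]
    rcases n with _ | n
    · simp
    · simp only [Nat.add_sub_cancel, smul_eq_mul, nsmul_eq_mul, pow_succ]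
      field_simp
  have hD : ∀ (δ : Derivation k K K) (j : Fin 3), δ ((x j : K) / (x 2 : K) ^ w j) =
      (δ (x j) - w j * x j / x 2 * δ (x 2)) / (x 2 : K) ^ w j := by
    intro δ j
    rw [derivation_div _ _ _ (pow_ne_zero _ ht), hpow]
    have := pow_ne_zero (w j) ht
    field_simp
  have hx := h.map_coord
  have hne := pow_ne_zero (w 0) ht
  have hne' := pow_ne_zero (w 1) ht
  fin_cases i <;> fin_cases j <;>
    simp [blowupDer, blowupCoord, hD, hx, Fin.sum_univ_three, hw2, hne, hne', ht]
  all_goals ring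

/-- Multiplication by t^{w_i} restores the weight that D_i takes away, so t^{w_i}D_i preserves each
I_n and, by the quotient rule, the fractions of degree zero. -/
theorem CoordSystem.pow_smul_mem (h : CoordSystem A x D) (hw2 : w 2 = 1)
    {P : weightedBlowup x w} (i : Fin 3) {z : K} (hz : z ∈ localRingAt P) :
    ((x 2 : K) ^ w i • D i) z ∈ localRingAt P := by
  obtain ⟨n, f, g, hf, hg, rfl⟩ := mem_localRingAt_iff.1 hz
  have key : ∀ f ∈ weightedIdeal x w n, x 2 ^ w i * h.der i f ∈ weightedIdeal x w n := by
    intro f hf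
    have h1 := mul_mem_weightedIdeal x w
      (pow_mem_weightedIdeal x w (coord_mem_weightedIdeal x w 2) (w i))
      (h.der_mem_weightedIdeal w i hf)
    rw [hw2, mul_one] at h1
    exact weightedIdeal_antitone x w (by omega) h1
  have h2 := sub_mem (mul_mem_weightedIdeal x w (key f hf) hg.1)
    (mul_mem_weightedIdeal x w hf (key g hg.1))
  convert div_mem_localRingAt h2 (hg.mul hg) using 1
  have hg0 : (g : K) ≠ 0 := fun h0 => hg.ne_zero (Subtype.ext h0)
  rw [derivation_div _ _ _ hg0]
  simp [coe_der]

/-- The Euler derivation `∑ wᵢ xᵢ Dᵢ` acts on `I_n / I_{n+1}` as multiplication by `n`. -/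
theorem CoordSystem.euler_sub_mem (h : CoordSystem A x D) (hw : ∀ i, 0 < w i) {n : ℕ} {f : A}
    (hf : f ∈ weightedIdeal x w n) :
    ∑ i, (w i : A) * x i * h.der i f - n * f ∈ weightedIdeal x w (n + 1) := by
  have key : ∀ (m : ℕ) (f : A), f ∈ weightedIdeal x w m →
      ∑ i, (w i : A) * x i * h.der i f ∈ weightedIdeal x w m := by
    intro m f hf
    refine Ideal.sum_mem _ fun i _ => ?_
    have h1 := mul_mem_weightedIdeal x w (coord_mem_weightedIdeal x w i)
      (h.der_mem_weightedIdeal w i hf)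
    rw [mul_assoc]
    exact Ideal.mul_mem_left _ _ (weightedIdeal_antitone x w (by omega) h1)
  obtain ⟨P, hP, hP'⟩ := h.exists_homogeneous hw hf
  have h2 : ∑ i, (w i : A) * x i * h.der i (MvPolynomial.aeval x P) =
      n * MvPolynomial.aeval x P := by
    have h3 := congrArg (MvPolynomial.aeval x) hP.sum_weight_X_mul_pderiv
    simp only [map_sum, map_mul, map_natCast, MvPolynomial.aeval_X, nsmul_eq_mul] at h3
    rw [← h3]
    exact Finset.sum_congr rfl fun i _ => by rw [h.der_aeval]; ring
  have h4 := sub_mem (key _ _ hP') (Ideal.mul_mem_left _ (n : A) hP')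
  convert h4 using 1
  simp only [map_sub, mul_sub, Finset.sum_sub_distrib, h2]
  ring

/-- For the third derivation, let θ be the Euler derivation. In θ(f)g - fθ(g) the contributions n f
g cancel, so the numerator has weight at least 2n+1 and t, a denominator of degree 1 at P, can be
divided out. -/
theorem CoordSystem.blowupDer_mem (h : CoordSystem A x D) (hw : ∀ i, 0 < w i) (hw2 : w 2 = 1)
    {P : weightedBlowup x w} (hP : IsDenominator P 1 (x 2)) (i : Fin 3) {z : K}
    (hz : z ∈ localRingAt P) : blowupDer x D w i z ∈ localRingAt P := by
  have ht := coord_two_ne_zero h 2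
  match i with
  | 0 =>
    have e : blowupDer x D w 0 = (x 2 : K) ^ w 0 • D 0 := rfl
    rw [e]
    exact h.pow_smul_mem hw2 0 hz
  | 1 =>
    have e : blowupDer x D w 1 = (x 2 : K) ^ w 1 • D 1 := rfl
    rw [e]
    exact h.pow_smul_mem hw2 1 hz
  | 2 =>
    obtain ⟨n, f, g, hf, hg, rfl⟩ := mem_localRingAt_iff.1 hz
    have h2 := mul_mem_weightedIdeal x w (h.euler_sub_mem hw hf) hg.1
    have h3 := mul_mem_weightedIdeal x w hf (h.euler_sub_mem hw hg.1)
    rw [show n + 1 + n = 1 + (n + n) by ring] at h2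
    rw [show n + (n + 1) = 1 + (n + n) by ring] at h3
    have h1 := sub_mem h2 h3
    convert div_mem_localRingAt h1 (hP.mul (hg.mul hg)) using 1
    have hg0 : (g : K) ≠ 0 := fun h0 => hg.ne_zero (Subtype.ext h0)
    have e : blowupDer x D w 2 = (x 2 : K)⁻¹ • ∑ i, ((w i : K) * x i) • D i := rfl
    rw [derivation_div _ _ _ hg0, e]
    simp [coe_der, Fin.sum_univ_three]
    field_simp
    ring

theorem blowupCoord_mem {P : weightedBlowup x w} (hP : IsDenominator P 1 (x 2)) (i : Fin 3) :
    blowupCoord x w i ∈ localRingAt P := by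
  have h1 : ∀ j, (x j / (x 2 : K) ^ w j) ∈ localRingAt P := by
    intro j
    have := div_mem_localRingAt (coord_mem_weightedIdeal x w j) (by simpa using hP.pow (w j))
    simpa using this
  match i with
  | 0 => exact h1 0
  | 1 => exact h1 1
  | 2 => exact le_localRingAt P (x 2).2

theorem CoordSystem.isDenominator_two [CharZero k] (h : CoordSystem A x D) (hw : ∀ i, 0 < w i)
    (hw2 : w 2 = 1) : IsDenominator (h.genericPoint hw) 1 (x 2) := by
  have h1 : IsDenominator (h.genericPoint hw) (w 2) (x 2) := by
    rw [h.isDenominator_genericPoint]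
    exact ⟨coord_mem_weightedIdeal x w 2, h.coord_notMem hw 2⟩
  rwa [hw2] at h1

end Derivations

end WeightedBlowup

end

noncomputable section

open Polynomial AlgebraicGeometry IsLocalRing

namespace WeightedBlowup

variable {k K : Type*} [Field k] [Field K] [Algebra k K]

/-! ### Monomial divisors -/

theorem residues_independent_of_jacobian [CharZero k] {R : Subalgebra k K} {t : R}
    (ht : ¬ IsUnit t) (δ : Fin 2 → Derivation k K K) (hmem : ∀ l, ∀ r ∈ R, δ l r ∈ R)
    (hδ : ∀ l, δ l t = 0) (S : Fin 2 → R) (u : R) (hu : IsUnit u)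
    (hdet : δ 0 (S 0) * δ 1 (S 1) - δ 0 (S 1) * δ 1 (S 0) = u)
    (P : MvPolynomial (Fin 2) k) (h : t ∣ MvPolynomial.aeval S P) : P = 0 := by
  refine eq_zero_of_dvd_aeval ht (fun l => restrictDerivation R (δ l) (hmem l))
    (fun l => Subtype.ext (hδ l)) S ?_ P h
  convert hu
  rw [Matrix.det_fin_two]
  exact Subtype.ext hdet

/-- The divisor `E` is given by the monomial valuation with weights `w₁, w₂, 1` with respect to
`x₁, x₂, x₃`. -/
structure IsMonomial (E : Divisor k K) {A : Subalgebra k K} (x : Fin 3 → A) (w : Fin 3 → ℕ) :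
    Prop where
  le : A ≤ E.ring
  maximalIdeal_eq : maximalIdeal E.ring = Ideal.span {Subalgebra.inclusion le (x 2)}
  exists_independent : ∃ S : Fin 2 → E.ring,
    Subalgebra.inclusion le (x 0) = Subalgebra.inclusion le (x 2) ^ w 0 * S 0 ∧
    Subalgebra.inclusion le (x 1) = Subalgebra.inclusion le (x 2) ^ w 1 * S 1 ∧
    ∀ P : MvPolynomial (Fin 2) k,
      Subalgebra.inclusion le (x 2) ∣ MvPolynomial.aeval S P → P = 0

/-! ### Reading the weighted filtration from a monomial valuation. -/

namespace IsMonomial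

variable {E : Divisor k K} {A : Subalgebra k K} {x : Fin 3 → A} {w : Fin 3 → ℕ}

theorem mem_maximalIdeal_pow_iff (h : IsMonomial E x w) {r : E.ring} {n : ℕ} :
    r ∈ maximalIdeal E.ring ^ n ↔ Subalgebra.inclusion h.le (x 2) ^ n ∣ r := by
  rw [h.maximalIdeal_eq, Ideal.span_singleton_pow, Ideal.mem_span_singleton]

theorem irreducible (h : IsMonomial E x w) : Irreducible (Subalgebra.inclusion h.le (x 2)) :=
  (IsDiscreteValuationRing.irreducible_iff_uniformizer _).2 h.maximalIdeal_eq

theorem inclusion_ne_zero (h : IsMonomial E x w) : Subalgebra.inclusion h.le (x 2) ≠ 0 :=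
  h.irreducible.ne_zero

theorem pow_dvd_of_mem (h : IsMonomial E x w) (hw2 : w 2 = 1) {n : ℕ} {f : A}
    (hf : f ∈ weightedIdeal x w n) :
    Subalgebra.inclusion h.le (x 2) ^ n ∣ Subalgebra.inclusion h.le f := by
  obtain ⟨S, h0, h1, -⟩ := h.exists_independent
  have key : weightedIdeal x w n ≤ (Ideal.span {Subalgebra.inclusion h.le (x 2) ^ n}).comap
      (Subalgebra.inclusion h.le) := by
    rw [weightedIdeal, Ideal.span_le]
    rintro _ ⟨s, hs, rfl⟩
    rw [SetLike.mem_coe, Ideal.mem_comap, Ideal.mem_span_singleton]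
    refine (pow_dvd_pow _ hs).trans ⟨S 0 ^ s 0 * S 1 ^ s 1, ?_⟩
    simp only [Fin.prod_univ_three, Fin.sum_univ_three, map_mul, map_pow, h0, h1, hw2]
    ring
  exact Ideal.mem_span_singleton.1 (key hf)

theorem le_weight [CharZero k] (h : IsMonomial E x w) (hw2 : w 2 = 1) {n : ℕ}
    {P : MvPolynomial (Fin 3) k}
    (hP : Subalgebra.inclusion h.le (x 2) ^ n ∣
      Subalgebra.inclusion h.le (MvPolynomial.aeval x P)) :
    ∀ s ∈ P.support, n ≤ ∑ i, w i * s i := by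
  obtain ⟨S, h0, h1, h2⟩ := h.exists_independent
  have e : Subalgebra.inclusion h.le (MvPolynomial.aeval x P) =
      MvPolynomial.aeval (fun i => Subalgebra.inclusion h.le (x i)) P := by
    rw [MvPolynomial.comp_aeval_apply]
  rw [e] at hP
  exact le_weight_of_pow_dvd_aeval h.inclusion_ne_zero h2 hw2 h0 h1 rfl hP

variable {D : Fin 3 → Derivation k K K}

/-- Induction on n: if an element of I_n has order at least n+1, independence of the residues allows
only monomials of weight at least n+1 in its form of weight n, which therefore vanishes. -/
theorem mem_weightedIdeal_iff [CharZero k] (h : IsMonomial E x w) (hx : CoordSystem A x D)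
    (hw : ∀ i, 0 < w i) (hw2 : w 2 = 1) {n : ℕ} {f : A} :
    f ∈ weightedIdeal x w n ↔
      Subalgebra.inclusion h.le (x 2) ^ n ∣ Subalgebra.inclusion h.le f := by
  refine ⟨h.pow_dvd_of_mem hw2, ?_⟩
  induction n with
  | zero => simp [weightedIdeal_zero]
  | succ n ih =>
    intro hf
    obtain ⟨P, hP, hP'⟩ := hx.exists_homogeneous hw (ih ((pow_dvd_pow _ n.le_succ).trans hf))
    have h1 := h.pow_dvd_of_mem hw2 hP'
    rw [map_sub, dvd_sub_right hf] at h1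
    have h2 := h.le_weight hw2 h1
    have h3 : P = 0 := by
      rw [← MvPolynomial.support_eq_empty, Finset.eq_empty_iff_forall_notMem]
      intro s hs
      have h4 := h2 s hs
      rw [← weight_eq_sum, hP (MvPolynomial.mem_support_iff.1 hs)] at h4
      omega
    simpa [h3] using hP'

/-- A valuation ring of K is determined by the orders of elements of A, whose fractions exhaust K,
and those orders are recorded by the ideals I_n. -/
theorem ring_eq [CharZero k] (h : IsMonomial E x w) (hx : CoordSystem A x D)
    (hA : IsFractionRing A K) (hw : ∀ i, 0 < w i) (hw2 : w 2 = 1) : E.ring = localRingAt (hx.genericPoint hw) := by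
  have ht : (x 2 : K) ≠ 0 := coord_two_ne_zero hx 2
  have hcoe : ∀ a : A, ((Subalgebra.inclusion h.le a : E.ring) : K) = a := fun a => rfl
  have hunit : ∀ (n : ℕ) (g : A), g ∈ weightedIdeal x w n → g ∉ weightedIdeal x w (n + 1) →
      ∃ r : E.ring, IsUnit r ∧ Subalgebra.inclusion h.le g =
        Subalgebra.inclusion h.le (x 2) ^ n * r := by
    intro n g hg hg'
    obtain ⟨r, hr⟩ := h.pow_dvd_of_mem hw2 hg
    refine ⟨r, ?_, hr⟩
    by_contra hr'
    rw [← mem_nonunits_iff, ← mem_maximalIdeal, h.maximalIdeal_eq, Ideal.mem_span_singleton] at hr'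
    refine hg' ((h.mem_weightedIdeal_iff hx hw hw2).2 ?_)
    rw [hr, pow_succ]
    exact mul_dvd_mul_left _ hr'
  apply le_antisymm
  · intro z hz
    obtain ⟨f, g, hg, rfl⟩ := IsFractionRing.div_surjective (A := A) z
    have hg0 : g ≠ 0 := nonZeroDivisors.ne_zero hg
    have hg1 : Subalgebra.inclusion h.le g ≠ 0 := fun h0 =>
    hg0 (Subalgebra.inclusion_injective h.le (by rw [h0, map_zero]))
    obtain ⟨n, u, hu⟩ := IsDiscreteValuationRing.eq_unit_mul_pow_irreducible hg1 h.irreducible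
    have hgn : g ∈ weightedIdeal x w n :=
      (h.mem_weightedIdeal_iff hx hw hw2).2 ⟨u, by rw [hu, mul_comm]⟩
    have hgn' : g ∉ weightedIdeal x w (n + 1) := by
      rw [h.mem_weightedIdeal_iff hx hw hw2, hu, mul_comm, pow_succ]
      intro h0
      have h1 := (mul_dvd_mul_iff_left (pow_ne_zero n h.inclusion_ne_zero)).1 h0
      exact h.irreducible.not_isUnit (isUnit_of_dvd_unit h1 u.isUnit)
    have hfn : f ∈ weightedIdeal x w n := by
      rw [h.mem_weightedIdeal_iff hx hw hw2]
      have h2 : Subalgebra.inclusion h.le f = Subalgebra.inclusion h.le g * ⟨_, hz⟩ := by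
        apply Subtype.ext
        rw [MulMemClass.coe_mul, hcoe, hcoe]
        exact (mul_div_cancel₀ _ (fun h0 => hg0 (Subtype.ext h0))).symm
      rw [h2]
      exact Dvd.dvd.mul_right ((h.mem_weightedIdeal_iff hx hw hw2).1 hgn) _
    exact div_mem_localRingAt hfn ((hx.isDenominator_genericPoint hw).2 ⟨hgn, hgn'⟩)
  · intro z hz
    obtain ⟨n, f, g, hf, hg, rfl⟩ := mem_localRingAt_iff.1 hz
    rw [hx.isDenominator_genericPoint] at hg
    obtain ⟨u, ⟨u, rfl⟩, hu'⟩ := hunit n g hg.1 hg.2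
    obtain ⟨r, hr⟩ := h.pow_dvd_of_mem hw2 hf
    have h1 : (f / g : K) = (r * (u⁻¹ : E.ringˣ) : E.ring) := by
      rw [← hcoe f, ← hcoe g, hr, hu']
      have h2 : (((u : E.ring) : K)) * ((u⁻¹ : E.ringˣ) : E.ring) = 1 := by
        rw [← MulMemClass.coe_mul, Units.mul_inv]; rfl
      have h3 : ((u : E.ring) : K) ≠ 0 := left_ne_zero_of_mul_eq_one h2
      have h4 : (((u⁻¹ : E.ringˣ) : E.ring) : K) = ((u : E.ring) : K)⁻¹ :=
        eq_inv_of_mul_eq_one_right h2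
      simp only [MulMemClass.coe_mul, SubmonoidClass.coe_pow, hcoe, h4]
      field_simp
    rw [h1]
    exact SetLike.coe_mem _

end IsMonomial

/-! ### Exceptional divisors of weighted blow-ups are monomial. -/

namespace CoordSystem

variable {A : Subalgebra k K} {x : Fin 3 → A} {D : Fin 3 → Derivation k K K} {w : Fin 3 → ℕ}

/-- A fraction f/g of degree n is invertible unless f lies in I_{n+1}; then f/(g t) is an admissible
fraction of degree n+1. -/
theorem eq_mul_of_not_isUnit [CharZero k] (h : CoordSystem A x D) (hw : ∀ i, 0 < w i)
    (hw2 : w 2 = 1) (r : localRingAt (h.genericPoint hw)) (hr : ¬ IsUnit r) :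
    Subalgebra.inclusion (le_localRingAt _) (x 2) ∣ r := by
  obtain ⟨n, f, g, hf, hg, e⟩ := mem_localRingAt_iff.1 r.2
  have hg0 : (g : K) ≠ 0 := fun h0 => hg.ne_zero (Subtype.ext h0)
  have ht : (x 2 : K) ≠ 0 := coord_two_ne_zero h 2
  have hf' : f ∈ weightedIdeal x w (n + 1) := by
    by_contra hf'
    have hfd : IsDenominator (h.genericPoint hw) n f :=
      (h.isDenominator_genericPoint hw).2 ⟨hf, hf'⟩
    have hf0 : (f : K) ≠ 0 := fun h0 => hfd.ne_zero (Subtype.ext h0)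
    refine hr (IsUnit.of_mul_eq_one ⟨_, div_mem_localRingAt hg.1 hfd⟩ (Subtype.ext ?_))
    simp only [MulMemClass.coe_mul, e, OneMemClass.coe_one]
    field_simp
  have h2 := h.isDenominator_two hw hw2
  refine ⟨⟨_, div_mem_localRingAt hf' (hg.mul h2)⟩, Subtype.ext ?_⟩
  have e2 : ((Subalgebra.inclusion (le_localRingAt (h.genericPoint hw)) (x 2) :
    localRingAt (h.genericPoint hw)) : K) = x 2 := rfl
  simp only [MulMemClass.coe_mul, e, e2]
  field_simp

theorem not_isUnit_two [CharZero k] (h : CoordSystem A x D) (hw : ∀ i, 0 < w i) (hw2 : w 2 = 1) :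
    ¬ IsUnit (Subalgebra.inclusion (le_localRingAt (h.genericPoint hw)) (x 2)) := by
  intro hu
  obtain ⟨r, hr⟩ := hu.exists_right_inv
  obtain ⟨n, f, g, hf, hg, e⟩ := mem_localRingAt_iff.1 r.2
  have hg0 : (g : K) ≠ 0 := fun h0 => hg.ne_zero (Subtype.ext h0)
  have h1 := congrArg (Subtype.val) hr
  have e2 : ((Subalgebra.inclusion (le_localRingAt (h.genericPoint hw)) (x 2) :
    localRingAt (h.genericPoint hw)) : K) = x 2 := rfl
  simp only [MulMemClass.coe_mul, e, e2, OneMemClass.coe_one] at h1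
  have h2 : x 2 * f = g := by
    apply Subtype.ext
    simp only [MulMemClass.coe_mul]
    field_simp at h1
    exact h1
  rw [h.isDenominator_genericPoint] at hg
  apply hg.2
  rw [← h2, add_comm]
  refine mul_mem_weightedIdeal x w ?_ hf
  rw [← hw2]
  exact coord_mem_weightedIdeal x w 2

/-- Independence of the residues follows from the Jacobian criterion with the first two derivations
of `blowupDer`: they are dual to x_1/t^{w_1}, x_2/t^{w_2}, so the Jacobian is 1. -/
theorem isMonomial [CharZero k] (h : CoordSystem A x D) (hw : ∀ i, 0 < w i) (hw2 : w 2 = 1)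
    (E : Divisor k K) (hE : E.ring = localRingAt (h.genericPoint hw)) : IsMonomial E x w := by
  obtain ⟨R, hR1, hR2, hR3⟩ := E
  subst hE
  have ht : (x 2 : K) ≠ 0 := coord_two_ne_zero h 2
  have hden := h.isDenominator_two hw hw2
  have hmem := fun i => blowupCoord_mem hden i
  have hdual := blowupDer_coord h hw2
  have e2 : blowupCoord x w 2 = x 2 := rfl
  refine ⟨le_localRingAt _, ?_, ![⟨_, hmem 0⟩, ⟨_, hmem 1⟩], ?_, ?_, ?_⟩
  · ext r
    rw [mem_maximalIdeal, mem_nonunits_iff, Ideal.mem_span_singleton]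
    refine ⟨h.eq_mul_of_not_isUnit hw hw2 r, fun hd hu => ?_⟩
    exact h.not_isUnit_two hw hw2 (isUnit_of_dvd_unit hd hu)
  · apply Subtype.ext
    change (x 0 : K) = (x 2 : K) ^ w 0 * (x 0 / (x 2 : K) ^ w 0)
    field_simp
  · apply Subtype.ext
    change (x 1 : K) = (x 2 : K) ^ w 1 * (x 1 / (x 2 : K) ^ w 1)
    field_simp
  · intro P hP
    refine residues_independent_of_jacobian (h.not_isUnit_two hw hw2)
      ![blowupDer x D w 0, blowupDer x D w 1] ?_ ?_ ![⟨_, hmem 0⟩, ⟨_, hmem 1⟩] 1 isUnit_one ?_ P hP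
    · intro l r hr
      fin_cases l
      · exact h.blowupDer_mem hw hw2 hden 0 hr
      · exact h.blowupDer_mem hw hw2 hden 1 hr
    · intro l
      fin_cases l
      · exact hdual 0 2
      · exact hdual 1 2
    · simp [hdual]

end CoordSystem

end WeightedBlowup

end

noncomputable section

open Polynomial AlgebraicGeometry IsLocalRing
open scoped KaehlerDifferential TensorProduct

namespace WeightedBlowup

variable {k K : Type*} [Field k] [Field K] [Algebra k K]

/-! ### Change of coordinates -/

section Change

variable {A : Subalgebra k K} {x y : Fin 3 → A} {D : Fin 3 → Derivation k K K}

/-- Differentiating x_j = ∑ N_{jl} y_l modulo the maximal ideal exhibits the transpose of N as an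
inverse of the Jacobian matrix over the residue field. -/
theorem CoordSystem.isUnit_det (h : CoordSystem A x D)
    (hy : Ideal.span (Set.range y) = Ideal.span (Set.range x)) :
    IsUnit (Matrix.of fun i j => h.der i (y j)).det := by
  set I := Ideal.span (Set.range x) with hI
  have hx : ∀ j, ∃ N : Fin 3 → A, ∑ l, N l * y l = x j := by
    intro j
    have : x j ∈ Ideal.span (Set.range y) := by
      rw [hy]
      exact Ideal.subset_span ⟨j, rfl⟩
    exact (Ideal.mem_span_range_iff_exists_fun).1 this
  choose N hN using hx
  have hyI : ∀ l, Ideal.Quotient.mk I (y l) = 0 := fun l => by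
    rw [Ideal.Quotient.eq_zero_iff_mem, ← hy]
    exact Ideal.subset_span ⟨l, rfl⟩
  have e : (Ideal.Quotient.mk I).mapMatrix
      ((Matrix.of fun i j => h.der i (y j)) * (Matrix.of N).transpose) = 1 := by
    ext i j
    have h1 := congrArg (fun a => Ideal.Quotient.mk I (h.der i a)) (hN j)
    simp only [map_sum, Derivation.leibniz, h.der_coord, smul_eq_mul, map_add, map_mul, hyI,
      zero_mul, add_zero] at h1
    rw [RingHom.mapMatrix_apply, Matrix.map_apply, Matrix.mul_apply, map_sum]
    simp only [Matrix.of_apply, Matrix.transpose_apply, map_mul]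
    rw [Matrix.one_apply]
    calc _ = _ := Finset.sum_congr rfl fun l _ => mul_comm _ _
      _ = _ := h1
      _ = _ := by split_ifs <;> simp
  have h2 := congrArg Matrix.det e
  rw [← RingHom.map_det, Matrix.det_one, Matrix.det_mul, ← map_one (Ideal.Quotient.mk I),
    Ideal.Quotient.eq] at h2
  have h3 : IsUnit ((Matrix.of fun i j => h.der i (y j)).det *
      (Matrix.of N).transpose.det) := by
    by_contra h4
    rw [← h.mem_span_iff, ← hI] at h4
    have h5 := I.sub_mem h4 h2
    rw [sub_sub_cancel, hI, h.mem_span_iff] at h5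
    exact h5 isUnit_one
  exact isUnit_of_mul_isUnit_left h3

/-- Derivations with invertible Jacobian matrix become dual after multiplication by its inverse,
whose entries lie in A. -/
theorem exists_coordSystem (h₁ : ∀ a : A, a ∈ Ideal.span (Set.range x) ↔ ¬ IsUnit a)
    (h₂ : ∀ a : A, ∃ c : k, a - algebraMap k A c ∈ Ideal.span (Set.range x))
    (h₃ : ∀ i, ∀ a ∈ A, D i a ∈ A)
    (hdet : IsUnit (Matrix.of fun i j => restrictDerivation A (D i) (h₃ i) (x j)).det) :
    ∃ D' : Fin 3 → Derivation k K K, CoordSystem A x D' := by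
  set M := Matrix.of fun i j => restrictDerivation A (D i) (h₃ i) (x j) with hM
  refine ⟨fun i => ∑ j, ((M⁻¹ i j : A) : K) • D j, h₁, h₂, ?_, ?_⟩
  · intro i a ha
    have e : (∑ j, ((M⁻¹ i j : A) : K) • D j) a = ∑ j, ((M⁻¹ i j : A) : K) * D j a := by
      rw [Fin.sum_univ_three, Fin.sum_univ_three]
      rfl
    rw [e]
    exact sum_mem fun j _ => mul_mem (SetLike.coe_mem _) (h₃ j a ha)
  · intro i j
    have h4 : (M⁻¹ * M) i j = (1 : Matrix _ _ A) i j := by rw [Matrix.nonsing_inv_mul M hdet]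
    have h5 := congrArg (Subtype.val) h4
    have e : (∑ l, ((M⁻¹ i l : A) : K) • D l) (x j) = ∑ l, ((M⁻¹ i l : A) : K) * D l (x j) := by
      rw [Fin.sum_univ_three, Fin.sum_univ_three]
      rfl
    rw [e]
    rw [Matrix.mul_apply, Matrix.one_apply, Fin.sum_univ_three] at h5
    rw [Fin.sum_univ_three]
    refine h5.trans ?_
    split_ifs <;> rfl

/-- Any other regular system of parameters has dual derivations. -/
theorem CoordSystem.change (h : CoordSystem A x D)
    (hy : Ideal.span (Set.range y) = Ideal.span (Set.range x)) :
    ∃ D' : Fin 3 → Derivation k K K, CoordSystem A y D' :=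
  exists_coordSystem (by rw [hy]; exact h.mem_span_iff) (by rw [hy]; exact h.exists_const)
    h.map_mem (h.isUnit_det hy)

end Change

/-! ### Dual derivations on a smooth germ -/

section Smooth

variable {A : Type*} [CommRing A] [IsLocalRing A] [Algebra k A]

/-- The derivation `A → 𝔪 / 𝔪²` of a local ring `A` with a `k`-algebra map `c : A → k`. -/
def cotangentDerivation (c : A →ₐ[k] k) (hc : ∀ a, a - algebraMap k A (c a) ∈ maximalIdeal A) :
    Derivation k A (CotangentSpace A) :=
  Derivation.mk'
    { toFun := fun a => (maximalIdeal A).toCotangent ⟨a - algebraMap k A (c a), hc a⟩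
      map_add' := fun a b => by
        rw [← map_add]
        congr 1
        apply Subtype.ext
        simp only [map_add, AddMemClass.mk_add_mk]
        ring
      map_smul' := fun r a => by
        rw [RingHom.id_apply, ← IsScalarTower.algebraMap_smul A r
          ((maximalIdeal A).toCotangent ⟨a - algebraMap k A (c a), hc a⟩), ← LinearMap.map_smul]
        congr 1
        apply Subtype.ext
        simp [Algebra.smul_def, mul_sub] }
    fun a b => by
      have h1 : ∀ (a : A) (m : maximalIdeal A), a • (maximalIdeal A).toCotangent m =
          algebraMap k A (c a) • (maximalIdeal A).toCotangent m := by
        intro a m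
        rw [← sub_eq_zero, ← sub_smul, ← map_smul, Ideal.toCotangent_eq_zero]
        rw [pow_two]
        exact Ideal.mul_mem_mul (hc a) m.2
      simp only [LinearMap.coe_mk, AddHom.coe_mk]
      rw [h1 b, ← map_smul, ← map_smul, ← map_add]
      congr 1
      apply Subtype.ext
      simp only [map_mul, Submodule.coe_add, Submodule.coe_smul, smul_eq_mul]
      ring

theorem cotangentDerivation_apply (c : A →ₐ[k] k)
    (hc : ∀ a, a - algebraMap k A (c a) ∈ maximalIdeal A) (a : A) :
    cotangentDerivation c hc a =
      (maximalIdeal A).toCotangent ⟨a - algebraMap k A (c a), hc a⟩ := rfl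

/-- Three generators of the maximal ideal in dimension 3 form a basis of the cotangent space. The
i-th coordinate of the class of a - a(x) is a derivation to the residue field; it lifts to A because
smoothness makes the module of differentials projective. -/
theorem exists_derivation_residue [IsNoetherianRing A] [Algebra.FormallySmooth k A]
    (hres : Function.Surjective (algebraMap k (ResidueField A))) (hdim : ringKrullDim A = 3)
    {x : Fin 3 → A} (hx : Ideal.span (Set.range x) = maximalIdeal A) (i : Fin 3) :
    ∃ d : Derivation k A A, ∀ j, d (x j) - (if i = j then 1 else 0) ∈ maximalIdeal A := by
  let e : k ≃ₐ[k] ResidueField A := AlgEquiv.ofBijective (Algebra.ofId k (ResidueField A))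
    ⟨(algebraMap k (ResidueField A)).injective, hres⟩
  let c : A →ₐ[k] k := e.symm.toAlgHom.comp (IsScalarTower.toAlgHom k A (ResidueField A))
  have hec : ∀ a, e (c a) = residue A a := fun a => e.apply_symm_apply _
  have hc : ∀ a, a - algebraMap k A (c a) ∈ maximalIdeal A := by
    intro a
    rw [← residue_eq_zero_iff, map_sub, sub_eq_zero, ← hec]
    rfl
  have hxm : ∀ j, x j ∈ maximalIdeal A := fun j => hx ▸ Ideal.subset_span ⟨j, rfl⟩
  have hcx : ∀ j, c (x j) = 0 := fun j => by
    apply e.injective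
    rw [hec, map_zero]
    exact (residue_eq_zero_iff _).2 (hxm j)
  let b : Fin 3 → CotangentSpace A := fun j => (maximalIdeal A).toCotangent ⟨x j, hxm j⟩
  have hspan : ⊤ ≤ Submodule.span (ResidueField A) (Set.range b) := by
    rintro v -
    obtain ⟨⟨m, hm⟩, rfl⟩ := (maximalIdeal A).toCotangent_surjective v
    have hm' := hm
    rw [← hx] at hm'
    obtain ⟨N, hN⟩ := Ideal.mem_span_range_iff_exists_fun.1 hm'
    have : (⟨m, hm⟩ : maximalIdeal A) = ∑ j, N j • ⟨x j, hxm j⟩ := by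
      apply Subtype.ext
      simp [← hN]
    rw [this, map_sum]
    refine Submodule.sum_mem _ fun j _ => ?_
    rw [map_smul]
    have h2 : N j • (maximalIdeal A).toCotangent ⟨x j, hxm j⟩ = residue A (N j) • b j := rfl
    rw [h2]
    exact Submodule.smul_mem _ _ (Submodule.subset_span ⟨j, rfl⟩)
  have hfin : Module.finrank (ResidueField A) (CotangentSpace A) = 3 := by
    apply le_antisymm
    · have h1 := finrank_range_le_card (R := ResidueField A) b
      rw [Set.finrank, top_le_iff.1 hspan, finrank_top] at h1
      simpa using h1
    · have h1 := ringKrullDim_le_spanFinrank_maximalIdeal A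
      rw [hdim, spanFinrank_maximalIdeal_eq_finrank_cotangentSpace] at h1
      exact_mod_cast h1
  let B := basisOfTopLeSpanOfCardEqFinrank b hspan (by rw [hfin]; simp)
  have hB : ∀ j, B j = b j := fun j => by simp [B]
  let ℓ : Ω[A⁄k] →ₗ[A] ResidueField A :=
    ((B.coord i).restrictScalars A).comp (cotangentDerivation c hc).liftKaehlerDifferential
  obtain ⟨L, hL⟩ := Module.projective_lifting_property
    (Algebra.linearMap A (ResidueField A)) ℓ residue_surjective
  refine ⟨L.compDer (KaehlerDifferential.D k A), fun j => ?_⟩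
  rw [← residue_eq_zero_iff, map_sub, sub_eq_zero]
  have h1 : residue A (L (KaehlerDifferential.D k A (x j))) = ℓ (KaehlerDifferential.D k A (x j)) :=
    LinearMap.congr_fun hL _
  refine h1.trans ?_
  have h2 : cotangentDerivation c hc (x j) = B j := by
    rw [cotangentDerivation_apply, hB]
    congr 1
    apply Subtype.ext
    simp [hcx]
  simp only [ℓ, LinearMap.comp_apply, LinearMap.restrictScalars_apply,
    Derivation.liftKaehlerDifferential_comp_D, h2, Module.Basis.coord_apply,
    Module.Basis.repr_self]
  rw [Finsupp.single_apply]
  simp only [eq_comm (a := j)]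
  split_ifs <;> simp

/-- A derivation of a domain extends to the fraction field. -/
theorem exists_derivation_extension {A K : Type*} [CommRing A] [Field K] [Algebra k A] [Algebra k K]
    [Algebra A K] [IsScalarTower k A K] [IsFractionRing A K] (d : Derivation k A A) :
    ∃ D : Derivation k K K, ∀ a, D (algebraMap A K a) = algebraMap A K (d a) := by
  have := Algebra.FormallyEtale.of_isLocalization (Rₘ := K) (nonZeroDivisors A)
  let e := KaehlerDifferential.tensorKaehlerEquivOfFormallyEtale k A K
  let ℓ : Ω[A⁄k] →ₗ[A] K := (Algebra.linearMap A K).comp d.liftKaehlerDifferential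
  refine ⟨((ℓ.liftBaseChange K).comp e.symm.toLinearMap).compDer (KaehlerDifferential.D k K),
    fun a => ?_⟩
  change (ℓ.liftBaseChange K) (e.symm (KaehlerDifferential.D k K (algebraMap A K a))) = _
  rw [KaehlerDifferential.tensorKaehlerEquivOfFormallyEtale_symm_D_algebraMap]
  simp [ℓ]

end Smooth

/-- The lifted derivations have the identity as Jacobian matrix modulo the maximal ideal, hence an
invertible one over A; they extend to K and are then made exactly dual. -/
theorem IsSmoothGerm.exists_coordSystem {A : Subalgebra k K} (hA : IsSmoothGerm 3 A)
    {x : Fin 3 → A} (hx : IsRegularSystem x) :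
    ∃ D : Fin 3 → Derivation k K K, CoordSystem A x D := by
  obtain ⟨hloc, hdim, hspan⟩ := hx
  have := hA.isFractionRing
  have := hA.essFiniteType
  have := hA.smooth
  have : IsNoetherianRing A := Algebra.EssFiniteType.isNoetherianRing k A
  choose d hd using exists_derivation_residue hA.residueField (by simpa using hdim) hspan
  choose D hD using fun i => exists_derivation_extension (K := K) (d i)
  have hDA : ∀ i (a : A), D i a = d i a := hD
  refine WeightedBlowup.exists_coordSystem (D := D) (fun a => ?_) (fun a => ?_) (fun i a ha => ?_) ?_
  · rw [hspan]
    exact mem_maximalIdeal a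
  · rw [hspan]
    obtain ⟨c, hc⟩ := hA.residueField (residue A a)
    refine ⟨c, ?_⟩
    rw [← residue_eq_zero_iff, map_sub, sub_eq_zero, ← hc]
    rfl
  · rw [hDA i ⟨a, ha⟩]
    exact SetLike.coe_mem _
  · rw [← not_not (a := IsUnit _), ← mem_nonunits_iff, ← mem_maximalIdeal, ← residue_eq_zero_iff,
      RingHom.map_det]
    have e : (residue A).mapMatrix (Matrix.of fun i j => restrictDerivation A (D i)
        (fun a ha => by rw [hDA i ⟨a, ha⟩]; exact SetLike.coe_mem _) (x j)) = 1 := by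
      ext i j
      rw [RingHom.mapMatrix_apply, Matrix.map_apply, Matrix.of_apply, Matrix.one_apply]
      have h1 : restrictDerivation A (D i) (fun a ha => by
          rw [hDA i ⟨a, ha⟩]; exact SetLike.coe_mem _) (x j) = d i (x j) := Subtype.ext (hDA i _)
      have h2 := (residue_eq_zero_iff _).2 (hd i j)
      rw [map_sub, sub_eq_zero] at h2
      rw [h1, h2]
      split_ifs <;> simp
    rw [e]
    simp

end WeightedBlowup

end

noncomputable section

open Polynomial AlgebraicGeometry IsLocalRing
open scoped KaehlerDifferential

namespace WeightedBlowup

variable {k K : Type*} [Field k] [Field K] [Algebra k K]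

/-! ### Existence of monomial divisors -/

section Existence

variable {A : Subalgebra k K} {x : Fin 3 → A} {D : Fin 3 → Derivation k K K} {w : Fin 3 → ℕ}

theorem isFractionRing_of_le {A R : Subalgebra k K} (hA : IsFractionRing A K) (h : A ≤ R) :
    IsFractionRing R K := by
  refine IsFractionRing.of_field R K fun z => ?_
  obtain ⟨f, g, -, e⟩ := IsFractionRing.div_surjective (A := A) z
  exact ⟨Subalgebra.inclusion h f, Subalgebra.inclusion h g, e.symm⟩

theorem IsDenominator.isUnit_of_eq {P : weightedBlowup x w} {n : ℕ} {g : A}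
    (hg : IsDenominator P n g) (hw2 : w 2 = 1) {c : localRingAt P}
    (hc : Subalgebra.inclusion (le_localRingAt P) g =
      Subalgebra.inclusion (le_localRingAt P) (x 2) ^ n * c) : IsUnit c := by
  have h1 : x 2 ^ n ∈ weightedIdeal x w n := by
    have := pow_mem_weightedIdeal x w (coord_mem_weightedIdeal x w 2) n
    rwa [hw2, mul_one] at this
  refine IsUnit.of_mul_eq_one ⟨_, div_mem_localRingAt h1 hg⟩ (Subtype.ext ?_)
  have h2 := congrArg Subtype.val hc
  change (g : K) = (x 2 : K) ^ n * c at h2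
  have hg0 : (g : K) ≠ 0 := fun h0 => hg.ne_zero (Subtype.ext h0)
  simp only [MulMemClass.coe_mul, SubmonoidClass.coe_pow, OneMemClass.coe_one]
  rw [← mul_div_assoc, mul_comm, ← h2, div_self hg0]

/-- The subalgebra N is left arbitrary because the same division by t^n serves twice: for essential
finiteness of the local ring and for the determination of its residue field. -/
theorem exists_mem_eq_pow_mul {P : weightedBlowup x w} (hP : IsDenominator P 1 (x 2))
    (ht : (x 2 : K) ≠ 0) (hw2 : w 2 = 1) (N : Subalgebra k (localRingAt P))
    (hAN : ∀ a, Subalgebra.inclusion (le_localRingAt P) a ∈ N)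
    (huN : ∀ i, (⟨blowupCoord x w i, blowupCoord_mem hP i⟩ : localRingAt P) ∈ N)
    {n : ℕ} {f : A} (hf : f ∈ weightedIdeal x w n) :
    ∃ c ∈ N, Subalgebra.inclusion (le_localRingAt P) f =
      Subalgebra.inclusion (le_localRingAt P) (x 2) ^ n * c := by
  set ι := Subalgebra.inclusion (le_localRingAt P) with hι
  set u : Fin 3 → localRingAt P := fun i => ⟨_, blowupCoord_mem hP i⟩
  have hu0 : ι (x 0) = ι (x 2) ^ w 0 * u 0 := Subtype.ext (by
    change (x 0 : K) = (x 2 : K) ^ w 0 * (x 0 / (x 2 : K) ^ w 0)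
    field_simp)
  have hu1 : ι (x 1) = ι (x 2) ^ w 1 * u 1 := Subtype.ext (by
    change (x 1 : K) = (x 2 : K) ^ w 1 * (x 1 / (x 2 : K) ^ w 1)
    field_simp)
  induction hf using Submodule.span_induction with
  | mem f hf =>
    obtain ⟨s, hs, rfl⟩ := hf
    refine ⟨ι (x 2) ^ (∑ i, w i * s i - n) * (u 0 ^ s 0 * u 1 ^ s 1),
      mul_mem (pow_mem (hAN _) _) (mul_mem (pow_mem (huN 0) _) (pow_mem (huN 1) _)), ?_⟩
    rw [← mul_assoc, ← pow_add, Nat.add_sub_cancel' hs]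
    simp only [Fin.prod_univ_three, Fin.sum_univ_three, map_mul, map_pow, hu0, hu1, hw2]
    ring
  | zero => exact ⟨0, zero_mem _, by simp⟩
  | add f g _ _ hf hg =>
    obtain ⟨c, hc, e⟩ := hf
    obtain ⟨c', hc', e'⟩ := hg
    exact ⟨c + c', add_mem hc hc', by rw [map_add, e, e', mul_add]⟩
  | smul a f _ hf =>
    obtain ⟨c, hc, e⟩ := hf
    exact ⟨ι a * c, mul_mem (hAN a) hc, by rw [smul_eq_mul, map_mul, e]; ring⟩

/-- The local ring is a localization of the algebra generated by generators for A and the blow-up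
coordinates. Dividing numerator and denominator of f/g by t^n turns the denominator into a unit. -/
theorem essFiniteType_localRingAt [Algebra.EssFiniteType k A] (P : weightedBlowup x w)
    (hP : IsDenominator P 1 (x 2)) (ht : (x 2 : K) ≠ 0) (hw2 : w 2 = 1) :
    Algebra.EssFiniteType k (localRingAt P) := by
  classical
  set R := localRingAt P
  set ι := Subalgebra.inclusion (le_localRingAt P) with hι
  obtain ⟨σ, hσ⟩ := (Algebra.essFiniteType_iff k A).1 inferInstance
  let u : Fin 3 → R := fun i => ⟨_, blowupCoord_mem hP i⟩
  have hT : ι (x 2) ≠ 0 := fun h0 => ht (congrArg Subtype.val h0)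
  let τ : Finset R := σ.image ι ∪ Finset.univ.image u
  -- `N` consists of the fractions of elements of the finitely generated algebra whose denominators
  -- are units of R.
  let N : Subalgebra k R :=
    { carrier := {c | ∃ d ∈ Algebra.adjoin k (τ : Set R), IsUnit d ∧
        c * d ∈ Algebra.adjoin k (τ : Set R)}
      mul_mem' := by
        rintro a b ⟨d, hd, hd', h⟩ ⟨e, he, he', h'⟩
        refine ⟨d * e, mul_mem hd he, hd'.mul he', ?_⟩
        rw [mul_mul_mul_comm]
        exact mul_mem h h'
      add_mem' := by
        rintro a b ⟨d, hd, hd', h⟩ ⟨e, he, he', h'⟩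
        refine ⟨d * e, mul_mem hd he, hd'.mul he', ?_⟩
        have e1 : (a + b) * (d * e) = a * d * e + b * e * d := by ring
        rw [e1]
        exact add_mem (mul_mem h he) (mul_mem h' hd)
      algebraMap_mem' := fun c => ⟨1, one_mem _, isUnit_one, by
        rw [mul_one]
        exact Subalgebra.algebraMap_mem _ c⟩ }
  have hadj : Algebra.adjoin k (τ : Set R) ≤ N := fun c hc =>
    ⟨1, one_mem _, isUnit_one, by rwa [mul_one]⟩
  have huN : ∀ i, u i ∈ N := fun i => hadj (Algebra.subset_adjoin (by simp [τ]))
  have hAN : ∀ a : A, ι a ∈ N := by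
    have h1 : (Algebra.adjoin k (σ : Set A)).map ι ≤ Algebra.adjoin k (τ : Set R) := by
      rw [AlgHom.map_adjoin]
      exact Algebra.adjoin_mono (by simp [τ])
    intro a
    obtain ⟨d, hd, hd', h⟩ := hσ a
    refine ⟨ι d, h1 ⟨d, hd, rfl⟩, hd'.map ι, ?_⟩
    rw [← map_mul]
    exact h1 ⟨_, h, rfl⟩
  have key := fun n (f : A) (hf : f ∈ weightedIdeal x w n) =>
    exists_mem_eq_pow_mul hP ht hw2 N hAN (fun i => huN i) hf
  rw [Algebra.essFiniteType_iff]
  refine ⟨τ, fun z => ?_⟩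
  obtain ⟨n, f, g, hf, hg, e⟩ := mem_localRingAt_iff.1 z.2
  obtain ⟨c₁, ⟨d₁, hd₁, hd₁', h₁⟩, e₁⟩ := key n f hf
  obtain ⟨c₂, ⟨d₂, hd₂, hd₂', h₂⟩, e₂⟩ := key n g hg.1
  have hg0 : (g : K) ≠ 0 := fun h0 => hg.ne_zero (Subtype.ext h0)
  have hz : z * c₂ = c₁ := by
    apply mul_left_cancel₀ (pow_ne_zero n hT)
    rw [← e₁, mul_left_comm, ← e₂]
    apply Subtype.ext
    rw [MulMemClass.coe_mul, e]
    exact div_mul_cancel₀ _ hg0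
  refine ⟨c₂ * d₂ * d₁, mul_mem h₂ hd₁, ((hg.isUnit_of_eq hw2 e₂).mul hd₂').mul hd₁', ?_⟩
  have e3 : z * (c₂ * d₂ * d₁) = c₁ * d₁ * d₂ := by rw [← hz]; ring
  rw [e3]
  exact mul_mem h₁ hd₂

/-- The ring is Noetherian and its nonunits are the multiples of t, so it is a discrete valuation
ring. This supplies the auxiliary divisor G to which the bound on the minimal log discrepancy is
applied. -/
theorem CoordSystem.exists_divisor [CharZero k] (h : CoordSystem A x D)
    (hA : IsFractionRing A K) (hA' : Algebra.EssFiniteType k A) (hw : ∀ i, 0 < w i)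
    (hw2 : w 2 = 1) : ∃ G : Divisor k K, G.ring = localRingAt (h.genericPoint hw) := by
  set R := localRingAt (h.genericPoint hw) with hR
  have ht := coord_two_ne_zero h 2
  have hess : Algebra.EssFiniteType k R :=
    essFiniteType_localRingAt _ (h.isDenominator_two hw hw2) ht hw2
  have hnoeth : IsNoetherianRing R := Algebra.EssFiniteType.isNoetherianRing k R
  set T := Subalgebra.inclusion (le_localRingAt (h.genericPoint hw)) (x 2) with hT
  have hT0 : T ≠ 0 := fun h0 => ht (congrArg Subtype.val h0)
  have hTu : ¬ IsUnit T := h.not_isUnit_two hw hw2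
  have hdvd : ∀ r : R, ¬ IsUnit r ↔ T ∣ r := fun r =>
    ⟨h.eq_mul_of_not_isUnit hw hw2 r, fun hd hu => hTu (isUnit_of_dvd_unit hd hu)⟩
  have hloc : IsLocalRing R := IsLocalRing.of_nonunits_add fun a b ha hb => by
    rw [mem_nonunits_iff, hdvd] at *
    exact dvd_add ha hb
  have hmax : maximalIdeal R = Ideal.span {T} := by
    ext r
    rw [mem_maximalIdeal, mem_nonunits_iff, Ideal.mem_span_singleton, hdvd]
  have hfield : ¬ IsField R := fun hf => by
    obtain ⟨b, hb⟩ := hf.mul_inv_cancel hT0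
    exact hTu (IsUnit.of_mul_eq_one b hb)
  have hdvr : IsDiscreteValuationRing R := by
    have := ((IsDiscreteValuationRing.TFAE R hfield).out 0 4)
    rw [this, hmax]
    exact ⟨T, rfl⟩
  exact ⟨⟨R, isFractionRing_of_le hA (le_localRingAt _), hdvr, hess⟩, rfl⟩

end Existence

/-! ### The order of the relative canonical divisor -/

theorem alternating_eq_det_smul {R M N : Type*} [CommRing R] [AddCommGroup M] [Module R M]
    [AddCommGroup N] [Module R N] {n : ℕ} (f : M [⋀^Fin n]→ₗ[R] N) (e : Fin n → M)
    (c : Matrix (Fin n) (Fin n) R) : f (fun i => ∑ j, c i j • e j) = c.det • f e := by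
  have h : f.compLinearMap (Fintype.linearCombination R e) =
      (LinearMap.toSpanSingleton R N (f e)).compAlternatingMap Matrix.detRowAlternating := by
    refine Module.Basis.ext_alternating (Pi.basisFun R (Fin n)) fun v hv => ?_
    obtain ⟨σ, rfl⟩ : ∃ σ : Equiv.Perm (Fin n), v = σ :=
      ⟨Equiv.ofBijective v (Finite.injective_iff_bijective.1 hv), rfl⟩
    have h1 := AlternatingMap.map_perm (f.compLinearMap (Fintype.linearCombination R e))
      (fun i => Pi.basisFun R (Fin n) i) σ
    have h2 := AlternatingMap.map_perm ((LinearMap.toSpanSingleton R N (f e)).compAlternatingMap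
      Matrix.detRowAlternating) (fun i => Pi.basisFun R (Fin n) i) σ
    simp only [Function.comp_def] at h1 h2
    rw [h1, h2]
    congr 1
    have h3 : (fun i => Pi.basisFun R (Fin n) i) = (1 : Matrix (Fin n) (Fin n) R) := by
      ext i j
      simp [Matrix.one_apply, Pi.single_apply, eq_comm]
    have h4 : Matrix.detRowAlternating (fun i => Pi.basisFun R (Fin n) i) = (1 : R) := by
      rw [h3]
      exact Matrix.det_one
    rw [LinearMap.compAlternatingMap_apply, h4]
    simp
  have h5 := DFunLike.congr_fun h c
  have h6 : (fun i => ∑ j, c i j • e j) = fun i => Fintype.linearCombination R e (c i) := by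
    funext i
    rw [Fintype.linearCombination_apply]
  rw [h6]
  exact h5

/-- Nakayama's lemma. If a = c + ∑ N_i x_i, then da differs from ∑ N_i dx_i by ∑ x_i dN_i, with x_i
in the maximal ideal of the valuation ring, whose module of differentials is finite. -/
theorem IsMonomial.D_mem_span {E : Divisor k K} {A : Subalgebra k K} {x : Fin 3 → A}
    {w : Fin 3 → ℕ} {D : Fin 3 → Derivation k K K} (h : IsMonomial E x w) (hw : ∀ i, 0 < w i)
    (hw2 : w 2 = 1) (hx : CoordSystem A x D) (a : A) :
    KaehlerDifferential.D k E.ring (Subalgebra.inclusion h.le a) ∈ Submodule.span E.ring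
      (Set.range fun i => KaehlerDifferential.D k E.ring (Subalgebra.inclusion h.le (x i))) := by
  have := E.essFiniteType
  set ι := Subalgebra.inclusion h.le
  set d := KaehlerDifferential.D k E.ring
  set W₀ := Submodule.span E.ring (Set.range fun i => d (ι (x i))) with hW₀
  set W := Submodule.span E.ring (Set.range fun a => d (ι a)) with hW
  have hm : ∀ i, ι (x i) ∈ maximalIdeal E.ring := by
    intro i
    have h1 := h.pow_dvd_of_mem hw2 (coord_mem_weightedIdeal x w i)
    rw [h.maximalIdeal_eq, Ideal.mem_span_singleton]
    exact (dvd_pow_self _ (hw i).ne').trans h1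
  have hle : W ≤ W₀ ⊔ maximalIdeal E.ring • W := by
    rw [hW, Submodule.span_le]
    rintro _ ⟨a, rfl⟩
    obtain ⟨c, hc⟩ := hx.exists_const a
    obtain ⟨N, hN⟩ := Ideal.mem_span_range_iff_exists_fun.1 hc
    have e : a = algebraMap k A c + ∑ i, N i * x i := by rw [hN]; ring
    have e2 : d (ι a) = ∑ i, (ι (N i) • d (ι (x i)) + ι (x i) • d (ι (N i))) := by
      rw [e, map_add, map_add, AlgHom.commutes, Derivation.map_algebraMap, zero_add, map_sum,
        map_sum]
      exact Finset.sum_congr rfl fun i _ => by rw [map_mul, Derivation.leibniz]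
    change d (ι a) ∈ _
    rw [e2]
    refine Submodule.sum_mem _ fun i _ => add_mem ?_ ?_
    · exact Submodule.mem_sup_left (Submodule.smul_mem _ _ (Submodule.subset_span ⟨i, rfl⟩))
    · exact Submodule.mem_sup_right (Submodule.smul_mem_smul (hm i)
        (Submodule.subset_span ⟨N i, rfl⟩))
  have hfg : W.FG := IsNoetherian.noetherian W
  have := Submodule.le_of_le_smul_of_le_jacobson_bot hfg
    (maximalIdeal_le_jacobson (⊥ : Ideal E.ring)) hle
  exact this (Submodule.subset_span ⟨a, rfl⟩)

/-- With x_i = t^{w_i}S_i, the wedge of the dx_i is t^{w_1+w_2} times that of dS_1, dS_2, dt, by the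
triangular matrix `C`; any three elements of A give a multiple of it. -/
theorem IsMonomial.le_canonicalOrder {E : Divisor k K} {A : Subalgebra k K} {x : Fin 3 → A}
    {w : Fin 3 → ℕ} {D : Fin 3 → Derivation k K K} (h : IsMonomial E x w) (hw : ∀ i, 0 < w i)
    (hw2 : w 2 = 1) (hx : CoordSystem A x D) :
    ((w 0 + w 1 : ℕ) : ℕ∞) ≤ E.canonicalOrder A := by
  obtain ⟨S, h0, h1, -⟩ := h.exists_independent
  refine le_iSup₂_of_le (w 0 + w 1) (fun a ha => ?_) le_rfl
  set T := Subalgebra.inclusion h.le (x 2) with hT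
  set f := exteriorPower.ιMulti E.ring 3 (M := Ω[E.ring⁄k])
  set d := KaehlerDifferential.D k E.ring
  have hspan : ∀ i, ∃ c : Fin 3 → E.ring,
      ∑ j, c j • d (Subalgebra.inclusion h.le (x j)) = d (a i) := fun i =>
    (Submodule.mem_span_range_iff_exists_fun _).1 (h.D_mem_span hw hw2 hx ⟨a i, ha i⟩)
  choose c hc using hspan
  have e1 : f (fun i => d (a i)) =
      (Matrix.of c).det • f (fun i => d (Subalgebra.inclusion h.le (x i))) := by
    rw [← alternating_eq_det_smul]
    simp only [Matrix.of_apply, hc]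
  let C : Matrix (Fin 3) (Fin 3) E.ring := !![T ^ w 0, 0, S 0 * (w 0 * T ^ (w 0 - 1));
    0, T ^ w 1, S 1 * (w 1 * T ^ (w 1 - 1)); 0, 0, 1]
  have e2 : (fun i => d (Subalgebra.inclusion h.le (x i))) =
      fun i => ∑ j, C i j • (![d (S 0), d (S 1), d T] : Fin 3 → Ω[E.ring⁄k]) j := by
    funext i
    fin_cases i
    · simp [C, h0, Fin.sum_univ_three, Derivation.leibniz, Derivation.leibniz_pow, mul_smul,
        Nat.cast_smul_eq_nsmul]
    · simp [C, h1, Fin.sum_univ_three, Derivation.leibniz, Derivation.leibniz_pow, mul_smul,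
        Nat.cast_smul_eq_nsmul]
    · simp [C, Fin.sum_univ_three, T]
  have e3 : C.det = T ^ (w 0 + w 1) := by
    rw [Matrix.det_fin_three]
    simp [C, pow_add]
  rw [e1, e2, alternating_eq_det_smul, e3]
  refine Submodule.smul_mem _ _ (Submodule.smul_mem_smul ?_ trivial)
  rw [h.mem_maximalIdeal_pow_iff]

/-- Pairing with the determinant of the three derivations `blowupDer`, which preserve the valuation
ring, sends the wedge of the dx_i to t^{w_1+w_2}; hence the wedge is divisible by no higher power.
-/
theorem CoordSystem.canonicalOrder_le [CharZero k] {A : Subalgebra k K} {x : Fin 3 → A}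
    {w : Fin 3 → ℕ} {D : Fin 3 → Derivation k K K} (h : CoordSystem A x D) (hw : ∀ i, 0 < w i)
    (hw2 : w 2 = 1) {E : Divisor k K} (hE : E.ring = localRingAt (h.genericPoint hw)) :
    E.canonicalOrder A ≤ ((w 0 + w 1 : ℕ) : ℕ∞) := by
  have hmon := h.isMonomial hw hw2 E hE
  have hden := h.isDenominator_two hw hw2
  refine iSup₂_le fun ν hν => ?_
  have hν' := hν (fun i => Subalgebra.inclusion hmon.le (x i)) (fun i => SetLike.coe_mem _)
  let δ : Fin 3 → Derivation k E.ring E.ring := fun i =>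
    restrictDerivation E.ring (blowupDer x D w i) fun r hr => by
      rw [hE] at hr ⊢
      exact h.blowupDer_mem hw hw2 hden i hr
  let φ : ⋀[E.ring]^3 Ω[E.ring⁄k] →ₗ[E.ring] E.ring := exteriorPower.alternatingMapLinearEquiv
    (Matrix.detRowAlternating.compLinearMap
      (LinearMap.pi fun j => (δ j).liftKaehlerDifferential))
  have h1 : φ (exteriorPower.ιMulti E.ring 3 fun i =>
      KaehlerDifferential.D k E.ring (Subalgebra.inclusion hmon.le (x i))) =
      Matrix.det (Matrix.of fun i j => δ j (Subalgebra.inclusion hmon.le (x i))) := by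
    simp only [φ, exteriorPower.alternatingMapLinearEquiv_apply_ιMulti]
    change Matrix.det (Matrix.of fun i j => (δ j).liftKaehlerDifferential
      (KaehlerDifferential.D k E.ring (Subalgebra.inclusion hmon.le (x i)))) = _
    simp only [Derivation.liftKaehlerDifferential_comp_D]
  have h2 : φ (exteriorPower.ιMulti E.ring 3 fun i =>
      KaehlerDifferential.D k E.ring (Subalgebra.inclusion hmon.le (x i))) ∈
      maximalIdeal E.ring ^ ν := by
    have h3 := Submodule.mem_map_of_mem (f := φ) hν'
    rw [Submodule.map_smul''] at h3
    have h4 := Submodule.smul_mono (le_refl (maximalIdeal E.ring ^ ν))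
      (le_top : Submodule.map φ ⊤ ≤ ⊤) h3
    rwa [smul_eq_mul, Ideal.mul_top] at h4
  have ht := coord_two_ne_zero h 2
  have h5 : Matrix.det (Matrix.of fun i j => δ j (Subalgebra.inclusion hmon.le (x i))) =
      Subalgebra.inclusion hmon.le (x 2) ^ (w 0 + w 1) := by
    apply Subtype.ext
    have hc : ∀ i j, ((δ j (Subalgebra.inclusion hmon.le (x i)) : E.ring) : K) =
      blowupDer x D w j (x i) := fun i j => rfl
    rw [Matrix.det_fin_three]
    simp only [Matrix.of_apply, AddMemClass.coe_add, AddSubgroupClass.coe_sub, MulMemClass.coe_mul,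
      hc, SubmonoidClass.coe_pow, Subalgebra.coe_inclusion]
    simp [blowupDer, h.map_coord, Fin.sum_univ_three, hw2, ht, pow_add]
  rw [h1, h5, hmon.mem_maximalIdeal_pow_iff,
    pow_dvd_pow_iff hmon.inclusion_ne_zero hmon.irreducible.not_isUnit] at h2
  exact_mod_cast h2

end WeightedBlowup

end

noncomputable section

open Polynomial AlgebraicGeometry IsLocalRing

namespace WeightedBlowup

/-! ### The point of a weighted blow-up on the strict transform of a curve -/

section StrictTransform

variable {R : Type*} [CommRing R] {x : Fin 3 → R} {w : Fin 3 → ℕ}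

/-- On the curve away from the exceptional locus t is invertible. There t^{w_i} in degree 0 times
x_i in degree w_i equals t^{w_i} in degree w_i times x_i in degree 0, which vanishes, so x_i
vanishes in degree w_i. This closed condition passes to the closure. -/
theorem not_isDenominator_of_mem_strictTransform {P : weightedBlowup x w}
    (hw2 : w 2 = 1) (hP : P ∈ strictTransform x w (Ideal.span {x 0, x 1})) {i : Fin 3}
    (hi : x i ∈ Ideal.span {x 0, x 1}) :
    ¬ IsDenominator P (w i) (x i) := by
  have hcl : IsClosed {Q : weightedBlowup x w |
      reesMonomial (coord_mem_weightedIdeal x w i) ∈ pointIdeal Q} := by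
    have h0 : {Q : weightedBlowup x w |
        reesMonomial (coord_mem_weightedIdeal x w i) ∈ pointIdeal Q} =
        ProjectiveSpectrum.zeroLocus (weightedGrading x w)
          {reesMonomial (coord_mem_weightedIdeal x w i)} :=
      Set.ext fun Q => by
        change _ ↔ (_ : Set (weightedRees x w)) ⊆ _
        rw [Set.singleton_subset_iff]
        exact Iff.rfl
    rw [h0]
    exact ProjectiveSpectrum.isClosed_zeroLocus (weightedGrading x w) _
  have hsub : {Q : weightedBlowup x w | Ideal.span {x 0, x 1} ≤ belowIdeal Q} \
      exceptionalLocus x w ⊆ {Q : weightedBlowup x w |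
      reesMonomial (coord_mem_weightedIdeal x w i) ∈ pointIdeal Q} := by
    rintro Q ⟨hQ, hQ'⟩
    have hQ : Ideal.span {x 0, x 1} ≤ belowIdeal Q := hQ
    have h2 : x 2 ∉ belowIdeal Q := by
      intro h2
      refine hQ' fun j => ?_
      fin_cases j
      · exact hQ (Ideal.subset_span (by simp))
      · exact hQ (Ideal.subset_span (by simp))
      · exact h2
    by_contra h3
    have h4 : IsDenominator Q (w i) (x i) := ⟨_, h3⟩
    have h5 := (isDenominator_zero_iff.2 h2).pow (w i)
    have h6 := h5.mul h4
    rw [mul_zero, zero_add] at h6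
    have h7 : x 2 ^ w i ∈ weightedIdeal x w (w i) := by
      have := pow_mem_weightedIdeal x w (coord_mem_weightedIdeal x w 2) (w i)
      rwa [hw2, mul_one] at this
    have h8 : x i ∈ weightedIdeal x w 0 := by simp [weightedIdeal_zero]
    have h9 : reesMonomial h8 ∈ pointIdeal Q := by
      by_contra h9
      exact isDenominator_zero_iff.1 ⟨h8, h9⟩ (hQ hi)
    refine h6.2 ?_
    have : reesMonomial h6.1 = reesMonomial h7 * reesMonomial h8 :=
      Subtype.ext (by rw [reesMonomial_mul, coe_reesMonomial])
    rw [this]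
    exact Ideal.mul_mem_left _ _ h9
  rintro ⟨h1, h2⟩
  exact h2 (closure_minimal hsub hcl hP)

/-- If every x_i vanished in degree w_i at P, the power trick of `exists_monomial_pow_eq` would put
the whole irrelevant ideal inside P. -/
theorem exists_isDenominator {d : ℕ} {x : Fin d → R} {w : Fin d → ℕ} (hw : ∀ i, 0 < w i)
    (P : weightedBlowup x w) : ∃ i, IsDenominator P (w i) (x i) := by
  by_contra! hcon
  have hprime := pointIdeal_isPrime P
  have key : ∀ n (f : R), 0 < n → f ∈ weightedIdeal x w n →
      ∃ hf : f ∈ weightedIdeal x w n, reesMonomial hf ∈ pointIdeal P := by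
    intro n f hn hf
    induction hf using Submodule.span_induction with
    | mem f hf =>
      obtain ⟨s, hs, rfl⟩ := hf
      refine ⟨monomial_mem_weightedIdeal x w s hs, ?_⟩
      obtain ⟨i, m, h1, h2⟩ := exists_monomial_pow_eq (x := x) hw s (by omega)
      have h3 : w i * n - w i ≤ ∑ j, w j * m j := by
        have h6 : w i * n ≤ w i * ∑ j, w j * s j := Nat.mul_le_mul_left _ hs
        rw [← h2] at h6
        omega
      have h4 : w i ≤ w i * n := Nat.le_mul_of_pos_right _ hn
      apply hprime.mem_of_pow_mem (w i)
      rw [reesMonomial_pow]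
      have h8 : reesMonomial (coord_mem_weightedIdeal x w i) ∈ pointIdeal P := by
        by_contra h9
        exact hcon i ⟨_, h9⟩
      have h10 : reesMonomial (pow_mem_weightedIdeal x w
          (monomial_mem_weightedIdeal x w s hs) (w i)) =
          reesMonomial (coord_mem_weightedIdeal x w i) *
            reesMonomial (monomial_mem_weightedIdeal x w _ h3) := by
        apply Subtype.ext
        rw [reesMonomial_mul, coe_reesMonomial, coe_reesMonomial, h1, Nat.add_sub_cancel' h4]
      rw [h10]
      exact Ideal.mul_mem_right _ _ h8
    | zero =>
      refine ⟨Ideal.zero_mem _, ?_⟩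
      convert Ideal.zero_mem (pointIdeal P)
      exact Subtype.ext (by simp [coe_reesMonomial])
    | add f g _ _ hf hg =>
      obtain ⟨hf, hf'⟩ := hf
      obtain ⟨hg, hg'⟩ := hg
      refine ⟨add_mem hf hg, ?_⟩
      convert add_mem hf' hg' using 1
      exact Subtype.ext (by simp [coe_reesMonomial])
    | smul a f _ hf =>
      obtain ⟨hf, hf'⟩ := hf
      refine ⟨Ideal.mul_mem_left _ _ hf, ?_⟩
      convert Ideal.mul_mem_left _ (algebraMap R (weightedRees x w) a) hf' using 1
      exact Subtype.ext (by simp [coe_reesMonomial, C_mul_monomial])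
  refine ProjectiveSpectrum.not_irrelevant_le (𝒜 := weightedGrading x w) P ?_
  intro f hf
  classical
  have hf : f ∈ HomogeneousIdeal.irrelevant (weightedGrading x w) := hf
  rw [HomogeneousIdeal.mem_irrelevant_iff, GradedRing.proj_apply] at hf
  change f ∈ pointIdeal P
  rw [← DirectSum.sum_support_decompose (weightedGrading x w) f]
  refine Ideal.sum_mem _ fun n _ => ?_
  rcases Nat.eq_zero_or_pos n with rfl | hn
  · rw [hf]
    exact Ideal.zero_mem _
  · rw [coe_decompose]
    exact (key n _ hn (f.2 n)).2

theorem isDenominator_two_of_mem_strictTransform {P : weightedBlowup x w} (hw : ∀ i, 0 < w i)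
    (hw2 : w 2 = 1) (hP : P ∈ strictTransform x w (Ideal.span {x 0, x 1})) :
    IsDenominator P 1 (x 2) := by
  obtain ⟨i, hi⟩ := exists_isDenominator hw P
  fin_cases i
  · exact absurd hi (not_isDenominator_of_mem_strictTransform hw2 hP
      (Ideal.subset_span (by simp)))
  · exact absurd hi (not_isDenominator_of_mem_strictTransform hw2 hP
      (Ideal.subset_span (by simp)))
  · exact hw2 ▸ hi

end StrictTransform

variable {k K : Type*} [Field k] [Field K] [Algebra k K]

theorem not_isUnit_of_not_isDenominator {A : Subalgebra k K} {d : ℕ} {x : Fin d → A}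
    {w : Fin d → ℕ} {P : weightedBlowup x w} {n : ℕ} {f g : A} (hf : f ∈ weightedIdeal x w n)
    (hf' : ¬ IsDenominator P n f) (hg : IsDenominator P n g) {r : localRingAt P}
    (hr : (r : K) = f / g) : ¬ IsUnit r := by
  intro hu
  obtain ⟨s, hs⟩ := hu.exists_right_inv
  obtain ⟨m, a, b, ha, hb, e⟩ := mem_localRingAt_iff.1 s.2
  have hg0 : (g : K) ≠ 0 := fun h0 => hg.ne_zero (Subtype.ext h0)
  have hb0 : (b : K) ≠ 0 := fun h0 => hb.ne_zero (Subtype.ext h0)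
  have h1 : (r * s : K) = 1 := by rw [← MulMemClass.coe_mul, hs]; rfl
  rw [hr, e] at h1
  have h2 : f * a = g * b := by
    apply Subtype.ext
    simp only [MulMemClass.coe_mul]
    field_simp at h1
    exact h1
  have h3 := hg.mul hb
  apply h3.2
  have h4 : reesMonomial h3.1 = reesMonomial hf * reesMonomial ha :=
    Subtype.ext (by rw [reesMonomial_mul, coe_reesMonomial, coe_reesMonomial, h2])
  rw [h4]
  refine Ideal.mul_mem_right _ _ ?_
  by_contra h5
  exact hf' ⟨hf, h5⟩

/-- Every element of the local ring is a constant modulo the ideal of the blow-up coordinates, none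
of which is a unit; so that ideal is the maximal ideal. -/
theorem CoordSystem.localRingAt [CharZero k] {A : Subalgebra k K} {x : Fin 3 → A}
    {D : Fin 3 → Derivation k K K} {w : Fin 3 → ℕ} (h : CoordSystem A x D) (hw : ∀ i, 0 < w i)
    (hw2 : w 2 = 1) {P : weightedBlowup x w} (hden : IsDenominator P 1 (x 2))
    (hloc : IsLocalRing (localRingAt P))
    (hP : P ∈ exceptionalLocus x w) (hP' : P ∈ strictTransform x w (Ideal.span {x 0, x 1})) :
    CoordSystem (localRingAt P) (fun i => ⟨blowupCoord x w i, blowupCoord_mem hden i⟩)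
      (blowupDer x D w) := by
  set B := WeightedBlowup.localRingAt P with hB
  set ι := Subalgebra.inclusion (le_localRingAt P) with hι
  set u : Fin 3 → B := fun i => ⟨blowupCoord x w i, blowupCoord_mem hden i⟩ with hu
  have ht : (x 2 : K) ≠ 0 := coord_two_ne_zero h 2
  have hu2 : u 2 = ι (x 2) := rfl
  have hpow : ∀ i, IsDenominator P (w i) (x 2 ^ w i) := fun i => by
    have := hden.pow (w i)
    rwa [mul_one] at this
  have hunit : ∀ i, ¬ IsUnit (u i) := by
    intro i
    fin_cases i
    · exact not_isUnit_of_not_isDenominator (coord_mem_weightedIdeal x w 0)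
        (not_isDenominator_of_mem_strictTransform hw2 hP' (Ideal.subset_span (by simp)))
        (hpow 0) (by simp [u, blowupCoord])
    · exact not_isUnit_of_not_isDenominator (coord_mem_weightedIdeal x w 1)
        (not_isDenominator_of_mem_strictTransform hw2 hP' (Ideal.subset_span (by simp)))
        (hpow 1) (by simp [u, blowupCoord])
    · refine not_isUnit_of_not_isDenominator (f := x 2) (g := 1) (n := 0)
        (by simp [weightedIdeal_zero]) ?_ (IsDenominator.one P) (by simp [u, blowupCoord])
      rw [isDenominator_zero_iff, not_not]
      exact hP 2
  have hle : Ideal.span (Set.range u) ≤ maximalIdeal B := by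
    rw [Ideal.span_le]
    rintro _ ⟨i, rfl⟩
    exact hunit i
  have hι' : ∀ f ∈ Ideal.span (Set.range x), ι f ∈ Ideal.span (Set.range u) := by
    intro f hf
    have h1 : Ideal.span (Set.range x) ≤ (Ideal.span (Set.range u)).comap ι.toRingHom := by
      rw [Ideal.span_le]
      rintro _ ⟨i, rfl⟩
      change ι (x i) ∈ Ideal.span (Set.range u)
      have h2 : ι (x i) = ι (x 2) ^ (if i = 2 then 0 else w i) * u i := by
        apply Subtype.ext
        fin_cases i
        · change (x 0 : K) = (x 2 : K) ^ w 0 * (x 0 / (x 2 : K) ^ w 0)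
          field_simp
        · change (x 1 : K) = (x 2 : K) ^ w 1 * (x 1 / (x 2 : K) ^ w 1)
          field_simp
        · change (x 2 : K) = (x 2 : K) ^ 0 * x 2
          simp
      rw [h2]
      exact Ideal.mul_mem_left _ _ (Ideal.subset_span ⟨i, rfl⟩)
    exact h1 hf
  -- `N` is the preimage of the constants of the quotient by the coordinates; it contains A and the
  -- coordinates, hence numerators and denominators after division by t^n.
  let N : Subalgebra k B :=
    (⊥ : Subalgebra k (B ⧸ Ideal.span (Set.range u))).comap
      (Ideal.Quotient.mkₐ k (Ideal.span (Set.range u)))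
  have hN : ∀ b, b ∈ N ↔ ∃ c : k, b - algebraMap k B c ∈ Ideal.span (Set.range u) := by
    intro b
    rw [Subalgebra.mem_comap, Algebra.mem_bot]
    constructor
    · rintro ⟨c, hc⟩
      refine ⟨c, ?_⟩
      rw [← Ideal.Quotient.eq]
      exact hc.symm
    · rintro ⟨c, hc⟩
      rw [← Ideal.Quotient.eq] at hc
      exact ⟨c, hc.symm⟩
  have hAN : ∀ a, ι a ∈ N := by
    intro a
    obtain ⟨c, hc⟩ := h.exists_const a
    refine (hN _).2 ⟨c, ?_⟩
    have := hι' _ hc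
    rwa [map_sub, AlgHom.commutes] at this
  have huN : ∀ i, u i ∈ N := fun i => (hN _).2 ⟨0, by
    rw [map_zero, sub_zero]; exact Ideal.subset_span ⟨i, rfl⟩⟩
  have hconst : ∀ b : B, ∃ c : k, b - algebraMap k B c ∈ Ideal.span (Set.range u) := by
    intro b
    obtain ⟨n, f, g, hf, hg, e⟩ := mem_localRingAt_iff.1 b.2
    obtain ⟨c, hc, hc'⟩ := exists_mem_eq_pow_mul hden ht hw2 N hAN huN hf
    obtain ⟨d, hd, hd'⟩ := exists_mem_eq_pow_mul hden ht hw2 N hAN huN hg.1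
    have hdu := hg.isUnit_of_eq hw2 hd'
    have hg0 : (g : K) ≠ 0 := fun h0 => hg.ne_zero (Subtype.ext h0)
    have h1 : b * d = c := by
      have h2 : ι (x 2) ^ n * (b * d) = ι (x 2) ^ n * c := by
        rw [← hc', mul_left_comm, ← hd']
        apply Subtype.ext
        rw [MulMemClass.coe_mul, e]
        change (f / g * g : K) = f
        field_simp
      refine mul_left_cancel₀ (pow_ne_zero n ?_) h2
      intro h0
      exact ht (congrArg Subtype.val h0)
    obtain ⟨c', hc'⟩ := (hN c).1 hc
    obtain ⟨d', hd'⟩ := (hN d).1 hd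
    have hd0 : d' ≠ 0 := by
      rintro rfl
      rw [map_zero, sub_zero] at hd'
      exact hle hd' hdu
    refine ⟨c' / d', ?_⟩
    obtain ⟨e', he'⟩ := hdu.exists_right_inv
    have h3 : b - algebraMap k B (c' / d') = (c - algebraMap k B c') * e' -
        algebraMap k B (c' / d') * (d - algebraMap k B d') * e' := by
      have h4 : algebraMap k B (c' / d') * algebraMap k B d' = algebraMap k B c' := by
        rw [← map_mul, div_mul_cancel₀ _ hd0]
      rw [← h1]
      linear_combination (algebraMap k B (c' / d') - b) * he' - e' * h4
    rw [h3]
    exact sub_mem (Ideal.mul_mem_right _ _ hc') (Ideal.mul_mem_right _ _ (Ideal.mul_mem_left _ _ hd'))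
  refine ⟨fun b => ⟨fun hb => hle hb, fun hb => ?_⟩, hconst, ?_, ?_⟩
  · obtain ⟨c, hc⟩ := hconst b
    by_cases hc0 : c = 0
    · rwa [hc0, map_zero, sub_zero] at hc
    · refine absurd (hle hc) fun h1 => ?_
      have h2 := (maximalIdeal B).sub_mem (show b ∈ maximalIdeal B from hb) h1
      rw [sub_sub_cancel] at h2
      exact h2 ((IsUnit.mk0 c hc0).map _)
  · intro i b hb
    exact h.blowupDer_mem hw hw2 hden i hb
  · exact blowupDer_coord h hw2

end WeightedBlowup

end

noncomputable section

open Polynomial AlgebraicGeometry IsLocalRing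

namespace WeightedBlowup

variable {k K : Type*} [Field k] [Field K] [Algebra k K]

/-! ### The order filtration -/

/-- The elements `f` of `K` with `f / t^n ∈ R`. -/
def orderFiltration (R : Subalgebra k K) (t : K) (n : ℤ) : Submodule k K where
  carrier := {f | t ^ (-n) * f ∈ R}
  add_mem' {f g} hf hg := by
    rw [Set.mem_ofPred_eq, mul_add]
    exact add_mem hf hg
  zero_mem' := by simp
  smul_mem' c f hf := by
    rw [Set.mem_ofPred_eq, mul_smul_comm]
    exact Subalgebra.smul_mem R hf c

section Filtration

variable {R : Subalgebra k K} {t : K}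

theorem mem_orderFiltration {n : ℤ} {f : K} : f ∈ orderFiltration R t n ↔ t ^ (-n) * f ∈ R :=
  Iff.rfl

theorem mem_orderFiltration_zero {f : K} : f ∈ orderFiltration R t 0 ↔ f ∈ R := by
  simp [mem_orderFiltration]

theorem orderFiltration_antitone (ht : t ≠ 0) (htR : t ∈ R) : Antitone (orderFiltration R t) := by
  intro m n h f hf
  obtain ⟨l, rfl⟩ := Int.le.dest h
  rw [mem_orderFiltration] at hf ⊢
  have : t ^ (-m) * f = t ^ l * (t ^ (-(m + l)) * f) := by
    rw [← mul_assoc, ← zpow_natCast, ← zpow_add₀ ht]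
    congr 2
    ring
  rw [this]
  exact mul_mem (pow_mem htR l) hf

theorem mul_mem_orderFiltration (ht : t ≠ 0) {m n : ℤ} {f g : K} (hf : f ∈ orderFiltration R t m)
    (hg : g ∈ orderFiltration R t n) : f * g ∈ orderFiltration R t (m + n) := by
  rw [mem_orderFiltration] at *
  have : t ^ (-(m + n)) * (f * g) = t ^ (-m) * f * (t ^ (-n) * g) := by
    rw [neg_add, zpow_add₀ ht]
    ring
  rw [this]
  exact mul_mem hf hg

theorem pow_mem_orderFiltration {m : ℤ} {f : K} (hf : f ∈ orderFiltration R t m)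
    (n : ℕ) : f ^ n ∈ orderFiltration R t (n * m) := by
  rw [mem_orderFiltration] at *
  have : t ^ (-(n * m)) * f ^ n = (t ^ (-m) * f) ^ n := by
    rw [mul_pow, ← zpow_natCast (t ^ (-m)), ← zpow_mul]
    congr 2
    ring
  rw [this]
  exact pow_mem hf n

theorem zpow_mem_orderFiltration (ht : t ≠ 0) (n : ℤ) : t ^ n ∈ orderFiltration R t n := by
  rw [mem_orderFiltration, ← zpow_add₀ ht, neg_add_cancel, zpow_zero]
  exact one_mem R

theorem pow_mem_orderFiltration_self (ht : t ≠ 0) (n : ℕ) :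
    t ^ n ∈ orderFiltration R t n := by
  exact_mod_cast zpow_mem_orderFiltration ht n

theorem mem_orderFiltration_iff_dvd {R : Subalgebra k K} {t f : R} (ht : t ≠ 0) {n : ℕ} :
    (f : K) ∈ orderFiltration R (t : K) n ↔ t ^ n ∣ f := by
  have ht' : (t : K) ≠ 0 := fun h => ht (Subtype.ext h)
  rw [mem_orderFiltration]
  constructor
  · intro h
    refine ⟨⟨_, h⟩, Subtype.ext ?_⟩
    simp [ht']
  · rintro ⟨c, rfl⟩
    have : (t : K) ^ (-(n : ℤ)) * (t ^ n * c : R) = c := by simp [ht']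
    rw [this]
    exact c.2

end Filtration

namespace IsMonomial

variable {E : Divisor k K} {A : Subalgebra k K} {x : Fin 3 → A} {w : Fin 3 → ℕ}

theorem coord_ne_zero (h : IsMonomial E x w) : (x 2 : K) ≠ 0 := fun h0 =>
  h.inclusion_ne_zero (Subtype.ext h0)

theorem coord_mem (h : IsMonomial E x w) : (x 2 : K) ∈ E.ring := h.le (x 2).2

theorem mem_weightedIdeal_iff_order [CharZero k] {D : Fin 3 → Derivation k K K}
    (h : IsMonomial E x w) (hx : CoordSystem A x D)
    (hw : ∀ i, 0 < w i) (hw2 : w 2 = 1) {n : ℕ} {f : A} :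
    f ∈ weightedIdeal x w n ↔ (f : K) ∈ orderFiltration E.ring (x 2 : K) n := by
  rw [h.mem_weightedIdeal_iff hx hw hw2, ← mem_orderFiltration_iff_dvd h.inclusion_ne_zero]
  rfl

theorem coord_mem_orderFiltration (h : IsMonomial E x w) (hw2 : w 2 = 1) (i : Fin 3) :
    (x i : K) ∈ orderFiltration E.ring (x 2 : K) (w i) := by
  have := (mem_orderFiltration_iff_dvd h.inclusion_ne_zero).2
    (h.pow_dvd_of_mem hw2 (coord_mem_weightedIdeal x w i))
  exact this

theorem exists_pow_iff (h : IsMonomial E x w) {n : ℕ} {f : K} :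
    (∃ g ∈ maximalIdeal E.ring ^ n, (g : K) = f) ↔ f ∈ orderFiltration E.ring (x 2 : K) n := by
  constructor
  · rintro ⟨g, hg, rfl⟩
    rw [h.mem_maximalIdeal_pow_iff, ← mem_orderFiltration_iff_dvd h.inclusion_ne_zero] at hg
    exact hg
  · intro hf
    have h1 : f ∈ E.ring := mem_orderFiltration_zero.1
      (orderFiltration_antitone h.coord_ne_zero h.coord_mem (Int.natCast_nonneg n) hf)
    exact ⟨⟨f, h1⟩, h.mem_maximalIdeal_pow_iff.2
      ((mem_orderFiltration_iff_dvd h.inclusion_ne_zero).1 hf), rfl⟩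

theorem le_ord_iff (h : IsMonomial E x w) {B : Subalgebra k K} (hB : B ≤ E.ring) {I : Ideal B}
    {n : ℕ} : (n : ℕ∞) ≤ E.ord I ↔
      ∀ f ∈ I, (f : K) ∈ orderFiltration E.ring (x 2 : K) n := by
  simp only [Divisor.ord, h.exists_pow_iff]
  constructor
  · intro hn f hf
    -- For `n + 1` the supremum exceeds `n`, so some admissible exponent is at least `n + 1`; for
    -- `0` the claim is just that `B` lies in the valuation ring.
    rcases n with _ | n
    · exact mem_orderFiltration_zero.2 (hB f.2)
    · have h1 : (n : ℕ∞) < ⨆ (ν : ℕ) (_ : ∀ f ∈ I, (f : K) ∈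
          orderFiltration E.ring (x 2 : K) ν), (ν : ℕ∞) :=
        lt_of_lt_of_le (by exact_mod_cast n.lt_succ_self) hn
      simp only [lt_iSup_iff] at h1
      obtain ⟨ν, hν, h2⟩ := h1
      exact orderFiltration_antitone h.coord_ne_zero h.coord_mem
        (by exact_mod_cast h2) (hν f hf)
  · intro hn
    exact le_iSup₂_of_le n hn le_rfl

end IsMonomial

/-! ### Weak transforms -/

theorem CoordSystem.localRingAt_le [CharZero k] {A : Subalgebra k K} {x : Fin 3 → A}
    {D : Fin 3 → Derivation k K K} {w : Fin 3 → ℕ} (h : CoordSystem A x D) (hw : ∀ i, 0 < w i)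
    {P : weightedBlowup x w} (hP : P ∈ exceptionalLocus x w) :
    WeightedBlowup.localRingAt P ≤ WeightedBlowup.localRingAt (h.genericPoint hw) := by
  intro z hz
  obtain ⟨n, f, g, hf, hg, rfl⟩ := mem_localRingAt_iff.1 hz
  exact div_mem_localRingAt hf ⟨hg.1, fun h1 => hg.2 (initialIdeal_le hw P hP h1)⟩

/-- A fraction g = a/b in 𝒪(-eE) has its numerator e steps deeper in the filtration, so (f/t^e) g =
(a/(t^e b)) f lies in the extended ideal. This inclusion is what bounds the order of f along F from
below by e plus the order of the weak transform. -/
theorem div_mem_weakTransformIdeal [CharZero k] {A : Subalgebra k K} {x : Fin 3 → A}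
    {D : Fin 3 → Derivation k K K} {w : Fin 3 → ℕ} (h : CoordSystem A x D) (hw : ∀ i, 0 < w i)
    (hw2 : w 2 = 1) {P : weightedBlowup x w} (hP : P ∈ exceptionalLocus x w)
    (hden : IsDenominator P 1 (x 2)) {E : Divisor k K}
    (hE : E.ring = localRingAt (h.genericPoint hw)) {I : Ideal A} {e : ℕ} (he : E.ord I = e)
    {f : A} (hf : f ∈ I) :
    ∃ b ∈ weakTransformIdeal E (localRingAt P) I, (b : K) * (x 2 : K) ^ e = f := by
  have hmon := h.isMonomial hw hw2 E hE
  have ht : (x 2 : K) ≠ 0 := hmon.coord_ne_zero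
  have hB : localRingAt P ≤ E.ring := hE ▸ h.localRingAt_le hw hP
  have hpow : IsDenominator P e (x 2 ^ e) := by
    have := hden.pow e
    rwa [mul_one] at this
  have hfe : f ∈ weightedIdeal x w e := by
    rw [hmon.mem_weightedIdeal_iff_order h hw hw2]
    exact (hmon.le_ord_iff hmon.le).1 he.ge f hf
  refine ⟨⟨_, div_mem_localRingAt hfe hpow⟩, ?_, by simp [ht]⟩
  rw [weakTransformIdeal, he, Submodule.mem_colon]
  intro g hg
  rw [SetLike.mem_coe, divisorialIdeal] at hg
  induction hg using Submodule.span_induction with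
  | mem g hg =>
    have hg1 := (hmon.le_ord_iff hB).1 hg g (Ideal.mem_span_singleton_self g)
    obtain ⟨n, a, b, ha, hb, e1⟩ := mem_localRingAt_iff.1 g.2
    have hb0 : (b : K) ≠ 0 := fun h0 => hb.ne_zero (Subtype.ext h0)
    have ha' : a ∈ weightedIdeal x w (e + n) := by
      rw [hmon.mem_weightedIdeal_iff_order h hw hw2]
      have h1 : (a : K) = g * b := by rw [e1]; field_simp
      rw [h1, Nat.cast_add]
      exact mul_mem_orderFiltration ht hg1 ((hmon.mem_weightedIdeal_iff_order h hw hw2).1 hb.1)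
    have h3 : (⟨_, div_mem_localRingAt hfe hpow⟩ : localRingAt P) • g =
        ⟨_, div_mem_localRingAt ha' (hpow.mul hb)⟩ *
          Subalgebra.inclusion (le_localRingAt P) f := by
      apply Subtype.ext
      simp only [smul_eq_mul, MulMemClass.coe_mul, e1, SubmonoidClass.coe_pow]
      change _ = _ * (f : K)
      field_simp
    rw [h3]
    exact Ideal.mul_mem_left _ _ (Ideal.subset_span ⟨f, hf, rfl⟩)
  | zero => simp
  | add a b _ _ ha hb => rw [smul_add]; exact add_mem ha hb
  | smul a b _ hb => rw [smul_comm]; exact Submodule.smul_mem _ _ hb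

/-! ### Log discrepancies -/

/-- In `EReal` anything minus `⊤` is `⊥`, so a log discrepancy at least 1 forces all the orders to
be finite, whatever the canonical order is. -/
theorem exists_ord_of_one_le {A : Subalgebra k K} {𝔞 : RIdeal A} {E : Divisor k K}
    (h : 1 ≤ logDiscrepancy A 𝔞 E) : ∃ e : Fin 𝔞.length → ℕ,
      (∀ j, E.ord (𝔞.ideal j) = e j) ∧
      E.ordRIdeal 𝔞 = ENNReal.ofReal (∑ j, 𝔞.exponent j * e j) := by
  have h1 : E.ordRIdeal 𝔞 ≠ ⊤ := by
    intro h1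
    rw [logDiscrepancy, h1, EReal.coe_ennreal_top, EReal.sub_top] at h
    exact absurd (le_bot_iff.1 h) (EReal.coe_ne_bot 1)
  have h2 : ∀ j, E.ord (𝔞.ideal j) ≠ ⊤ := by
    intro j hj
    refine h1 (ENNReal.sum_eq_top.2 ⟨j, Finset.mem_univ j, ?_⟩)
    rw [hj, ENat.toENNReal_top, ENNReal.mul_top]
    simpa using 𝔞.exponent_pos j
  choose e he using fun j => ENat.ne_top_iff_exists.1 (h2 j)
  refine ⟨e, fun j => (he j).symm, ?_⟩
  rw [Divisor.ordRIdeal, ENNReal.ofReal_sum_of_nonneg]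
  · refine Finset.sum_congr rfl fun j _ => ?_
    rw [← he j, ENNReal.ofReal_mul (𝔞.exponent_pos j).le]
    simp
  · intro j _
    exact mul_nonneg (𝔞.exponent_pos j).le (Nat.cast_nonneg _)

theorem sum_nonneg {A : Subalgebra k K} (𝔞 : RIdeal A) (e : Fin 𝔞.length → ℕ) :
    0 ≤ ∑ j, 𝔞.exponent j * (e j : ℝ) :=
  Finset.sum_nonneg fun j _ => mul_nonneg (𝔞.exponent_pos j).le (Nat.cast_nonneg _)

theorem exists_ord_of_canonicalOrder_le {A : Subalgebra k K} {𝔞 : RIdeal A} {E : Divisor k K}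
    (h : 1 ≤ logDiscrepancy A 𝔞 E) {c : ℕ} (hc : E.canonicalOrder A ≤ c) :
    ∃ e : Fin 𝔞.length → ℕ, (∀ j, E.ord (𝔞.ideal j) = e j) ∧ ∑ j, 𝔞.exponent j * e j ≤ c := by
  obtain ⟨e, he, hs⟩ := exists_ord_of_one_le h
  refine ⟨e, he, ?_⟩
  obtain ⟨m, hm⟩ := ENat.ne_top_iff_exists.1 (ne_top_of_le_ne_top (ENat.natCast_ne_top c) hc)
  rw [← hm] at hc
  rw [logDiscrepancy, hs, ← hm, EReal.coe_ennreal_ofReal, max_eq_left (sum_nonneg 𝔞 e)] at h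
  have h1 : (1 : ℝ) ≤ 1 + (m : ℝ) - ∑ j, 𝔞.exponent j * e j := by
    have : (((m : ℕ∞) : ENNReal) : EReal) = ((m : ℝ) : EReal) := by simp; rfl
    rw [this] at h
    exact_mod_cast h
  have h2 : (m : ℝ) ≤ c := by exact_mod_cast hc
  linarith

theorem exists_ord_of_le_canonicalOrder {A : Subalgebra k K} {𝔞 : RIdeal A} {E : Divisor k K}
    (h : logDiscrepancy A 𝔞 E = 1) {c : ℕ} (hc : c ≤ E.canonicalOrder A) :
    ∃ e : Fin 𝔞.length → ℕ, (∀ j, E.ord (𝔞.ideal j) = e j) ∧ c ≤ ∑ j, 𝔞.exponent j * e j := by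
  obtain ⟨e, he, hs⟩ := exists_ord_of_one_le h.ge
  refine ⟨e, he, ?_⟩
  rw [logDiscrepancy, hs, EReal.coe_ennreal_ofReal, max_eq_left (sum_nonneg 𝔞 e)] at h
  -- An infinite canonical order is impossible: the orders of the ideals are finite, so the log
  -- discrepancy would be `⊤` instead of 1.
  by_cases htop : E.canonicalOrder A = ⊤
  · rw [htop] at h
    simp only [ENat.toENNReal_top, EReal.coe_ennreal_top] at h
    have h3 : (1 : EReal) + ⊤ = ⊤ := EReal.add_top_of_ne_bot (by decide)
    rw [h3, EReal.top_sub_coe] at h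
    exact absurd h (by decide)
  · obtain ⟨m, hm⟩ := ENat.ne_top_iff_exists.1 htop
    rw [← hm] at hc h
    have h1 : 1 + (m : ℝ) - ∑ j, 𝔞.exponent j * e j = 1 := by
      have : (((m : ℕ∞) : ENNReal) : EReal) = ((m : ℝ) : EReal) := by simp; rfl
      rw [this] at h
      exact_mod_cast h
    have h2 : (c : ℝ) ≤ m := by exact_mod_cast hc
    linarith

theorem one_le_logDiscrepancy {A : Subalgebra k K} {𝔞 : RIdeal A} (hmld : mld A 𝔞 = 1)
    {E : Divisor k K} (hE : E.HasCentre A) : 1 ≤ logDiscrepancy A 𝔞 E :=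
  hmld ▸ sInf_le ⟨E, hE, rfl⟩

theorem CoordSystem.hasCentre [CharZero k] {A : Subalgebra k K} {x : Fin 3 → A}
    {D : Fin 3 → Derivation k K K} {w : Fin 3 → ℕ} (h : CoordSystem A x D) (hw : ∀ i, 0 < w i)
    (hw2 : w 2 = 1) {G : Divisor k K} (hG : G.ring = WeightedBlowup.localRingAt (h.genericPoint hw)) :
    G.HasCentre A := by
  have hmon := h.isMonomial hw hw2 G hG
  refine ⟨hmon.le, fun a b e hb => ?_⟩
  by_contra ha
  rw [← h.mem_span_iff, ← weightedIdeal_one_eq_span x w hw] at ha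
  have h1 := hmon.pow_dvd_of_mem hw2 ha
  have h2 : Subalgebra.inclusion hmon.le a = b := Subtype.ext e
  rw [pow_one, h2] at h1
  exact hmon.irreducible.not_isUnit (isUnit_of_dvd_unit h1 hb)

end WeightedBlowup

end

noncomputable section

open Polynomial AlgebraicGeometry IsLocalRing

namespace WeightedBlowup

/-! ### Initial forms under a weighted substitution -/

section InitialForm

variable {k : Type*} [Field k]

theorem coeff_coeff_swap (p : k[X][X]) (a b : ℕ) :
    ((Bivariate.swap (R := k) p).coeff a).coeff b = (p.coeff b).coeff a := by
  induction p using Polynomial.induction_on' with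
  | add p q hp hq => simp [hp, hq]
  | monomial n q =>
    induction q using Polynomial.induction_on' with
    | add p q hp hq => simp only [map_add, coeff_add, hp, hq]
    | monomial m c =>
      rw [Bivariate.swap_monomial_monomial]
      simp only [coeff_monomial]
      split_ifs <;> simp_all [coeff_monomial]

/-- The root multiplicity of `Q` with respect to the outer variable bounds the degree of the inner
variable. -/
theorem exists_coeff_ne_zero_of_pow_dvd {f : k[X][X]} (hf : f ≠ 0) {Q : k[X]} {M d : ℕ}
    (hQ : d ≤ Q.natDegree) (h : (X - C Q) ^ M ∣ f) :
    ∃ a b, M * d ≤ a ∧ (f.coeff b).coeff a ≠ 0 := by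
  obtain ⟨g, rfl⟩ := h
  have hg : g ≠ 0 := right_ne_zero_of_mul hf
  set σ := Bivariate.swap (R := k)
  -- Swapping the variables turns the degree in the inner variable into `natDegree`, which is
  -- additive on products.
  have hσ : ∀ p, p ≠ 0 → σ p ≠ 0 := fun p hp h0 => hp (σ.injective (by rw [h0, map_zero]))
  have h1 : d ≤ (σ (X - C Q)).natDegree := by
    rcases Nat.eq_zero_or_pos d with rfl | hd
    · exact Nat.zero_le _
    refine hQ.trans (le_natDegree_of_ne_zero fun h0 => ?_)
    have h2 := coeff_coeff_swap (X - C Q) Q.natDegree 0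
    rw [h0] at h2
    simp only [coeff_zero, coeff_sub, coeff_X_zero, zero_sub, coeff_C_zero, coeff_neg,
      coeff_natDegree] at h2
    have h3 : Q = 0 := by simpa using h2.symm
    rw [h3, natDegree_zero] at hQ
    omega
  have h2 : M * d ≤ (σ ((X - C Q) ^ M * g)).natDegree := by
    rw [map_mul, map_pow, natDegree_mul (pow_ne_zero _ (hσ _ (X_sub_C_ne_zero Q))) (hσ _ hg),
      natDegree_pow]
    exact (Nat.mul_le_mul_left M h1).trans (Nat.le_add_right _ _)
  have h3 : (σ ((X - C Q) ^ M * g)).leadingCoeff ≠ 0 := leadingCoeff_ne_zero.2 (hσ _ hf)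
  obtain ⟨b, hb⟩ : ∃ b, ((σ ((X - C Q) ^ M * g)).leadingCoeff).coeff b ≠ 0 := by
    by_contra! hcon
    exact h3 (Polynomial.ext (by simpa using hcon))
  refine ⟨_, b, h2, ?_⟩
  rwa [← coeff_coeff_swap]

/-- The substitution `S ↦ S τ^σ`, `Y ↦ Y τ^μ`, `T ↦ τ^N`. -/
def weightedSubst (σ μ N : ℕ) : MvPolynomial (Fin 3) k →ₐ[k] k[X][X][X] :=
  MvPolynomial.aeval (![C (C X) * X ^ σ, C X * X ^ μ, X ^ N] : Fin 3 → k[X][X][X])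

variable {σ μ N : ℕ}

theorem weightedSubst_monomial (s : Fin 3 →₀ ℕ) (c : k) :
    weightedSubst σ μ N (MvPolynomial.monomial s c) =
      monomial (σ * s 0 + μ * s 1 + N * s 2) (monomial (s 1) (monomial (s 0) c)) := by
  rw [weightedSubst, MvPolynomial.aeval_monomial, Finsupp.prod_fintype _ _ (by simp),
    Fin.prod_univ_three]
  simp only [Matrix.cons_val_zero, Matrix.cons_val_one, Matrix.cons_val, ← C_mul_X_pow_eq_monomial]
  have : algebraMap k k[X][X][X] c = C (C (C c)) := rfl
  rw [this]
  simp only [map_mul, map_pow]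
  ring

/-- The outermost variable τ records the weight. As N > 0, the weight and the exponents of S and Y
determine that of T, so distinct monomials do not collide. -/
theorem coeff_weightedSubst (hN : 0 < N) (Φ : MvPolynomial (Fin 3) k) (s : Fin 3 →₀ ℕ) :
    (((weightedSubst σ μ N Φ).coeff (σ * s 0 + μ * s 1 + N * s 2)).coeff (s 1)).coeff (s 0) =
      Φ.coeff s := by
  classical
  induction Φ using MvPolynomial.induction_on' with
  | add p q hp hq => simp only [map_add, coeff_add, MvPolynomial.coeff_add, hp, hq]
  | monomial r b =>
    rw [weightedSubst_monomial, MvPolynomial.coeff_monomial]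
    simp only [coeff_monomial]
    split_ifs with h1 h2 h2
    · subst h2; simp
    · by_cases h3 : r 1 = s 1
      · by_cases h4 : r 0 = s 0
        · refine absurd (Finsupp.ext fun i => ?_) h2
          have h5 : r 2 = s 2 := by
            rw [h3, h4] at h1
            exact Nat.eq_of_mul_eq_mul_left hN (by omega)
          fin_cases i <;> simp [*]
        · simp [h3, coeff_monomial, h4]
      · simp [coeff_monomial, h3]
    · subst h2; exact absurd rfl h1
    · simp

theorem exists_mem_support_of_coeff_ne_zero {Φ : MvPolynomial (Fin 3) k} {V a b : ℕ}
    (h : (((weightedSubst σ μ N Φ).coeff V).coeff b).coeff a ≠ 0) :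
    ∃ s ∈ Φ.support, s 0 = a ∧ s 1 = b ∧ σ * s 0 + μ * s 1 + N * s 2 = V := by
  by_contra! hcon
  apply h
  rw [Φ.as_sum, map_sum]
  simp only [finsetSum_coeff]
  refine Finset.sum_eq_zero fun s hs => ?_
  rw [weightedSubst_monomial]
  simp only [coeff_monomial]
  split_ifs with h1
  · rw [coeff_monomial]
    split_ifs with h2
    · rw [coeff_monomial, if_neg]
      intro h3
      exact hcon s hs h3 h2 h1
    · simp
  · simp

/-- Let `V` be the minimal weight of `Φ(S, X, T)`. If `p(S, T)` has weight at least the weight of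
`X`, and has a monomial of this weight with degree at least `d` in `S`, then there is an `M` such
that `Φ(S, Y + p, T)` has a monomial of degree `M` in `Y` and weight `V`, and `Φ` has a monomial of
weight `V` and of degree at least `M d` in `S`. -/
theorem exists_initial_monomials (hN : 0 < N) {Φ : MvPolynomial (Fin 3) k} (hΦ : Φ ≠ 0)
    {p : MvPolynomial (Fin 2) k} (hp : ∀ s ∈ p.support, μ ≤ σ * s 0 + N * s 1) {d : ℕ}
    (hd : ∃ s ∈ p.support, σ * s 0 + N * s 1 = μ ∧ d ≤ s 0) {Ψ : MvPolynomial (Fin 3) k}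
    (hΨ : Ψ = MvPolynomial.aeval ![MvPolynomial.X 0, MvPolynomial.X 1 +
      MvPolynomial.aeval ![MvPolynomial.X 0, MvPolynomial.X 2] p, MvPolynomial.X 2] Φ) :
    ∃ V M : ℕ, (∀ s ∈ Φ.support, V ≤ σ * s 0 + μ * s 1 + N * s 2) ∧
      (∃ s ∈ Ψ.support, s 1 = M ∧ σ * s 0 + μ * s 1 + N * s 2 = V) ∧
      ∃ s ∈ Φ.support, M * d ≤ s 0 ∧ σ * s 0 + μ * s 1 + N * s 2 = V := by
  classical
  set Θ := weightedSubst (k := k) σ μ N with hΘ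
  set V := (Θ Φ).natTrailingDegree with hV
  have hVle : ∀ s ∈ Φ.support, V ≤ σ * s 0 + μ * s 1 + N * s 2 := by
    intro s hs
    refine natTrailingDegree_le_of_ne_zero fun h0 => ?_
    have h1 := coeff_weightedSubst (σ := σ) (μ := μ) hN Φ s
    rw [← hΘ, h0] at h1
    exact MvPolynomial.mem_support_iff.1 hs (by simpa using h1.symm)
  have hΘΦ : Θ Φ ≠ 0 := by
    obtain ⟨s, hs⟩ := MvPolynomial.support_nonempty.2 hΦ
    intro h0
    have h1 := coeff_weightedSubst (σ := σ) (μ := μ) hN Φ s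
    rw [← hΘ, h0] at h1
    exact MvPolynomial.mem_support_iff.1 hs (by simpa using h1.symm)
  obtain ⟨Φ₁, hΦ₁⟩ : X ^ V ∣ Θ Φ := X_pow_dvd_iff.2 fun d hd =>
    coeff_eq_zero_of_lt_natTrailingDegree hd
  -- `f` is the initial form of Φ with T put equal to 1, a polynomial in X over k[S].
  set f := Φ₁.coeff 0 with hf
  have hfV : f = (Θ Φ).coeff V := by
    rw [hΦ₁, hf]
    simpa using (coeff_X_pow_mul Φ₁ V 0).symm
  have hf0 : f ≠ 0 := by
    rw [hfV]
    exact trailingCoeff_nonzero_iff_nonzero.2 hΘΦ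
  -- `P₁` is p after the weighted substitution, divided by τ^μ; its value at τ = 0 is the initial
  -- form `Q` of p with T put equal to 1.
  set P₁ : k[X][X][X] := ∑ s ∈ p.support,
    monomial (σ * s 0 + N * s 1 - μ) (C (monomial (s 0) (p.coeff s))) with hP₁
  set Q : k[X] := ∑ s ∈ p.support with σ * s 0 + N * s 1 = μ, monomial (s 0) (p.coeff s) with hQ
  have hP₁Q : P₁.coeff 0 = C Q := by
    rw [hP₁, hQ, finsetSum_coeff, map_sum, Finset.sum_filter]
    refine Finset.sum_congr rfl fun s hs => ?_
    rw [coeff_monomial]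
    have := hp s hs
    by_cases h1 : σ * s 0 + N * s 1 = μ
    · rw [if_pos (by omega), if_pos h1]
    · rw [if_neg (by omega), if_neg h1]
  have hΘp : MvPolynomial.aeval (![C (C X) * X ^ σ, X ^ N] : Fin 2 → k[X][X][X]) p = P₁ * (X : k[X][X][X]) ^ μ := by
    conv_lhs => rw [p.as_sum]
    rw [map_sum, hP₁, Finset.sum_mul]
    refine Finset.sum_congr rfl fun s hs => ?_
    rw [MvPolynomial.aeval_monomial, Finsupp.prod_fintype _ _ (by simp), Fin.prod_univ_two,
      ← C_mul_X_pow_eq_monomial, mul_assoc, ← pow_add, Nat.sub_add_cancel (hp s hs),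
      ← C_mul_X_pow_eq_monomial]
    have : algebraMap k k[X][X][X] (p.coeff s) = C (C (C (p.coeff s))) := rfl
    rw [this]
    simp only [map_mul, map_pow, Matrix.cons_val_zero, Matrix.cons_val_one]
    ring
  have hdQ : d ≤ Q.natDegree := by
    obtain ⟨s, hs, h1, h2⟩ := hd
    refine h2.trans (le_natDegree_of_ne_zero ?_)
    rw [hQ, finsetSum_coeff, Finset.sum_eq_single s]
    · simpa using MvPolynomial.mem_support_iff.1 hs
    · intro r hr hrs
      rw [coeff_monomial, if_neg]
      intro h3
      refine hrs (Finsupp.ext fun i => ?_)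
      have h4 := (Finset.mem_filter.1 hr).2
      rw [← h1, h3] at h4
      have h5 : r 1 = s 1 := Nat.eq_of_mul_eq_mul_left hN (by omega)
      fin_cases i
      · exact h3
      · exact h5
    · intro h3
      exact absurd (Finset.mem_filter.2 ⟨hs, h1⟩) h3
  let β : k[X][X] →ₐ[k] k[X][X][X] :=
    { eval₂RingHom ((C : k[X][X] →+* _).comp C) (C X + P₁) with
      commutes' := fun c => by
        change eval₂ _ _ (C (C c)) = _
        rw [eval₂_C]
        rfl }
  have hβC : ∀ q, β (C q) = C (C q) := fun q => eval₂_C _ _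
  have hβX : β X = C X + P₁ := eval₂_X _ _
  let α : k[X][X][X] →ₐ[k] k[X][X][X] :=
    { eval₂RingHom (β : k[X][X] →+* _) X with
      commutes' := fun c => by
        change eval₂ _ _ (C (C (C c))) = _
        rw [eval₂_C]
        change β (C (C c)) = _
        rw [hβC]
        rfl }
  have hαC : ∀ q, α (C q) = β q := fun q => eval₂_C _ _
  have hαX : α X = X := eval₂_X _ _
  -- At τ = 0 the substitution of Y + p for X becomes the Taylor shift by `Q`.
  have h0 : ∀ G : k[X][X][X], (α G).coeff 0 = taylor Q (G.coeff 0) := by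
    have hβ0 : ∀ G : k[X][X], (β G).coeff 0 = taylor Q G := by
      intro G
      have : (constantCoeff.comp (β : k[X][X] →+* k[X][X][X])) =
          (taylorAlgHom Q : k[X][X] →+* k[X][X]) := by
        refine Polynomial.ringHom_ext (fun a => ?_) ?_
        · simp [hβC]
        · simp [hβX, hP₁Q]
      exact congrArg (fun φ : k[X][X] →+* k[X][X] => φ G) this
    intro G
    have : (constantCoeff.comp (α : k[X][X][X] →+* k[X][X][X])) =
        (taylorAlgHom Q : k[X][X] →+* k[X][X]).comp constantCoeff := by
      refine Polynomial.ringHom_ext (fun a => ?_) ?_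
      · simp [hαC, hβ0]
      · simp [hαX]
    exact congrArg (fun φ : k[X][X][X] →+* k[X][X] => φ G) this
  have hΘΨ : Θ Ψ = α (Θ Φ) := by
    have h1 : Θ (MvPolynomial.aeval ![MvPolynomial.X 0, MvPolynomial.X 2] p) =
        P₁ * (X : k[X][X][X]) ^ μ := by
      rw [← hΘp]
      have : (Θ.comp (MvPolynomial.aeval ![MvPolynomial.X 0, MvPolynomial.X 2])) =
          MvPolynomial.aeval (![C (C X) * X ^ σ, X ^ N] : Fin 2 → k[X][X][X]) := by
        refine MvPolynomial.algHom_ext fun i => ?_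
        fin_cases i <;> simp [hΘ, weightedSubst]
      rw [← this]
      rfl
    rw [hΨ]
    have : Θ.comp (MvPolynomial.aeval ![MvPolynomial.X 0, MvPolynomial.X 1 +
        MvPolynomial.aeval ![MvPolynomial.X 0, MvPolynomial.X 2] p, MvPolynomial.X 2]) =
        α.comp Θ := by
      refine MvPolynomial.algHom_ext fun i => ?_
      fin_cases i
      · simp [hΘ, weightedSubst, hαC, hβC, hαX]
      · simp only [Fin.mk_one, AlgHom.comp_apply, MvPolynomial.aeval_X, Matrix.cons_val_one,
          Matrix.cons_val_zero, map_add, h1]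
        simp only [hΘ, weightedSubst, MvPolynomial.aeval_X, Matrix.cons_val_one,
          Matrix.cons_val_zero, map_mul, map_pow, hαC, hβX, hαX]
        ring
      · simp [hΘ, weightedSubst, hαX]
    exact congrArg (fun φ : MvPolynomial (Fin 3) k →ₐ[k] k[X][X][X] => φ Φ) this
  have hΨV : (Θ Ψ).coeff V = taylor Q f := by
    rw [hΘΨ, hΦ₁, map_mul, map_pow, hαX, hf, ← h0]
    simpa using coeff_X_pow_mul (α Φ₁) V 0
  -- After the shift, the multiplicity of the root `Q` is the lowest power of Y that occurs; before
  -- it, (X - Q)^M divides f and forces degree at least M·deg Q in S.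
  obtain ⟨f₁, hf₁, hf₂⟩ := exists_eq_pow_rootMultiplicity_mul_and_not_dvd f hf0 Q
  set M := f.rootMultiplicity Q with hM
  refine ⟨V, M, hVle, ?_, ?_⟩
  · have h1 : (taylor Q f).coeff M ≠ 0 := by
      rw [hf₁, taylor_mul, taylor_pow]
      have h2 : taylor Q (X - C Q) = X := by simp
      have h3 := coeff_X_pow_mul (taylor Q f₁) M 0
      rw [zero_add] at h3
      rw [h2, h3, taylor_coeff_zero]
      rwa [dvd_iff_isRoot] at hf₂
    obtain ⟨a, ha⟩ : ∃ a, ((taylor Q f).coeff M).coeff a ≠ 0 := by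
      by_contra! hcon
      exact h1 (Polynomial.ext (by simpa using hcon))
    rw [← hΨV] at ha
    obtain ⟨s, hs, -, h2, h3⟩ := exists_mem_support_of_coeff_ne_zero ha
    exact ⟨s, hs, h2, h3⟩
  · obtain ⟨a, b, h1, h2⟩ := exists_coeff_ne_zero_of_pow_dvd hf0 hdQ
      (Dvd.intro _ hf₁.symm : (X - C Q) ^ M ∣ f)
    rw [hfV] at h2
    obtain ⟨s, hs, h3, -, h4⟩ := exists_mem_support_of_coeff_ne_zero h2
    exact ⟨s, hs, by omega, h4⟩

end InitialForm

end WeightedBlowup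

end

noncomputable section

open Polynomial AlgebraicGeometry IsLocalRing

namespace WeightedBlowup

variable {k K : Type*} [Field k] [Field K] [Algebra k K]

/-! ### Monomial divisors with respect to new coordinates -/

/-- The derivations t^{v_0}D_0 and t^{v_1}D_1 preserve the valuation ring and kill t. Since t is
constant for them, the Jacobian of the x_i/t^{w_i} is that of the x_i multiplied by
t^{v_0+v_1-w_0-w_1}, which `hdet` makes a unit. -/
theorem IsMonomial.of_jacobian [CharZero k] {B : Subalgebra k K} {z : Fin 3 → B}
    {D : Fin 3 → Derivation k K K} {v : Fin 3 → ℕ} (hz : CoordSystem B z D) (hv : ∀ i, 0 < v i)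
    (hv2 : v 2 = 1) {E : Divisor k K} (hE : E.ring = localRingAt (hz.genericPoint hv))
    {A : Subalgebra k K} {x : Fin 3 → A} {w : Fin 3 → ℕ} (hA : A ≤ E.ring)
    (hx2 : (x 2 : K) = z 2) (h0 : (x 0 : K) ∈ orderFiltration E.ring (z 2 : K) (w 0))
    (h1 : (x 1 : K) ∈ orderFiltration E.ring (z 2 : K) (w 1)) {u : E.ring} (hu : IsUnit u)
    (hdet : (z 2 : K) ^ (v 0 + v 1) * (D 0 (x 0) * D 1 (x 1) - D 0 (x 1) * D 1 (x 0)) =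
      (z 2 : K) ^ (w 0 + w 1) * u) : IsMonomial E x w := by
  have hm := hz.isMonomial hv hv2 E hE
  have ht : (z 2 : K) ≠ 0 := hm.coord_ne_zero
  have e2 : Subalgebra.inclusion hA (x 2) = Subalgebra.inclusion hm.le (z 2) := Subtype.ext hx2
  have key : ∀ (i : Fin 3) (S : K), S = (z 2 : K) ^ (-(w i : ℤ)) * x i →
      (x i : K) = (z 2 : K) ^ w i * S ∧
      ∀ l : Fin 3, l ≠ 2 → (D l (x i) : K) = (z 2 : K) ^ w i * D l S := by
    intro i S hS
    have h3 : (x i : K) = (z 2 : K) ^ w i * S := by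
      rw [hS, ← mul_assoc, ← zpow_natCast, ← zpow_add₀ ht, add_neg_cancel, zpow_zero, one_mul]
    refine ⟨h3, fun l hl => ?_⟩
    rw [h3, Derivation.leibniz, Derivation.leibniz_pow, hz.map_coord, if_neg hl]
    simp
  obtain ⟨k0, d0⟩ := key 0 _ rfl
  obtain ⟨k1, d1⟩ := key 1 _ rfl
  refine ⟨hA, by rw [e2]; exact hm.maximalIdeal_eq, ![⟨_, h0⟩, ⟨_, h1⟩], ?_, ?_, ?_⟩
  · rw [e2]
    exact Subtype.ext k0
  · rw [e2]
    exact Subtype.ext k1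
  · intro P hP
    rw [e2] at hP
    refine residues_independent_of_jacobian hm.irreducible.not_isUnit
      ![(z 2 : K) ^ v 0 • D 0, (z 2 : K) ^ v 1 • D 1] ?_ ?_ ![⟨_, h0⟩, ⟨_, h1⟩] u hu ?_ P hP
    · intro l r hr
      rw [hE] at hr ⊢
      fin_cases l
      · exact hz.pow_smul_mem hv2 0 hr
      · exact hz.pow_smul_mem hv2 1 hr
    · intro l
      have h3 : ((Subalgebra.inclusion hm.le (z 2) : E.ring) : K) = z 2 := rfl
      fin_cases l <;> simp [h3, hz.map_coord]
    · refine mul_left_cancel₀ (pow_ne_zero (w 0 + w 1) ht) ?_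
      rw [← hdet, d0 0 (by decide), d0 1 (by decide), d1 0 (by decide), d1 1 (by decide)]
      simp only [Matrix.cons_val_zero, Matrix.cons_val_one, Derivation.smul_apply, smul_eq_mul]
      ring

section

variable {A R : Subalgebra k K} {x : Fin 3 → A} {t : K}

theorem mem_orderFiltration_of_mem_weightedIdeal (hA : A ≤ R) (ht : t ≠ 0) (htR : t ∈ R)
    {w : Fin 3 → ℕ} (hx : ∀ i, (x i : K) ∈ orderFiltration R t (w i)) {n : ℕ} {f : A}
    (hf : f ∈ weightedIdeal x w n) : (f : K) ∈ orderFiltration R t n := by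
  induction hf using Submodule.span_induction with
  | mem f hf =>
    obtain ⟨s, hs, rfl⟩ := hf
    refine orderFiltration_antitone ht htR
      (show (n : ℤ) ≤ ((s 0 * w 0 + s 1 * w 1 + s 2 * w 2 : ℕ) : ℤ) by
        rw [Fin.sum_univ_three] at hs
        exact_mod_cast hs.trans_eq (by ring)) ?_
    rw [Fin.prod_univ_three]
    push_cast
    exact mul_mem_orderFiltration ht (mul_mem_orderFiltration ht
      (pow_mem_orderFiltration (hx 0) _) (pow_mem_orderFiltration (hx 1) _))
      (pow_mem_orderFiltration (hx 2) _)
  | zero => exact zero_mem _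
  | add f g _ _ hf hg => exact add_mem hf hg
  | smul a f _ hf =>
    have := mul_mem_orderFiltration ht (mem_orderFiltration_zero.2 (hA a.2)) hf
    rwa [zero_add] at this

theorem CoordSystem.exists_polynomial {D : Fin 3 → Derivation k K K} (h : CoordSystem A x D)
    {w : Fin 3 → ℕ} (hw : ∀ i, 0 < w i) (f : A) (n : ℕ) :
    ∃ φ : MvPolynomial (Fin 3) k, f - MvPolynomial.aeval x φ ∈ weightedIdeal x w n := by
  induction n with
  | zero => exact ⟨0, by simp [weightedIdeal_zero]⟩
  | succ n ih =>
    obtain ⟨φ, hφ⟩ := ih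
    obtain ⟨P, -, hP⟩ := h.exists_homogeneous hw hφ
    exact ⟨φ + P, by rwa [map_add, ← sub_sub]⟩

theorem IsMonomial.le_weight_of_mem [CharZero k] {E : Divisor k K} {w : Fin 3 → ℕ}
    (h : IsMonomial E x w) (hw2 : w 2 = 1) {n : ℕ} {P : MvPolynomial (Fin 3) k}
    (hP : ((MvPolynomial.aeval x P : A) : K) ∈ orderFiltration E.ring (x 2 : K) n) :
    ∀ s ∈ P.support, n ≤ w 0 * s 0 + w 1 * s 1 + s 2 := by
  intro s hs
  have := h.le_weight hw2 ((mem_orderFiltration_iff_dvd h.inclusion_ne_zero).1 hP) s hs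
  rwa [Fin.sum_univ_three, hw2, one_mul] at this

end

/-! ### The slope inequality -/

section BlowupSubst

variable {k : Type*} [Field k]

/-- The substitution `X₀ ↦ S T^{w₁}`, `X₁ ↦ X T^{w₂}`, `X₂ ↦ T`. -/
def blowupSubst (w₁ w₂ : ℕ) : MvPolynomial (Fin 3) k →ₐ[k] MvPolynomial (Fin 3) k :=
  MvPolynomial.aeval ![MvPolynomial.X 0 * MvPolynomial.X 2 ^ w₁,
    MvPolynomial.X 1 * MvPolynomial.X 2 ^ w₂, MvPolynomial.X 2]

/-- The exponent of the image of a monomial under `blowupSubst`. -/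
def blowupExponent (w₁ w₂ : ℕ) (r : Fin 3 →₀ ℕ) : Fin 3 →₀ ℕ :=
  Finsupp.equivFunOnFinite.symm ![r 0, r 1, w₁ * r 0 + w₂ * r 1 + r 2]

variable {w₁ w₂ : ℕ}

theorem blowupExponent_injective : Function.Injective (blowupExponent w₁ w₂) := by
  intro r s h
  have h0 := DFunLike.congr_fun h 0
  have h1 := DFunLike.congr_fun h 1
  have h2 := DFunLike.congr_fun h 2
  simp only [blowupExponent, Finsupp.equivFunOnFinite_symm_apply_apply, Matrix.cons_val_zero,
    Matrix.cons_val_one, Matrix.cons_val] at h0 h1 h2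
  rw [h0, h1] at h2
  ext i
  fin_cases i
  · exact h0
  · exact h1
  · exact add_left_cancel h2

theorem blowupSubst_monomial (r : Fin 3 →₀ ℕ) (c : k) :
    blowupSubst w₁ w₂ (MvPolynomial.monomial r c) =
      MvPolynomial.monomial (blowupExponent w₁ w₂ r) c := by
  rw [blowupSubst, MvPolynomial.aeval_monomial, MvPolynomial.monomial_eq,
    Finsupp.prod_fintype _ _ (by simp), Finsupp.prod_fintype _ _ (by simp), Fin.prod_univ_three,
    Fin.prod_univ_three]
  simp only [blowupExponent, Finsupp.equivFunOnFinite_symm_apply_apply, Matrix.cons_val_zero,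
    Matrix.cons_val_one, Matrix.cons_val, MvPolynomial.algebraMap_eq]
  ring

theorem coeff_blowupSubst (φ : MvPolynomial (Fin 3) k) (r : Fin 3 →₀ ℕ) :
    (blowupSubst w₁ w₂ φ).coeff (blowupExponent w₁ w₂ r) = φ.coeff r := by
  classical
  induction φ using MvPolynomial.induction_on' with
  | add p q hp hq => simp only [map_add, MvPolynomial.coeff_add, hp, hq]
  | monomial s c =>
    rw [blowupSubst_monomial, MvPolynomial.coeff_monomial, MvPolynomial.coeff_monomial]
    simp only [blowupExponent_injective.eq_iff]

theorem exists_of_mem_support_blowupSubst {φ : MvPolynomial (Fin 3) k} {s : Fin 3 →₀ ℕ}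
    (hs : s ∈ (blowupSubst w₁ w₂ φ).support) : ∃ r ∈ φ.support, s = blowupExponent w₁ w₂ r := by
  classical
  by_contra! hcon
  rw [MvPolynomial.mem_support_iff] at hs
  apply hs
  rw [φ.as_sum, map_sum, MvPolynomial.coeff_sum]
  refine Finset.sum_eq_zero fun r hr => ?_
  rw [blowupSubst_monomial, MvPolynomial.coeff_monomial, if_neg (hcon r hr).symm]

/-- Divisibility by a power of the last variable survives every substitution that fixes that
variable. -/
theorem le_of_mem_support_aeval {Φ : MvPolynomial (Fin 3) k} {e : ℕ}
    (h : ∀ s ∈ Φ.support, e ≤ s 2) {g : Fin 3 → MvPolynomial (Fin 3) k}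
    (hg : g 2 = MvPolynomial.X 2) : ∀ s ∈ (MvPolynomial.aeval g Φ).support, e ≤ s 2 := by
  have h1 : Φ ∈ Ideal.span ((fun s => MvPolynomial.monomial s (1 : k)) ''
      {Finsupp.single (2 : Fin 3) e}) := by
    rw [MvPolynomial.mem_ideal_span_monomial_image]
    exact fun s hs => ⟨_, rfl, by simpa using h s hs⟩
  rw [Set.image_singleton, Ideal.mem_span_singleton] at h1
  obtain ⟨Φ', rfl⟩ := h1
  have h2 : MvPolynomial.aeval g (MvPolynomial.monomial (Finsupp.single (2 : Fin 3) e) (1 : k) * Φ') ∈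
      Ideal.span ((fun s => MvPolynomial.monomial s (1 : k)) ''
      {Finsupp.single (2 : Fin 3) e}) := by
    rw [Set.image_singleton, Ideal.mem_span_singleton, map_mul]
    refine Dvd.dvd.mul_right ?_ _
    rw [MvPolynomial.aeval_monomial]
    simp [hg, ← MvPolynomial.X_pow_eq_monomial]
  intro s hs
  rw [MvPolynomial.mem_ideal_span_monomial_image] at h2
  obtain ⟨_, rfl, h3⟩ := h2 s hs
  simpa using h3 2

end BlowupSubst

/-- This is ν times `h` plus N - ν times `hl`; the condition ν ≤ N makes the second multiplier
nonnegative. -/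
theorem slope_combination_le {ν N e m v₁ v₂ a b l μ : ℕ} (hν : ν ≤ N) (h : e + m ≤ v₂ * a + v₁ * b + l)
    (hl : e ≤ l) :
    N * e + ν * m + b * μ ≤ ν * v₂ * a + μ * b + N * l + b * (ν * v₁) := by
  obtain ⟨c, rfl⟩ := Nat.exists_eq_add_of_le hν
  have h5 := Nat.mul_le_mul_left ν h
  have h6 := Nat.mul_le_mul_left c hl
  linarith

/-- This is Nn + σ times `ha` plus N times `h`, with the term μb dropped. -/
theorem slope_weight_le {w₀ w₂ n M g σ μ N a b l : ℕ} (ha : M * 2 ≤ a)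
    (h : g ≤ w₀ * a + w₂ * b + l) :
    2 * M * (N * n + σ) + N * g ≤ σ * a + μ * b + N * ((w₀ + n) * a + w₂ * b + l) := by
  have h1 := Nat.mul_le_mul_left (N * n + σ) ha
  have h2 := Nat.mul_le_mul_left N h
  have h3 := Nat.zero_le (μ * b)
  linarith

/-- Write f as φ(X_0, X_1, t) up to high order and set Φ(S, X, T) = φ(S T^{w₁}, X T^{w₂}, T), with
initial weight V along the chosen face of p. Three monomials supply the inequalities. One of Φ(S, Y
+ p, T), of degree M in Y, is tested on F and E. One of Φ, of degree at least 2M in S, is tested on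
G. One of φ, computing the order g along G, bounds V from above. -/
theorem exists_slope_data [CharZero k] {A B : Subalgebra k K} {X : Fin 3 → A} {U : Fin 3 → B}
    {D : Fin 3 → Derivation k K K} (hX : CoordSystem A X D) {E F G : Divisor k K}
    {w₁ w₂ w₀ n v₁ v₂ : ℕ} (hw₂ : 0 < w₂) (hw₀ : 0 < w₀) (hn : w₁ = w₀ + n)
    (hE : IsMonomial E X ![w₁, w₂, 1]) (hG : IsMonomial G X ![w₀, w₂, 1])
    (hF : IsMonomial F U ![v₂, v₁, 1]) (hAF : A ≤ F.ring)
    {p : MvPolynomial (Fin 2) k} (hU2 : (U 2 : K) = X 2) (hX0 : (X 0 : K) = X 2 ^ w₁ * U 0)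
    (hX1 : (X 1 : K) = (X 2 : K) ^ w₂ * (U 1 + MvPolynomial.aeval ![(U 0 : K), X 2] p))
    {σ μ N : ℕ} (hN : 0 < N) (hp : ∀ s ∈ p.support, μ ≤ σ * s 0 + N * s 1)
    (hp' : ∃ s ∈ p.support, σ * s 0 + N * s 1 = μ ∧ 2 ≤ s 0)
    {ν : ℕ} (hν : ν ≤ N) (hσ : σ = ν * v₂)
    {f : A} {e m g : ℕ} (hfE : (f : K) ∈ orderFiltration E.ring (X 2 : K) e)
    (hfG : (f : K) ∈ orderFiltration G.ring (X 2 : K) g)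
    (hfG' : (f : K) ∉ orderFiltration G.ring (X 2 : K) (g + 1 : ℕ))
    (hfF : (f : K) ∈ orderFiltration F.ring (X 2 : K) (e + m : ℕ)) :
    ∃ V M a b L : ℕ, N * e + ν * m + M * μ ≤ V + M * (ν * v₁) ∧
      2 * M * (N * n + σ) + N * g ≤ V ∧ L = g + n * a ∧ e ≤ L ∧ w₁ * a + w₂ * b ≤ L ∧
      V ≤ σ * a + μ * b + N * L := by
  have htX : (X 2 : K) ≠ 0 := hE.coord_ne_zero
  -- Every X_i has order at least 1 along E, F and G, so with unit weights the error lies beyond all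
  -- the orders to be compared.
  obtain ⟨φ, hφ⟩ := hX.exists_polynomial (w := fun _ => 1) (by simp) f (e + m + g + 1)
  have hcomp : ∀ (H : Divisor k K), (X 2 : K) ∈ H.ring → A ≤ H.ring →
      (∀ i, (X i : K) ∈ orderFiltration H.ring (X 2 : K) 1) → ∀ l : ℕ, l ≤ e + m + g + 1 →
      ((f : K) ∈ orderFiltration H.ring (X 2 : K) l ↔
        ((MvPolynomial.aeval X φ : A) : K) ∈ orderFiltration H.ring (X 2 : K) l) := by
    intro H hXH hAH hXi l hl
    have h1 := mem_orderFiltration_of_mem_weightedIdeal hAH htX hXH (w := fun _ => 1)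
      (by exact_mod_cast hXi) hφ
    have h2 := orderFiltration_antitone htX hXH (Nat.cast_le.2 hl) h1
    have h3 : (f : K) = (f - MvPolynomial.aeval X φ : A) + (MvPolynomial.aeval X φ : A) := by
      push_cast
      ring
    rw [h3]
    exact Submodule.add_mem_iff_right _ h2
  have hone : ∀ {H : Divisor k K} {w : Fin 3 → ℕ}, IsMonomial H X w → w 2 = 1 →
      (∀ i, 0 < w i) → ∀ i, (X i : K) ∈ orderFiltration H.ring (X 2 : K) 1 := by
    intro H w hH hw2 hw i
    exact orderFiltration_antitone htX hH.coord_mem (by exact_mod_cast hw i)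
      (hH.coord_mem_orderFiltration hw2 i)
  have hE1 := hone hE rfl (fun i => by fin_cases i <;> simp <;> omega)
  have hG1 := hone hG rfl (fun i => by fin_cases i <;> simp <;> omega)
  have hF1 : ∀ i, (X i : K) ∈ orderFiltration F.ring (X 2 : K) 1 := by
    have htF : (X 2 : K) ∈ F.ring := hAF (X 2).2
    have h2 : (X 2 : K) ∈ orderFiltration F.ring (X 2 : K) 1 := by
      simpa using pow_mem_orderFiltration_self (R := F.ring) htX 1
    have hpos : ∀ (w : ℕ) (c : K), 0 < w → c ∈ F.ring →
        (X 2 : K) ^ w * c ∈ orderFiltration F.ring (X 2 : K) 1 := by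
      intro w c hw hc
      refine orderFiltration_antitone htX htF (by exact_mod_cast hw : (1 : ℤ) ≤ (w : ℤ)) ?_
      have := mul_mem_orderFiltration htX (pow_mem_orderFiltration_self (R := F.ring) htX w)
        (mem_orderFiltration_zero.2 hc)
      rwa [add_zero] at this
    intro i
    fin_cases i
    · change (X 0 : K) ∈ _
      rw [hX0]
      exact hpos _ _ (by omega) (hF.le (U 0).2)
    · change (X 1 : K) ∈ _
      rw [hX1]
      refine hpos _ _ hw₂ (add_mem (hF.le (U 1).2) ?_)
      have h3 : MvPolynomial.aeval ![(U 0 : K), X 2] p =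
          ((MvPolynomial.aeval ![U 0, U 2] p : B) : K) := by
        rw [← hU2]
        change _ = B.val _
        rw [← AlgHom.comp_apply, MvPolynomial.comp_aeval]
        congr 2
        ext i
        fin_cases i <;> rfl
      rw [h3]
      exact hF.le (SetLike.coe_mem _)
    · exact h2
  rw [hcomp E hE.coord_mem hE.le hE1 e (by omega)] at hfE
  rw [hcomp G hG.coord_mem hG.le hG1 g (by omega)] at hfG
  rw [hcomp G hG.coord_mem hG.le hG1 (g + 1) (by omega)] at hfG'
  rw [hcomp F (hAF (X 2).2) hAF hF1 (e + m) (by omega)] at hfF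
  have hφE := hE.le_weight_of_mem rfl hfE
  have hφG := hG.le_weight_of_mem rfl hfG
  simp only [Matrix.cons_val_zero, Matrix.cons_val_one] at hφE hφG
  obtain ⟨r, hr, hrg⟩ : ∃ r ∈ φ.support, w₀ * r 0 + w₂ * r 1 + r 2 = g := by
    by_contra! hcon
    refine hfG' (mem_orderFiltration_of_mem_weightedIdeal hG.le htX hG.coord_mem
      (hG.coord_mem_orderFiltration rfl) (aeval_mem_weightedIdeal X _ fun s hs => ?_))
    rw [Fin.sum_univ_three]
    simp only [Matrix.cons_val_zero, Matrix.cons_val_one, Matrix.cons_val]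
    have := hφG s hs
    have := hcon s hs
    omega
  set Φ := blowupSubst w₁ w₂ φ with hΦ
  have hrΦ : blowupExponent w₁ w₂ r ∈ Φ.support := by
    rw [MvPolynomial.mem_support_iff, coeff_blowupSubst]
    exact MvPolynomial.mem_support_iff.1 hr
  have hΦ0 : Φ ≠ 0 := by
    rintro h0
    rw [h0] at hrΦ
    simp at hrΦ
  obtain ⟨V, M, hV, ⟨s, hs, hsM, hsV⟩, s', hs', hs'M, hs'V⟩ :=
    exists_initial_monomials hN hΦ0 hp hp' rfl
  set gg : Fin 3 → MvPolynomial (Fin 3) k := ![MvPolynomial.X 0, MvPolynomial.X 1 +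
      MvPolynomial.aeval ![MvPolynomial.X 0, MvPolynomial.X 2] p, MvPolynomial.X 2] with hgg
  have hΨK : ((MvPolynomial.aeval U (MvPolynomial.aeval gg Φ) : B) : K) =
      ((MvPolynomial.aeval X φ : A) : K) := by
    have h3 : ((B.val.comp (MvPolynomial.aeval U)).comp (MvPolynomial.aeval gg)).comp
        (blowupSubst w₁ w₂) = A.val.comp (MvPolynomial.aeval X) := by
      have h4 : B.val ((MvPolynomial.aeval U) ((MvPolynomial.aeval (![MvPolynomial.X 0,
          MvPolynomial.X 2] : Fin 2 → MvPolynomial (Fin 3) k)) p)) = MvPolynomial.aeval ![(U 0 : K), X 2] p := by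
        have : (B.val.comp (MvPolynomial.aeval U)).comp (MvPolynomial.aeval
            (![MvPolynomial.X 0, MvPolynomial.X 2] : Fin 2 → MvPolynomial (Fin 3) k)) =
            MvPolynomial.aeval ![(U 0 : K), X 2] := by
          refine MvPolynomial.algHom_ext fun i => ?_
          fin_cases i
          · simp
          · simp [hU2]
        rw [← this]
        rfl
      refine MvPolynomial.algHom_ext fun i => ?_
      fin_cases i
      · simp [blowupSubst, hgg, hX0, hU2, mul_comm]
      · simp only [Fin.mk_one, AlgHom.comp_apply, blowupSubst, MvPolynomial.aeval_X,
          Matrix.cons_val_one, Matrix.cons_val_zero, map_mul, map_pow, hgg, Matrix.cons_val,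
          map_add, h4]
        simp [hX1, hU2, mul_comm]
      · simp [blowupSubst, hgg, hU2]
    exact congrArg (fun ψ : MvPolynomial (Fin 3) k →ₐ[k] K => ψ φ) h3
  have hΨF := hF.le_weight_of_mem rfl (n := e + m) (P := MvPolynomial.aeval gg Φ)
    (by rw [hΨK, hU2]; exact hfF) s hs
  -- Order at least e along E means that T^e divides Φ, hence also the shifted polynomial.
  have hΨe : e ≤ s 2 := by
    refine le_of_mem_support_aeval (Φ := Φ) ?_ (g := gg) rfl s hs
    intro q hq
    obtain ⟨q', hq', rfl⟩ := exists_of_mem_support_blowupSubst hq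
    simpa [blowupExponent] using hφE q' hq'
  simp only [Matrix.cons_val_zero, Matrix.cons_val_one] at hΨF
  obtain ⟨r', hr', rfl⟩ := exists_of_mem_support_blowupSubst hs'
  have hVr := hV _ hrΦ
  have hr'G : g ≤ w₀ * r' 0 + w₂ * r' 1 + r' 2 := hφG r' hr'
  have hrE := hφE r hr
  simp only [blowupExponent, Finsupp.equivFunOnFinite_symm_apply_apply, Matrix.cons_val_zero,
    Matrix.cons_val_one, Matrix.cons_val] at hVr hs'M hs'V
  refine ⟨V, M, r 0, r 1, w₁ * r 0 + w₂ * r 1 + r 2, ?_, ?_, ?_, hrE, by omega, hVr⟩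
  · rw [← hsV, hσ, ← hsM]
    exact slope_combination_le hν hΨF hΨe
  · rw [← hs'V, hn]
    exact slope_weight_le hs'M hr'G
  · rw [← hrg, hn]
    ring

end WeightedBlowup

end

noncomputable section

open Polynomial AlgebraicGeometry IsLocalRing

namespace WeightedBlowup

/-! ### Comparison of log discrepancies -/

/-- This eliminates M, V and the monomial (a, b, L). With W = V - Ne, `h₂` bounds cM and `h₁` then
bounds c ν m by W (`k1`). To bound W (`k2`), a is solved from `h₃` and b is bounded by `h₅`; the
coefficient of L - e is nonpositive by `hw` and `hμσ`. The result is linear in e, g, m and can be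
summed over the ideals. -/
theorem slope_linear_bound {V M a b L N e g n w₁ w₂ σ μ c δ ν m : ℝ} (hN : 0 < N)
    (hn : 0 < n) (hw₂ : 0 < w₂) (hσ : 0 ≤ σ) (hμ : N ≤ μ) (hc : c = 2 * (N * n + σ))
    (hδ : 0 < δ) (hw : n + 2 * w₂ ≤ w₁) (hμσ : N * n + σ = μ + N)
    (h₁ : N * e + ν * m ≤ V + M * δ) (h₂ : 2 * M * (N * n + σ) + N * g ≤ V) (h₃ : L = g + n * a)
    (h₄ : e ≤ L) (h₅ : w₁ * a + w₂ * b ≤ L) (h₆ : V ≤ σ * a + μ * b + N * L) :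
    n * w₂ * (c * (ν * m)) ≤ (c + δ) * (σ * w₂ * (e - g) + μ * (e * n - w₁ * (e - g))) +
      δ * N * (e - g) * (n * w₂) := by
  set W := V - N * e with hW
  have hc0 : 0 < c := by rw [hc]; positivity
  have hμ0 : 0 < μ := hN.trans_le hμ
  have k1 : c * (ν * m) ≤ (c + δ) * W + δ * (N * (e - g)) := by
    have h7 : c * M ≤ W + N * (e - g) := by rw [hc, hW]; linarith
    have h8 : ν * m ≤ W + M * δ := by rw [hW]; linarith
    have h9 := mul_le_mul_of_nonneg_left h8 hc0.le
    have h10 := mul_le_mul_of_nonneg_left h7 hδ.le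
    linarith
  have k2 : n * w₂ * W ≤ σ * w₂ * (e - g) + μ * (e * n - w₁ * (e - g)) := by
    set d := L - e with hd
    have hd0 : 0 ≤ d := by linarith
    have hna : n * a = d + (e - g) := by rw [hd]; linarith
    have h7 : W ≤ σ * a + μ * b + N * d := by rw [hW, hd]; linarith
    have h8 := mul_le_mul_of_nonneg_left h7 (mul_pos hn hw₂).le
    have h9 : w₂ * b ≤ d + e - w₁ * a := by rw [hd]; linarith
    have h10 := mul_le_mul_of_nonneg_left h9 (mul_pos hμ0 hn).le
    have h11 : d * (σ * w₂ + μ * n - μ * w₁ + N * n * w₂) ≤ 0 := by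
      refine mul_nonpos_of_nonneg_of_nonpos hd0 ?_
      have h12 := mul_le_mul_of_nonneg_left hw hμ0.le
      have h13 := mul_le_mul_of_nonneg_right hμ hw₂.le
      have h14 : (N * n + σ) * w₂ = (μ + N) * w₂ := by rw [hμσ]
      linarith
    have h15 : n * w₂ * (σ * a) = σ * w₂ * (d + (e - g)) := by rw [← hna]; ring
    have h16 : μ * n * (w₁ * a) = μ * w₁ * (d + (e - g)) := by rw [← hna]; ring
    linarith
  have k3 := mul_le_mul_of_nonneg_left k1 (mul_pos hn hw₂).le
  have k4 := mul_le_mul_of_nonneg_left k2 (add_pos hc0 hδ).le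
  linarith

/-- The right side of `h` is affine in H with nonpositive slope, so it may be evaluated at the least
value H = n (`k1`). Cancelling n w₂ and δ leaves c ≤ σ + μ + Nn, whereas c = 2(Nn + σ) exceeds this
by N(n - j) = N. The factor 2 comes from the degree at least 2 in s, and strictness from n = j + 1.
-/
theorem slope_contradiction {H N n j w₁ w₂ σ μ θ c δ T : ℝ} (hN : 0 < N) (hj : 1 ≤ j)
    (hnj : n = j + 1) (hw₂ : 0 < w₂) (hσ : 0 ≤ σ) (hμ : μ = σ + N * j)
    (hc : c = 2 * (N * n + σ)) (hδ : δ = θ - μ) (hδ0 : 0 < δ) (hw : 2 * w₂ ≤ w₁) (hH : n ≤ H)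
    (hT : θ + σ ≤ T)
    (h : n * w₂ * (c * T) ≤ (c + δ) * (σ * w₂ * H + μ * ((w₁ + w₂) * n - w₁ * H)) +
      δ * N * H * (n * w₂)) : False := by
  have hn : 0 < n := by linarith
  have hc0 : 0 < c := by rw [hc]; positivity
  have hμ0 : 0 < μ := by rw [hμ]; positivity
  have hq := mul_pos hn hw₂
  have k1 : (H - n) * ((c + δ) * (σ * w₂ - μ * w₁) + δ * N * (n * w₂)) ≤ 0 := by
    refine mul_nonpos_of_nonneg_of_nonpos (by linarith) ?_
    have h1 : σ * w₂ - μ * w₁ ≤ -(σ + 2 * (N * j)) * w₂ := by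
      have := mul_le_mul_of_nonneg_left hw hμ0.le
      rw [hμ] at this ⊢
      linarith
    have h2 := mul_le_mul_of_nonneg_left h1 (add_pos hc0 hδ0).le
    have h3 : N * n ≤ σ + 2 * (N * j) := by
      have := mul_le_mul_of_nonneg_left hj hN.le
      rw [hnj]
      linarith
    have h4 := mul_le_mul_of_nonneg_right h3 (mul_pos hδ0 hw₂).le
    have h5 : 0 ≤ c * ((σ + 2 * (N * j)) * w₂) := by positivity
    linarith
  have k2 : n * w₂ * (c * T) ≤ n * w₂ * ((c + δ) * (σ + μ) + δ * N * n) := by linarith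
  have k3 := le_of_mul_le_mul_left k2 hq
  have k4 := mul_le_mul_of_nonneg_left hT hc0.le
  have k5 : δ * c ≤ δ * (σ + μ + N * n) := by
    have : θ = δ + μ := by linarith
    rw [this] at k4
    linarith
  have k6 := le_of_mul_le_mul_left k5 hδ0
  rw [hc, hμ, hnj] at k6
  linarith

variable {k K : Type*} [Field k] [Field K] [Algebra k K]

/-- Under the numerical conditions, the log discrepancy of the divisor `G` with weights
`w₁ - j - 1, w₂, 1` would be less than one. -/
theorem no_steep_initial_form [CharZero k] {A B : Subalgebra k K} {X : Fin 3 → A} {U : Fin 3 → B}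
    {D : Fin 3 → Derivation k K K} (hX : CoordSystem A X D) {E F G : Divisor k K}
    {w₁ w₂ w₀ j v₁ v₂ : ℕ} (hw₂ : 0 < w₂) (hw₀ : 0 < w₀) (hn : w₁ = w₀ + (j + 1)) (hj : 1 ≤ j)
    (hw : j + 1 + 2 * w₂ ≤ w₁)
    (hE : IsMonomial E X ![w₁, w₂, 1]) (hG : IsMonomial G X ![w₀, w₂, 1])
    (hF : IsMonomial F U ![v₂, v₁, 1]) (hAF : A ≤ F.ring)
    {p : MvPolynomial (Fin 2) k} (hU2 : (U 2 : K) = X 2) (hX0 : (X 0 : K) = X 2 ^ w₁ * U 0)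
    (hX1 : (X 1 : K) = (X 2 : K) ^ w₂ * (U 1 + MvPolynomial.aeval ![(U 0 : K), X 2] p))
    {ν N : ℕ} (hN : 0 < N) (hν : ν ≤ N)
    (hp : ∀ s ∈ p.support, ν * v₂ + N * j ≤ ν * v₂ * s 0 + N * s 1)
    (hp' : ∃ s ∈ p.support, ν * v₂ * s 0 + N * s 1 = ν * v₂ + N * j ∧ 2 ≤ s 0)
    (hνv : ν * v₂ + N * j < ν * v₁)
    {𝔞 : RIdeal A} {e m g : Fin 𝔞.length → ℕ}
    (he : ∀ i, ∀ f ∈ 𝔞.ideal i, (f : K) ∈ orderFiltration E.ring (X 2 : K) (e i))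
    (hem : ∀ i, ∀ f ∈ 𝔞.ideal i, (f : K) ∈ orderFiltration F.ring (X 2 : K) (e i + m i : ℕ))
    (hg : ∀ i, G.ord (𝔞.ideal i) = g i)
    (hsume : ∑ i, 𝔞.exponent i * e i = w₁ + w₂)
    (hsumm : (v₁ + v₂ : ℝ) ≤ ∑ i, 𝔞.exponent i * m i)
    (hsumg : ∑ i, 𝔞.exponent i * g i ≤ w₀ + w₂) : False := by
  set n : ℕ := j + 1 with hnj
  set μ : ℕ := ν * v₂ + N * j with hμ
  -- The order along G is finite, so it is attained exactly by some element of the ideal.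
  have hexist : ∀ i, ∃ f ∈ 𝔞.ideal i, (f : K) ∉ orderFiltration G.ring (X 2 : K) (g i + 1 : ℕ) := by
    intro i
    by_contra! hcon
    have := (hG.le_ord_iff hG.le).2 hcon
    rw [hg i] at this
    have : g i + 1 ≤ g i := by exact_mod_cast this
    omega
  set c : ℝ := 2 * (N * n + (ν * v₂ : ℕ)) with hc
  set δ : ℝ := (ν * v₁ : ℕ) - μ with hδ
  have hδ0 : 0 < δ := by
    rw [hδ, sub_pos]
    exact_mod_cast hνv
  have hbound : ∀ i, (n : ℝ) * w₂ * (c * (ν * m i)) ≤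
      (c + δ) * ((ν * v₂ : ℕ) * w₂ * ((e i : ℝ) - g i) +
        μ * (e i * n - w₁ * ((e i : ℝ) - g i))) + δ * N * ((e i : ℝ) - g i) * (n * w₂) := by
    intro i
    obtain ⟨f, hf, hfG⟩ := hexist i
    obtain ⟨V, M, a, b, L, h1, h2, h3, h4, h5, h6⟩ := exists_slope_data hX hw₂ hw₀ hn hE hG hF
      hAF hU2 hX0 hX1 hN hp hp' hν rfl (he i f hf) ((hG.le_ord_iff hG.le).1 (hg i).ge f hf) hfG
      (hem i f hf)
    refine slope_linear_bound (V := V) (M := M) (a := a) (b := b) (L := L)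
      (by exact_mod_cast hN) (by exact_mod_cast Nat.succ_pos j) (by exact_mod_cast hw₂)
      (Nat.cast_nonneg _) ?_ rfl hδ0 (by exact_mod_cast hw) ?_ ?_ (by exact_mod_cast h2)
      (by exact_mod_cast h3) (by exact_mod_cast h4) (by exact_mod_cast h5) (by exact_mod_cast h6)
    · have : N ≤ μ := by
        rw [hμ]
        nlinarith [Nat.zero_le (ν * v₂)]
      exact_mod_cast this
    · rw [hμ, hnj]
      push_cast
      ring
    · have h7 : (N * e i + ν * m i + M * μ : ℝ) ≤ V + M * (ν * v₁ : ℕ) := by exact_mod_cast h1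
      rw [hδ]
      linarith
  -- Linearity in the orders allows the bounds to be added with the exponents of the ℝ-ideal as
  -- multipliers.
  have hsum := Finset.sum_le_sum fun i (_ : i ∈ Finset.univ) =>
    mul_le_mul_of_nonneg_left (hbound i) (𝔞.exponent_pos i).le
  set H : ℝ := (w₁ + w₂) - ∑ i, 𝔞.exponent i * g i with hH
  set T : ℝ := ν * ∑ i, 𝔞.exponent i * m i with hT
  refine slope_contradiction (H := H) (T := T) (N := N) (n := n) (j := j) (w₁ := w₁) (w₂ := w₂)
    (σ := (ν * v₂ : ℕ)) (μ := μ) (θ := (ν * v₁ : ℕ)) (c := c) (δ := δ) (by exact_mod_cast hN)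
    (by exact_mod_cast hj) (by push_cast [hnj]; ring) (by exact_mod_cast hw₂)
    (Nat.cast_nonneg _) (by push_cast [hμ]; ring) rfl rfl hδ0 ?_ ?_ ?_ ?_
  · have : 2 * w₂ ≤ w₁ := by omega
    exact_mod_cast this
  · rw [hH, hn]
    push_cast
    linarith
  · rw [hT]
    push_cast
    have := mul_le_mul_of_nonneg_left hsumm (Nat.cast_nonneg (α := ℝ) ν)
    linarith
  · have e1 : ∑ i, 𝔞.exponent i * ((e i : ℝ) - g i) = H := by
      rw [hH, ← hsume, ← Finset.sum_sub_distrib]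
      exact Finset.sum_congr rfl fun i _ => by ring
    refine le_of_eq_of_le ?_ (hsum.trans_eq ?_)
    · rw [hT, Finset.mul_sum, Finset.mul_sum, Finset.mul_sum]
      exact Finset.sum_congr rfl fun i _ => by ring
    · rw [← hsume, ← e1, Finset.sum_mul, Finset.mul_sum, Finset.mul_sum, ← Finset.sum_sub_distrib,
        Finset.mul_sum, ← Finset.sum_add_distrib, Finset.mul_sum, Finset.mul_sum, Finset.sum_mul,
        ← Finset.sum_add_distrib]
      exact Finset.sum_congr rfl fun i _ => by ring

end WeightedBlowup

end

noncomputable section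

open Polynomial AlgebraicGeometry IsLocalRing

namespace WeightedBlowup

variable {k K : Type*} [Field k] [Field K] [Algebra k K]

/-! ### Coordinate changes over a tower of two weighted blow-ups -/

/-- A coordinate may be replaced by an element of the maximal ideal whose derivative with respect
to it is a unit. -/
theorem CoordSystem.replace {B : Subalgebra k K} {z : Fin 3 → B} {D : Fin 3 → Derivation k K K}
    (h : CoordSystem B z D) {s : B} (hs : ¬ IsUnit s) (hD : IsUnit (h.der 1 s)) :
    ∃ D' : Fin 3 → Derivation k K K, CoordSystem B ![z 0, s, z 2] D' := by
  refine h.change (le_antisymm ?_ ?_)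
  · rw [Ideal.span_le]
    rintro _ ⟨i, rfl⟩
    fin_cases i
    · exact Ideal.subset_span ⟨0, rfl⟩
    · exact (h.mem_span_iff s).2 hs
    · exact Ideal.subset_span ⟨2, rfl⟩
  · have h1 := (h.mem_span_iff s).2 hs
    obtain ⟨c, hc⟩ := Ideal.mem_span_range_iff_exists_fun.1 h1
    rw [Fin.sum_univ_three] at hc
    set J := Ideal.span (Set.range ![z 0, s, z 2])
    have m0 : z 0 ∈ J := Ideal.subset_span ⟨0, rfl⟩
    have ms : s ∈ J := Ideal.subset_span ⟨1, rfl⟩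
    have m2 : z 2 ∈ J := Ideal.subset_span ⟨2, rfl⟩
    have hzm : ∀ i, z i ∈ Ideal.span (Set.range z) := fun i => Ideal.subset_span ⟨i, rfl⟩
    have hunit : IsUnit (c 1) := by
      by_contra hc1
      rw [← h.mem_span_iff] at hc1
      refine (h.mem_span_iff _).1 ?_ hD
      rw [← hc]
      simp only [map_add, Derivation.leibniz, h.der_coord, smul_eq_mul]
      simp only [Fin.isValue, one_ne_zero, if_false, if_true, Fin.reduceEq, mul_zero, mul_one,
        zero_add]
      exact add_mem (add_mem (Ideal.mul_mem_right _ _ (hzm 0))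
        (add_mem hc1 (Ideal.mul_mem_right _ _ (hzm 1)))) (Ideal.mul_mem_right _ _ (hzm 2))
    have m1 : z 1 ∈ J := by
      obtain ⟨d, hd⟩ := hunit.exists_right_inv
      have : z 1 = d * (s - c 0 * z 0 - c 2 * z 2) := by
        linear_combination (-z 1) * hd + d * hc
      rw [this]
      exact Ideal.mul_mem_left _ _ (sub_mem (sub_mem ms (Ideal.mul_mem_left _ _ m0))
        (Ideal.mul_mem_left _ _ m2))
    rw [Ideal.span_le]
    rintro _ ⟨i, rfl⟩
    fin_cases i
    · exact m0
    · exact m1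
    · exact m2

/-- Truncation: the monomials of weight at least n in a polynomial approximation already have order
at least n along F. -/
theorem CoordSystem.mem_span_monomials_sup {B : Subalgebra k K} {z : Fin 3 → B}
    {D : Fin 3 → Derivation k K K} (h : CoordSystem B z D) {F : Divisor k K} {v : Fin 3 → ℕ}
    (hv : ∀ i, 0 < v i) (hv2 : v 2 = 1) (hF : IsMonomial F z v) (n : ℕ) (f : B) :
    (f : K) ∈ Submodule.span k {g : K | ∃ a b e : ℕ, v 0 * a + v 1 * b + e < n ∧
      g = (z 0 : K) ^ a * (z 1 : K) ^ b * (z 2 : K) ^ e} ⊔ orderFiltration F.ring (z 2 : K) n := by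
  obtain ⟨φ, hφ⟩ := h.exists_polynomial hv f n
  have ht := hF.coord_ne_zero
  have h1 := mem_orderFiltration_of_mem_weightedIdeal hF.le ht hF.coord_mem
    (hF.coord_mem_orderFiltration hv2) hφ
  have h2 : (f : K) = (MvPolynomial.aeval z φ : B) + (f - MvPolynomial.aeval z φ : B) := by
    push_cast
    ring
  rw [h2]
  refine add_mem ?_ (Submodule.mem_sup_right h1)
  rw [MvPolynomial.aeval_def, MvPolynomial.eval₂_eq']
  push_cast
  refine Submodule.sum_mem _ fun s _ => ?_
  rw [Fin.prod_univ_three]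
  rw [← Algebra.smul_def]
  refine Submodule.smul_mem _ _ ?_
  by_cases hs : v 0 * s 0 + v 1 * s 1 + s 2 < n
  · exact Submodule.mem_sup_left (Submodule.subset_span ⟨s 0, s 1, s 2, hs, rfl⟩)
  · refine Submodule.mem_sup_right ?_
    have h4 := mul_mem_orderFiltration ht (mul_mem_orderFiltration ht
      (pow_mem_orderFiltration (hF.coord_mem_orderFiltration hv2 0) (s 0))
      (pow_mem_orderFiltration (hF.coord_mem_orderFiltration hv2 1) (s 1)))
      (pow_mem_orderFiltration (hF.coord_mem_orderFiltration hv2 2) (s 2))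
    refine orderFiltration_antitone ht hF.coord_mem ?_ h4
    rw [hv2]
    push_cast
    have : (n : ℤ) ≤ v 0 * s 0 + v 1 * s 1 + s 2 := by exact_mod_cast not_lt.1 hs
    linarith

/-! ### Polynomial changes of coordinates and their derivatives. -/

section Adjoin

variable {t g : K}

theorem derivation_eq_zero_of_mem_adjoin {D : Derivation k K K} (hD : D t = 0) {f : K}
    (hf : f ∈ Algebra.adjoin k {t}) : D f = 0 := by
  induction hf using Algebra.adjoin_induction with
  | mem a ha => rw [Set.mem_singleton_iff.1 ha, hD]
  | algebraMap c => exact D.map_algebraMap c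
  | add a b _ _ ha hb => rw [map_add, ha, hb, add_zero]
  | mul a b _ _ ha hb => rw [Derivation.leibniz, ha, hb, smul_zero, smul_zero, add_zero]

/-- The factor c is the partial derivative with respect to g. It does not depend on the derivation,
so subtracting a polynomial in g and t is a row operation that preserves Jacobians. -/
theorem exists_derivation_eq_mul_of_mem_adjoin {f : K} (hf : f ∈ Algebra.adjoin k {g, t}) :
    ∃ c : K, ∀ D : Derivation k K K, D t = 0 → D f = c * D g := by
  induction hf using Algebra.adjoin_induction with
  | mem a ha =>
    rcases ha with rfl | rfl
    · exact ⟨1, fun D _ => by rw [one_mul]⟩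
    · exact ⟨0, fun D hD => by rw [hD, zero_mul]⟩
  | algebraMap c => exact ⟨0, fun D _ => by rw [D.map_algebraMap, zero_mul]⟩
  | add a b _ _ ha hb =>
    obtain ⟨c, hc⟩ := ha
    obtain ⟨d, hd⟩ := hb
    exact ⟨c + d, fun D hD => by rw [map_add, hc D hD, hd D hD, add_mul]⟩
  | mul a b _ _ ha hb =>
    obtain ⟨c, hc⟩ := ha
    obtain ⟨d, hd⟩ := hb
    exact ⟨a * d + b * c, fun D hD => by
      rw [Derivation.leibniz, hc D hD, hd D hD, smul_eq_mul, smul_eq_mul]; ring⟩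

theorem exists_const_of_mem_adjoin {A : Subalgebra k K} {I : Ideal A} {S : Set K}
    (hS : ∀ a ∈ S, ∃ b ∈ I, (b : K) = a) {f : K} (hf : f ∈ Algebra.adjoin k S) :
    ∃ c : k, ∃ b ∈ I, f = algebraMap k K c + (b : A) := by
  induction hf using Algebra.adjoin_induction with
  | mem a ha =>
    obtain ⟨b, hb, e⟩ := hS a ha
    exact ⟨0, b, hb, by simp [e]⟩
  | algebraMap c => exact ⟨c, 0, I.zero_mem, by simp⟩
  | add a b _ _ ha hb =>
    obtain ⟨c, a, ha, rfl⟩ := ha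
    obtain ⟨d, b, hb, rfl⟩ := hb
    exact ⟨c + d, a + b, add_mem ha hb, by push_cast [map_add]; ring⟩
  | mul a b _ _ ha hb =>
    obtain ⟨c, a, ha, rfl⟩ := ha
    obtain ⟨d, b, hb, rfl⟩ := hb
    refine ⟨c * d, algebraMap k A c * b + algebraMap k A d * a + a * b, add_mem (add_mem
      (Ideal.mul_mem_left _ _ hb) (Ideal.mul_mem_left _ _ ha)) (Ideal.mul_mem_left _ _ hb), ?_⟩
    push_cast [map_mul]
    ring

end Adjoin

/-- Each x_i is a constant plus an element of the ideal of the X_i. That ideal lies in the maximal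
ideal, as does x_i, so the constant is zero. -/
theorem CoordSystem.span_eq_of_sub_mem_adjoin {A : Subalgebra k K} {x X : Fin 3 → A}
    {D : Fin 3 → Derivation k K K} (h : CoordSystem A x D) (hX : ∀ i, ¬ IsUnit (X i))
    (hX2 : X 2 = x 2) (hX1 : (x 1 - X 1 : K) ∈ Algebra.adjoin k {(x 2 : K)})
    (hX0 : (x 0 - X 0 : K) ∈ Algebra.adjoin k {(X 1 : K), (x 2 : K)}) :
    Ideal.span (Set.range X) = Ideal.span (Set.range x) := by
  have hle : Ideal.span (Set.range X) ≤ Ideal.span (Set.range x) := by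
    rw [Ideal.span_le]
    rintro _ ⟨i, rfl⟩
    exact (h.mem_span_iff _).2 (hX i)
  refine le_antisymm hle ?_
  set I := Ideal.span (Set.range X)
  have hXI : ∀ i, X i ∈ I := fun i => Ideal.subset_span ⟨i, rfl⟩
  have hxm : ∀ i, x i ∈ Ideal.span (Set.range x) := fun i => Ideal.subset_span ⟨i, rfl⟩
  have key : ∀ i, (x i - X i : K) ∈ Algebra.adjoin k {(X 1 : K), (x 2 : K)} → x i ∈ I := by
    intro i hi
    obtain ⟨c, b, hb, e⟩ := exists_const_of_mem_adjoin (A := A) (I := I) (by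
      rintro a (rfl | rfl)
      · exact ⟨_, hXI 1, rfl⟩
      · exact ⟨_, hX2 ▸ hXI 2, rfl⟩) hi
    have e' : x i = algebraMap k A c + (b + X i) := by
      apply Subtype.ext
      push_cast
      linear_combination e
    have hbX : b + X i ∈ I := add_mem hb (hXI i)
    by_cases hc : c = 0
    · rw [e', hc, map_zero, zero_add]
      exact hbX
    · exfalso
      have h1 : algebraMap k A c ∈ Ideal.span (Set.range x) := by
        have := sub_mem (hxm i) (hle hbX)
        rwa [e', add_sub_cancel_right] at this
      exact (h.mem_span_iff _).1 h1 ((IsUnit.mk0 c hc).map _)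
  rw [Ideal.span_le]
  rintro _ ⟨i, rfl⟩
  fin_cases i
  · exact key 0 hX0
  · refine key 1 (Algebra.adjoin_mono ?_ hX1)
    simp
  · exact hX2 ▸ hXI 2

theorem not_isUnit_of_mem_orderFiltration {A : Subalgebra k K} {F : Divisor k K}
    {B : Subalgebra k K} {z : Fin 3 → B} {v : Fin 3 → ℕ} (hF : IsMonomial F z v) (hA : A ≤ F.ring)
    {a : A} {n : ℕ} (hn : 0 < n) (ha : (a : K) ∈ orderFiltration F.ring (z 2 : K) n) :
    ¬ IsUnit a := by
  intro hu
  have h1 := (mem_orderFiltration_iff_dvd (f := Subalgebra.inclusion hA a)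
    hF.inclusion_ne_zero).1 ha
  have h2 := isUnit_of_dvd_unit h1 (hu.map (Subalgebra.inclusion hA))
  exact hF.irreducible.not_isUnit ((isUnit_pow_iff hn.ne').1 h2)

/-- A divisor `F` with monomial valuation over a germ `B` with coordinates `z`, where `B` lies over
a germ `A` with coordinates `x`, such that `xᵢ = x₃^{wᵢ} uᵢ` and `u₁, u₂, x₃` are coordinates
in `B`. -/
structure BlowupTower (A B : Subalgebra k K) (F : Divisor k K) (x : Fin 3 → A)
    (D : Fin 3 → Derivation k K K) (w₁ w₂ : ℕ) (u : Fin 2 → B) (z : Fin 3 → B)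
    (D' : Fin 3 → Derivation k K K) (v₁ v₂ : ℕ) : Prop where
  isFractionRing : IsFractionRing A K
  regular : IsRegularSystem x
  coord : CoordSystem A x D
  coord' : CoordSystem B z D'
  le : A ≤ B
  coord_zero : (x 0 : K) = (x 2 : K) ^ w₁ * u 0
  coord_one : (x 1 : K) = (x 2 : K) ^ w₂ * u 1
  coord_two : (z 2 : K) = x 2
  jacobian : IsUnit (coord'.der 0 (u 0) * coord'.der 1 (u 1) -
    coord'.der 0 (u 1) * coord'.der 1 (u 0))
  isMonomial : IsMonomial F z ![v₁, v₂, 1]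
  pos₁ : 0 < v₁
  pos₂ : 0 < v₂

namespace BlowupTower

variable {A B : Subalgebra k K} {F : Divisor k K} {x : Fin 3 → A}
  {D : Fin 3 → Derivation k K K} {w₁ w₂ : ℕ} {u : Fin 2 → B} {z : Fin 3 → B}
  {D' : Fin 3 → Derivation k K K} {v₁ v₂ : ℕ}

theorem weight_pos {a b : ℕ} (ha : 0 < a) (hb : 0 < b) (i : Fin 3) : 0 < ![a, b, 1] i := by
  fin_cases i
  · exact ha
  · exact hb
  · exact one_pos

variable (h : BlowupTower A B F x D w₁ w₂ u z D' v₁ v₂)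

include h

theorem ne_zero : (x 2 : K) ≠ 0 := coord_two_ne_zero h.coord 2

theorem le_ring : B ≤ F.ring := h.isMonomial.le

theorem mem_ring : (x 2 : K) ∈ F.ring := h.le_ring (h.le (x 2).2)

theorem ring_eq [CharZero k] :
    F.ring = localRingAt (h.coord'.genericPoint (weight_pos h.pos₁ h.pos₂)) :=
  h.isMonomial.ring_eq h.coord' (isFractionRing_of_le h.isFractionRing h.le) _ rfl

theorem derivation_two {i : Fin 3} (hi : i ≠ 2) : D' i (x 2) = 0 := by
  rw [← h.coord_two, h.coord'.map_coord, if_neg hi]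

theorem derivation_zero {i : Fin 3} (hi : i ≠ 2) : D' i (x 0) = (x 2 : K) ^ w₁ * D' i (u 0) := by
  rw [h.coord_zero, Derivation.leibniz, Derivation.leibniz_pow, h.derivation_two hi]
  simp

theorem derivation_one {i : Fin 3} (hi : i ≠ 2) : D' i (x 1) = (x 2 : K) ^ w₂ * D' i (u 1) := by
  rw [h.coord_one, Derivation.leibniz, Derivation.leibniz_pow, h.derivation_two hi]
  simp

/-- If the orders of `x₁', x₂'` along `F` are as large as possible, then `F` is obtained by a
weighted blow-up of the germ `A`. -/
theorem isExceptionalDivisor [CharZero k] {X₀ X₁ : A} {α β : ℕ} (hα : 0 < α) (hβ : 0 < β)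
    (hαβ : α + β = w₁ + w₂ + (v₁ + v₂))
    (hX₁ : (x 1 - X₁ : K) ∈ Algebra.adjoin k {(x 2 : K)})
    (hX₀ : (x 0 - X₀ : K) ∈ Algebra.adjoin k {(X₁ : K), (x 2 : K)})
    (h₀ : (X₀ : K) ∈ orderFiltration F.ring (x 2 : K) α)
    (h₁ : (X₁ : K) ∈ orderFiltration F.ring (x 2 : K) β) :
    IsRegularSystem ![X₀, X₁, x 2] ∧ IsExceptionalDivisor ![X₀, X₁, x 2] ![α, β, 1] F := by
  have hAF : A ≤ F.ring := h.le.trans h.le_ring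
  rw [← h.coord_two] at h₀ h₁
  have hspan : Ideal.span (Set.range ![X₀, X₁, x 2]) = Ideal.span (Set.range x) := by
    refine h.coord.span_eq_of_sub_mem_adjoin (fun i => ?_) rfl hX₁ hX₀
    fin_cases i
    · exact not_isUnit_of_mem_orderFiltration h.isMonomial hAF hα h₀
    · exact not_isUnit_of_mem_orderFiltration h.isMonomial hAF hβ h₁
    · exact (h.coord.mem_span_iff _).1 (Ideal.subset_span ⟨2, rfl⟩)
  obtain ⟨D₁, hD₁⟩ := h.coord.change hspan
  refine ⟨?_, ?_⟩
  · obtain ⟨hloc, hdim, hmax⟩ := h.regular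
    exact ⟨hloc, hdim, hspan.trans hmax⟩
  · have hmon : IsMonomial F ![X₀, X₁, x 2] ![α, β, 1] := by
      refine IsMonomial.of_jacobian h.coord' (weight_pos h.pos₁ h.pos₂) rfl h.ring_eq hAF
        h.coord_two.symm h₀ h₁ (u := Subalgebra.inclusion h.le_ring _)
        (h.jacobian.map (Subalgebra.inclusion h.le_ring)) ?_
      -- The change is triangular, so the Jacobian of X₀, X₁ is t^{w₁+w₂} times the unit Jacobian of
      -- u; `hαβ` is exactly the balance of orders required.
      obtain ⟨c, hc⟩ := exists_derivation_eq_mul_of_mem_adjoin hX₀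
      have d1 : ∀ i : Fin 3, i ≠ 2 → D' i X₁ = (x 2 : K) ^ w₂ * D' i (u 1) := by
        intro i hi
        have := derivation_eq_zero_of_mem_adjoin (h.derivation_two hi) hX₁
        rw [map_sub, h.derivation_one hi, sub_eq_zero] at this
        exact this.symm
      have d0 : ∀ i : Fin 3, i ≠ 2 → D' i X₀ = (x 2 : K) ^ w₁ * D' i (u 0) - c * D' i X₁ := by
        intro i hi
        have := hc _ (h.derivation_two hi)
        rw [map_sub, h.derivation_zero hi] at this
        linear_combination -this
      have e : ((Subalgebra.inclusion h.le_ring (h.coord'.der 0 (u 0) * h.coord'.der 1 (u 1) -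
          h.coord'.der 0 (u 1) * h.coord'.der 1 (u 0)) : F.ring) : K) =
          D' 0 (u 0) * D' 1 (u 1) - D' 0 (u 1) * D' 1 (u 0) := rfl
      rw [e, h.coord_two]
      simp only [Matrix.cons_val_zero, Matrix.cons_val_one]
      rw [hαβ, d0 0 (by decide), d0 1 (by decide), d1 0 (by decide), d1 1 (by decide)]
      ring
    rw [hD₁.isExceptionalDivisor_iff (weight_pos hα hβ)]
    exact hmon.ring_eq hD₁ h.isFractionRing _ rfl

/-- The monomial valuation in new coordinates. -/
theorem isMonomial_change [CharZero k] {s y : B} {a b : ℕ} (hab : a + b = v₁ + v₂)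
    (hs : (s : K) ∈ orderFiltration F.ring (x 2 : K) a)
    (hy : (y : K) ∈ orderFiltration F.ring (x 2 : K) b)
    (hdet : IsUnit (h.coord'.der 0 s * h.coord'.der 1 y - h.coord'.der 0 y * h.coord'.der 1 s)) :
    IsMonomial F ![s, y, z 2] ![a, b, 1] := by
  rw [← h.coord_two] at hs hy
  refine IsMonomial.of_jacobian h.coord' (weight_pos h.pos₁ h.pos₂) rfl h.ring_eq h.le_ring
    rfl hs hy (u := Subalgebra.inclusion h.le_ring _)
    (hdet.map (Subalgebra.inclusion h.le_ring)) ?_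
  change (z 2 : K) ^ (v₁ + v₂) * _ = (z 2 : K) ^ (a + b) * _
  rw [hab]
  rfl

end BlowupTower

end WeightedBlowup

end

noncomputable section

open Polynomial AlgebraicGeometry IsLocalRing

namespace WeightedBlowup

variable {k K : Type*} [Field k] [Field K] [Algebra k K]

/-! ### Expansions with respect to two weights -/

/-- The span of the monomials `s^a y^m t^e` of weight at least `n` for the weights `v₂, v₁, 1` and
at least `r` for the weights `j v₂, j v₁, c`. -/
def doubleFiltration (k : Type*) {K : Type*} [Field k] [Field K] [Algebra k K] (s y t : K)
    (v₁ v₂ j c : ℕ) (n r : ℤ) : Submodule k K :=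
  Submodule.span k {g | ∃ (a m : ℕ) (e : ℤ), n ≤ v₂ * a + v₁ * m + e ∧
    r ≤ j * (v₂ * a + v₁ * m) + c * e ∧ g = s ^ a * y ^ m * t ^ e}

section

variable {s y t : K} {v₁ v₂ j c : ℕ}

theorem monomial_mem_doubleFiltration {n r : ℤ} (a m : ℕ) (e : ℤ)
    (hn : n ≤ v₂ * a + v₁ * m + e) (hr : r ≤ j * (v₂ * a + v₁ * m) + c * e) :
    s ^ a * y ^ m * t ^ e ∈ doubleFiltration k s y t v₁ v₂ j c n r :=
  Submodule.subset_span ⟨a, m, e, hn, hr, rfl⟩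

theorem doubleFiltration_mono {n n' r r' : ℤ} (hn : n' ≤ n) (hr : r' ≤ r) :
    doubleFiltration k s y t v₁ v₂ j c n r ≤ doubleFiltration k s y t v₁ v₂ j c n' r' :=
  Submodule.span_mono fun _ ⟨a, m, e, h1, h2, h3⟩ => ⟨a, m, e, hn.trans h1, hr.trans h2, h3⟩

theorem mul_mem_doubleFiltration (ht : t ≠ 0) {n n' r r' : ℤ} {f g : K}
    (hf : f ∈ doubleFiltration k s y t v₁ v₂ j c n r)
    (hg : g ∈ doubleFiltration k s y t v₁ v₂ j c n' r') :
    f * g ∈ doubleFiltration k s y t v₁ v₂ j c (n + n') (r + r') := by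
  have h := Submodule.mul_mem_mul hf hg
  rw [doubleFiltration, doubleFiltration, Submodule.span_mul_span] at h
  refine Submodule.span_le.2 ?_ h
  rintro _ ⟨_, ⟨a, m, e, h1, h2, rfl⟩, _, ⟨a', m', e', h1', h2', rfl⟩, rfl⟩
  have : s ^ a * y ^ m * t ^ e * (s ^ a' * y ^ m' * t ^ e') =
      s ^ (a + a') * y ^ (m + m') * t ^ (e + e') := by
    rw [pow_add, pow_add, zpow_add₀ ht]
    ring
  simp only [this]
  refine monomial_mem_doubleFiltration _ _ _ ?_ ?_
  · push_cast
    linarith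
  · push_cast
    linarith

theorem pow_sub_pow_mem_doubleFiltration (ht : t ≠ 0) {n r : ℤ} {f g : K}
    (hg : g ∈ doubleFiltration k s y t v₁ v₂ j c n r)
    (hfg : f - g ∈ doubleFiltration k s y t v₁ v₂ j c (n + 1) r) (a : ℕ) :
    f ^ a ∈ doubleFiltration k s y t v₁ v₂ j c (n * a) (r * a) ∧
      f ^ a - g ^ a ∈ doubleFiltration k s y t v₁ v₂ j c (n * a + 1) (r * a) := by
  have hf : f ∈ doubleFiltration k s y t v₁ v₂ j c n r := by
    have := add_mem hg (doubleFiltration_mono (by omega) le_rfl hfg)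
    rwa [add_sub_cancel] at this
  induction a with
  | zero =>
    refine ⟨?_, by simp⟩
    have := monomial_mem_doubleFiltration (k := k) (s := s) (y := y) (t := t) (v₁ := v₁)
      (v₂ := v₂) (j := j) (c := c) (n := 0) (r := 0) 0 0 0 (by simp) (by simp)
    simpa using this
  | succ a ih =>
    have e1 : n * ((a + 1 : ℕ) : ℤ) = n * a + n := by push_cast; ring
    have e2 : r * ((a + 1 : ℕ) : ℤ) = r * a + r := by push_cast; ring
    rw [e1, e2]
    refine ⟨pow_succ f a ▸ mul_mem_doubleFiltration ht ih.1 hf, ?_⟩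
    have e3 : f ^ (a + 1) - g ^ (a + 1) = f ^ a * (f - g) + (f ^ a - g ^ a) * g := by ring
    rw [e3]
    refine add_mem ?_ ?_
    · rw [add_assoc]
      exact mul_mem_doubleFiltration ht ih.1 hfg
    · rw [add_right_comm]
      exact mul_mem_doubleFiltration ht ih.2 hg

theorem doubleFiltration_le_orderFiltration {R : Subalgebra k K} (ht : t ≠ 0) (htR : t ∈ R)
    (hs : s ∈ orderFiltration R t v₂) (hy : y ∈ orderFiltration R t v₁) (n r : ℤ) :
    doubleFiltration k s y t v₁ v₂ j c n r ≤ orderFiltration R t n := by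
  refine Submodule.span_le.2 ?_
  rintro _ ⟨a, m, e, h1, -, rfl⟩
  refine orderFiltration_antitone ht htR ?_ (mul_mem_orderFiltration ht
    (mul_mem_orderFiltration ht (pow_mem_orderFiltration hs a) (pow_mem_orderFiltration hy m))
    (zpow_mem_orderFiltration ht e))
  linarith

/-- Here u = c₀ s t^j plus higher terms is solved for s one order at a time, replacing s^a t^e by a
multiple of u^a t^{e-ja}. The second weight is that of the line through (1, j) and (v₁/v₂, 0).
Keeping it bounded below guarantees a v₂ < v₁ at each replacement. The exponent of t may become
negative, but only in a controlled way. -/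
theorem mem_span_sup_doubleFiltration (ht : t ≠ 0) {u : K} {c₀ : k} (hc₀ : c₀ ≠ 0)
    (hu : u - c₀ • (s * t ^ j) ∈ doubleFiltration k s y t v₁ v₂ j c (v₂ + j + 1) (j * v₁))
    (hc : v₁ = v₂ + c) (hj : j < c) (hv₂ : 0 < v₂) (l : ℕ) (hl : v₂ + l + j ≤ v₁) :
    s ∈ Submodule.span k {g | ∃ (a : ℕ) (e : ℤ), a * v₂ < v₁ ∧ (v₂ : ℤ) ≤ e + (v₂ + j) * a ∧
        g = u ^ a * t ^ e} ⊔ doubleFiltration k s y t v₁ v₂ j c (v₂ + l) (j * v₂) := by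
  induction l with
  | zero =>
    refine Submodule.mem_sup_right ?_
    have := monomial_mem_doubleFiltration (k := k) (s := s) (y := y) (t := t) (v₁ := v₁)
      (v₂ := v₂) (j := j) (c := c) (n := v₂) (r := j * v₂) 1 0 0 (by simp) (by simp)
    simpa using this
  | succ l ih =>
    set N := Submodule.span k {g | ∃ (a : ℕ) (e : ℤ), a * v₂ < v₁ ∧
      (v₂ : ℤ) ≤ e + (v₂ + j) * a ∧ g = u ^ a * t ^ e} with hN
    refine (sup_le le_sup_left ?_ : N ⊔ doubleFiltration k s y t v₁ v₂ j c (v₂ + l) (j * v₂) ≤ _)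
      (ih (by omega))
    refine Submodule.span_le.2 ?_
    rintro _ ⟨a, m, e, h1, h2, rfl⟩
    by_cases h3 : (v₂ : ℤ) + (l + 1 : ℕ) ≤ v₂ * a + v₁ * m + e
    · exact Submodule.mem_sup_right (monomial_mem_doubleFiltration a m e h3 h2)
    have h4 : (v₂ : ℤ) * a + v₁ * m + e = v₂ + l := by push_cast at h3; omega
    -- Substituting the exact first weight v₂ + l < v₁ - j into the bound on the second weight and
    -- cancelling c - j > 0 gives this; in particular y cannot occur.
    have h5 : (v₂ : ℤ) * a + v₁ * m < v₁ := by
      have e1 : e = v₂ + l - (v₂ * a + v₁ * m) := by linarith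
      have h6 : (0 : ℤ) < (c : ℤ) - j := by omega
      refine lt_of_mul_lt_mul_left ?_ h6.le
      have h7 : ((v₂ : ℤ) + l) * c < (v₁ - j) * c :=
        mul_lt_mul_of_pos_right (by omega) (by omega)
      have h8 : (v₁ : ℤ) = v₂ + c := by exact_mod_cast hc
      rw [e1] at h2
      set V : ℤ := v₂ * a + v₁ * m
      have h9 : ((c : ℤ) - j) * v₁ = (v₁ - j) * c - j * v₂ := by rw [h8]; ring
      rw [h9]
      linarith
    have hm : m = 0 := by
      by_contra hm
      have h6 : v₁ * 1 ≤ v₁ * m := Nat.mul_le_mul_left _ (Nat.pos_of_ne_zero hm)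
      have h7 : (v₁ : ℤ) ≤ v₁ * m := by exact_mod_cast (by simpa using h6)
      have h8 : (0 : ℤ) ≤ v₂ * a := by positivity
      linarith
    subst hm
    simp only [Nat.cast_zero, mul_zero, add_zero, pow_zero, mul_one] at h1 h2 h4 h5 ⊢
    have hg : c₀ • (s * t ^ j) ∈ doubleFiltration k s y t v₁ v₂ j c (v₂ + j) (j * v₁) := by
      refine Submodule.smul_mem _ _ ?_
      have := monomial_mem_doubleFiltration (k := k) (s := s) (y := y) (t := t) (v₁ := v₁)
        (v₂ := v₂) (j := j) (c := c) (n := v₂ + j) (r := j * v₁) 1 0 j (by simp) (by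
          rw [hc]; push_cast; linarith)
      simpa using this
    have h6 := (pow_sub_pow_mem_doubleFiltration ht hg hu a).2
    have h7 : t ^ (e - j * a) ∈ doubleFiltration k s y t v₁ v₂ j c (e - j * a)
        (c * (e - j * a)) := by
      have := monomial_mem_doubleFiltration (k := k) (s := s) (y := y) (t := t) (v₁ := v₁)
        (v₂ := v₂) (j := j) (c := c) (n := e - j * a) (r := c * (e - j * a)) 0 0 (e - j * a)
        (by simp) (by simp)
      simpa using this
    have h8 := mul_mem_doubleFiltration ht h6 h7
    -- The main term joins the span; the error u^a - (c₀ s t^j)^a raises the first weight by one and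
    -- keeps the second.
    have h9 : s ^ a * t ^ e = (c₀ ^ a)⁻¹ • (u ^ a * t ^ (e - j * a)) -
        (c₀ ^ a)⁻¹ • ((u ^ a - (c₀ • (s * t ^ j)) ^ a) * t ^ (e - j * a)) := by
      rw [← smul_sub, eq_inv_smul_iff₀ (pow_ne_zero a hc₀), sub_mul, sub_sub_cancel, _root_.smul_pow,
        smul_mul_assoc, mul_pow, mul_assoc, ← pow_mul, ← zpow_natCast t (j * a), ← zpow_add₀ ht]
      congr 3
      push_cast
      ring
    rw [h9]
    refine sub_mem (Submodule.mem_sup_left (Submodule.smul_mem _ _ (Submodule.subset_span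
      ⟨a, _, ?_, ?_, rfl⟩))) (Submodule.mem_sup_right (Submodule.smul_mem _ _
      (doubleFiltration_mono ?_ ?_ h8)))
    · rw [mul_comm]
      exact_mod_cast h5
    · linarith
    · push_cast
      linarith
    · have : (j : ℤ) * v₁ * a + c * (e - j * a) = j * (v₂ * a) + c * e := by
        rw [hc]; push_cast; ring
      rw [this]
      exact h2

end

/-- If a finite set of exponents `(a, e)` has no initial face of slope below the critical one which
contains an exponent with `a ≥ 2`, then its initial exponent is `(1, j)` and the others lie above
the critical line through it. -/
theorem exists_initial_exponent {v₁ v₂ c : ℕ} (hc : v₁ = v₂ + c) {S : Finset (Fin 2 →₀ ℕ)}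
    (hS : S.Nonempty) (h₁ : ∀ r ∈ S, 1 ≤ r 0) (h₂ : ∀ r ∈ S, v₂ * r 0 + r 1 < v₁)
    (h₃ : ∀ r ∈ S, v₂ < v₂ * r 0 + r 1)
    (hsteep : ∀ ν N j : ℕ, 1 ≤ j → 0 < N → ν ≤ N →
      (∀ r ∈ S, ν * v₂ + N * j ≤ ν * v₂ * r 0 + N * r 1) →
      (∃ r ∈ S, ν * v₂ * r 0 + N * r 1 = ν * v₂ + N * j ∧ 2 ≤ r 0) →
      ν * v₂ + N * j < ν * v₁ → False) :
    ∃ j, 1 ≤ j ∧ j < c ∧ ∃ q ∈ S, q 0 = 1 ∧ q 1 = j ∧ ∀ r ∈ S, r ≠ q →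
      v₂ + j + 1 ≤ v₂ * r 0 + r 1 ∧ j * v₁ ≤ j * v₂ * r 0 + c * r 1 := by
  obtain ⟨q, hq, hmin⟩ := S.exists_min_image (fun r => v₂ * r 0 + r 1) hS
  obtain ⟨j, hj⟩ := Nat.exists_eq_add_of_lt (h₃ q hq)
  set i := j + 1 with hi
  have hqi : v₂ * q 0 + q 1 = v₂ + i := by omega
  have hi1 : 1 ≤ i := by omega
  have hic : i < c := by have := h₂ q hq; omega
  -- Taking ν = N = 1, the face of least weight cannot contain an exponent with r 0 ≥ 2; so it
  -- consists of (1, i) alone.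
  have hface : ∀ r ∈ S, v₂ * r 0 + r 1 = v₂ + i → r 0 = 1 := by
    intro r hr hri
    by_contra hne
    have := h₁ r hr
    refine hsteep 1 1 i hi1 one_pos le_rfl (fun r' hr' => ?_) ⟨r, hr, by linarith, by omega⟩
      (by omega)
    have := hmin r' hr'
    linarith
  have hq0 := hface q hq hqi
  have hq1 : q 1 = i := by rw [hq0] at hqi; omega
  refine ⟨i, hi1, hic, q, hq, hq0, hq1, fun r hr hrq => ⟨?_, ?_⟩⟩
  · have h4 := hmin r hr
    by_contra h5
    have h6 : v₂ * r 0 + r 1 = v₂ + i := by omega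
    refine hrq (Finsupp.ext fun x => ?_)
    have h7 := hface r hr h6
    rw [h7] at h6
    fin_cases x
    · exact h7.trans hq0.symm
    · change r 1 = q 1
      omega
  · by_contra! hcon
    have hr0 := h₁ r hr
    have hwr : v₂ + i ≤ v₂ * r 0 + r 1 := hqi ▸ hmin r hr
    have hr2 : 2 ≤ r 0 := by
      by_contra h4
      have h5 : r 0 = 1 := by omega
      rw [h5, mul_one] at hwr hcon
      have h6 : i ≤ r 1 := by omega
      have h7 := Nat.mul_le_mul_left c h6
      rw [hc] at hcon
      nlinarith
    set T := S.filter fun r => 2 ≤ r 0 with hT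
    -- Among the exponents with r 0 ≥ 2, `p` gives the steepest line through (1, i). All exponents
    -- lie on or above that line, so it spans a face.
    obtain ⟨p, hp, hmax⟩ := T.exists_max_image
      (fun r => ((i : ℚ) - r 1) / ((r 0 : ℚ) - 1)) ⟨r, Finset.mem_filter.2 ⟨hr, hr2⟩⟩
    obtain ⟨hpS, hp2⟩ := Finset.mem_filter.1 hp
    have hpos : ∀ r ∈ T, (0 : ℚ) < (r 0 : ℚ) - 1 := by
      intro r hr
      have : (2 : ℚ) ≤ r 0 := by exact_mod_cast (Finset.mem_filter.1 hr).2
      linarith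
    have hmax' : ∀ r ∈ T, ((i : ℚ) - r 1) * ((p 0 : ℚ) - 1) ≤ ((i : ℚ) - p 1) * ((r 0 : ℚ) - 1) :=
      fun r hr => (div_le_div_iff₀ (hpos r hr) (hpos p hp)).1 (hmax r hr)
    have hrT : r ∈ T := Finset.mem_filter.2 ⟨hr, hr2⟩
    have hcon' : (i : ℚ) * v₂ * ((r 0 : ℚ) - 1) < c * ((i : ℚ) - r 1) := by
      have : ((i * v₂ * r 0 + c * r 1 : ℕ) : ℚ) < ((i * v₁ : ℕ) : ℚ) := by exact_mod_cast hcon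
      rw [hc] at this
      push_cast at this
      linarith
    have hc0 : (0 : ℚ) < c := by exact_mod_cast (by omega : 0 < c)
    have hri : (0 : ℚ) < (i : ℚ) - r 1 := by
      refine pos_of_mul_pos_right (lt_of_le_of_lt ?_ hcon') hc0.le
      have := (hpos r hrT).le
      positivity
    have hpi : (0 : ℚ) < (i : ℚ) - p 1 := by
      refine pos_of_mul_pos_left (lt_of_lt_of_le ?_ (hmax' r hrT)) (hpos r hrT).le
      exact mul_pos hri (hpos p hp)
    have hpi' : p 1 < i := by
      have : (p 1 : ℚ) < i := by linarith
      exact_mod_cast this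
    obtain ⟨ν, hν⟩ := Nat.exists_eq_add_of_lt hpi'
    obtain ⟨b, hb⟩ := Nat.exists_eq_add_of_le hp2
    have hv₂ : 0 < v₂ := by
      rcases Nat.eq_zero_or_pos v₂ with h0 | h0
      · exfalso
        have := hmin p hpS
        simp only [h0] at this hqi
        omega
      · exact h0
    have hνq : ((ν + 1 : ℕ) : ℚ) = (i : ℚ) - p 1 := by rw [hν]; push_cast; ring
    have hbq : ((b + 1 : ℕ) : ℚ) = (p 0 : ℚ) - 1 := by rw [hb]; push_cast; ring
    -- The weights come from the line through (1, i) and p: ν + 1 = i - p 1 and b + 1 = p 0 - 1.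
    -- Minimality of the weight v₂ + i gives ν + 1 ≤ N, and lying below the critical line gives the
    -- last inequality.
    refine hsteep (ν + 1) (v₂ * (b + 1)) i hi1 (by positivity) ?_ ?_ ⟨p, hpS, ?_, hp2⟩ ?_
    · have h4 : v₂ + i ≤ v₂ * p 0 + p 1 := hqi ▸ hmin p hpS
      rw [hb] at h4
      nlinarith
    · intro r' hr'
      have h5 : ((i : ℚ) - r' 1) * (b + 1 : ℕ) ≤ (ν + 1 : ℕ) * ((r' 0 : ℚ) - 1) := by
        by_cases h6 : 2 ≤ r' 0
        · rw [hνq, hbq]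
          exact hmax' r' (Finset.mem_filter.2 ⟨hr', h6⟩)
        · have h7 : r' 0 = 1 := by have := h₁ r' hr'; omega
          have h8 : v₂ + i ≤ v₂ * r' 0 + r' 1 := hqi ▸ hmin r' hr'
          rw [h7, mul_one] at h8
          have h9 : (i : ℚ) ≤ r' 1 := by exact_mod_cast (by omega : i ≤ r' 1)
          rw [h7]
          simp only [Nat.cast_one, sub_self, mul_zero]
          exact mul_nonpos_of_nonpos_of_nonneg (by linarith) (Nat.cast_nonneg _)
      have h6 := mul_le_mul_of_nonneg_left h5 (Nat.cast_nonneg (α := ℚ) v₂)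
      have h7 : (((ν + 1) * v₂ + v₂ * (b + 1) * i : ℕ) : ℚ) ≤
          (((ν + 1) * v₂ * r' 0 + v₂ * (b + 1) * r' 1 : ℕ) : ℚ) := by
        push_cast at h6 ⊢
        linarith
      exact_mod_cast h7
    · have h7 : (((ν + 1) * v₂ * p 0 + v₂ * (b + 1) * p 1 : ℕ) : ℚ) =
          (((ν + 1) * v₂ + v₂ * (b + 1) * i : ℕ) : ℚ) := by
        push_cast at hνq hbq ⊢
        rw [hνq, hbq]
        ring
      exact_mod_cast h7
    · have h5 := hmax' r hrT
      rw [← hνq, ← hbq] at h5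
      have h6 : (i : ℚ) * v₂ * (b + 1 : ℕ) < (ν + 1 : ℕ) * c := by
        have h7 := mul_lt_mul_of_pos_right hcon' (show (0 : ℚ) < (b + 1 : ℕ) by positivity)
        have h8 := mul_le_mul_of_nonneg_left h5 hc0.le
        refine lt_of_mul_lt_mul_right ?_ (hpos r hrT).le
        linarith
      have h7 : (((ν + 1) * v₂ + v₂ * (b + 1) * i : ℕ) : ℚ) < (((ν + 1) * v₁ : ℕ) : ℚ) := by
        rw [hc]
        push_cast at h6 ⊢
        linarith
      exact_mod_cast h7

end WeightedBlowup

end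

/-! ### Constructing the new coordinates: equal weights and a unit derivative. -/

noncomputable section

open Polynomial AlgebraicGeometry IsLocalRing

namespace WeightedBlowup

variable {k K : Type*} [Field k] [Field K] [Algebra k K]

theorem adjoin_coe_le {A : Subalgebra k K} (a : A) : Algebra.adjoin k {(a : K)} ≤ A := by
  rw [Algebra.adjoin_le_iff, Set.singleton_subset_iff]
  exact a.2

namespace BlowupTower

variable {A B : Subalgebra k K} {F : Divisor k K} {x : Fin 3 → A}
  {D : Fin 3 → Derivation k K K} {w₁ w₂ : ℕ} {u : Fin 2 → B} {z : Fin 3 → B}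
  {D' : Fin 3 → Derivation k K K} {v₁ v₂ : ℕ}
  (h : BlowupTower A B F x D w₁ w₂ u z D' v₁ v₂)

include h

theorem pow_mul_mem {n w : ℕ} {f : K} (hf : f ∈ orderFiltration F.ring (x 2 : K) n) :
    (x 2 : K) ^ w * f ∈ orderFiltration F.ring (x 2 : K) (w + n : ℕ) := by
  push_cast
  exact mul_mem_orderFiltration h.ne_zero (pow_mem_orderFiltration_self h.ne_zero w) hf

/-- An element of `B` is a polynomial in `x₃` up to order `n` if `n` is at most the weights. -/
theorem exists_sub_mem (f : B) {n : ℕ} (h₁ : n ≤ v₁) (h₂ : n ≤ v₂) :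
    ∃ τ ∈ Algebra.adjoin k {(x 2 : K)}, (f : K) - τ ∈ orderFiltration F.ring (x 2 : K) n := by
  obtain ⟨τ, hτ, r, hr, e⟩ := Submodule.mem_sup.1
    (h.coord'.mem_span_monomials_sup (weight_pos h.pos₁ h.pos₂) rfl h.isMonomial n f)
  refine ⟨τ, ?_, by rw [← e, add_sub_cancel_left, ← h.coord_two]; exact hr⟩
  refine (Submodule.span_le (p := Subalgebra.toSubmodule (Algebra.adjoin k {(x 2 : K)}))).2 ?_ hτ
  rintro _ ⟨a, b, e, hlt, rfl⟩
  simp only [Matrix.cons_val_zero, Matrix.cons_val_one] at hlt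
  have ha : a = 0 := by
    by_contra ha
    have := Nat.le_mul_of_pos_right v₁ (Nat.pos_of_ne_zero ha)
    omega
  have hb : b = 0 := by
    by_contra hb
    have := Nat.le_mul_of_pos_right v₂ (Nat.pos_of_ne_zero hb)
    omega
  rw [ha, hb, pow_zero, pow_zero, one_mul, one_mul, h.coord_two]
  exact pow_mem (Algebra.self_mem_adjoin_singleton k _) e

/-- The conclusion of the main theorem, from suitable coordinates. -/
theorem exists_weights [CharZero k] {d : ℕ} (hd : d ≤ v₁ - v₂) {τ η : K}
    (hτ : τ ∈ Algebra.adjoin k {(x 2 : K)})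
    (hη : η ∈ Algebra.adjoin k {(x 1 : K) - τ, (x 2 : K)})
    (h₀ : (x 0 : K) - η ∈ orderFiltration F.ring (x 2 : K) (w₁ + (v₁ - d) : ℕ))
    (h₁ : (x 1 : K) - τ ∈ orderFiltration F.ring (x 2 : K) (w₂ + (v₂ + d) : ℕ)) :
    ∃ (d : ℕ) (X : Fin 3 → A), d ≤ v₁ - v₂ ∧ IsRegularSystem X ∧ X 2 = x 2 ∧
      IsExceptionalDivisor X ![w₁ + v₁ - d, w₂ + v₂ + d, 1] F := by
  have hX₁ : (x 1 : K) - τ ∈ A := sub_mem (x 1).2 (adjoin_coe_le _ hτ)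
  have hη' : η ∈ A := by
    refine (Algebra.adjoin_le_iff (S := A)).2 ?_ hη
    rintro _ (rfl | rfl)
    · exact hX₁
    · exact (x 2).2
  have := h.pos₁
  have := h.pos₂
  have e1 : w₁ + v₁ - d = w₁ + (v₁ - d) := by omega
  have := h.isExceptionalDivisor (X₀ := ⟨_, sub_mem (x 0).2 hη'⟩) (X₁ := ⟨_, hX₁⟩)
    (α := w₁ + v₁ - d) (β := w₂ + (v₂ + d)) (by omega) (by omega) (by omega)
    (by simpa using hτ) (by simpa using hη) (by rw [e1]; exact h₀) h₁
  exact ⟨d, _, hd, this.1, rfl, by rw [add_assoc w₂]; exact this.2⟩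

/-- Below order v₁ = v₂ only powers of t occur in any expansion, so each u_i is corrected by a
polynomial in t independently. -/
theorem exists_weights_of_eq [CharZero k] (hv : v₁ = v₂) :
    ∃ (d : ℕ) (X : Fin 3 → A), d ≤ v₁ - v₂ ∧ IsRegularSystem X ∧ X 2 = x 2 ∧
      IsExceptionalDivisor X ![w₁ + v₁ - d, w₂ + v₂ + d, 1] F := by
  obtain ⟨τ₀, hτ₀, h₀⟩ := h.exists_sub_mem (u 0) le_rfl hv.le
  obtain ⟨τ₁, hτ₁, h₁⟩ := h.exists_sub_mem (u 1) hv.ge le_rfl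
  have hpow : ∀ w : ℕ, (x 2 : K) ^ w ∈ Algebra.adjoin k {(x 2 : K)} := fun w =>
    pow_mem (Algebra.self_mem_adjoin_singleton k _) w
  refine h.exists_weights (d := 0) (Nat.zero_le _) (mul_mem (hpow w₂) hτ₁)
    (Algebra.adjoin_mono (by simp) (mul_mem (hpow w₁) hτ₀)) ?_ ?_
  · rw [h.coord_zero, ← mul_sub]
    exact h.pow_mul_mem h₀
  · rw [h.coord_one, ← mul_sub]
    exact h.pow_mul_mem h₁

/-- A new coordinate of weight `v₂`. -/
theorem exists_coordinate [CharZero k] (hv : v₂ ≤ v₁) (i : Fin 2)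
    (hu : IsUnit (h.coord'.der 1 (u i))) :
    ∃ τ ∈ Algebra.adjoin k {(x 2 : K)}, ∃ s : B, (s : K) = u i - τ ∧
      (s : K) ∈ orderFiltration F.ring (x 2 : K) v₂ ∧ ∀ f : B,
      (f : K) ∈ Submodule.span k {g : K | ∃ b e : ℕ, v₂ * b + e < v₁ ∧
        g = (s : K) ^ b * (x 2 : K) ^ e} ⊔ orderFiltration F.ring (x 2 : K) v₁ := by
  obtain ⟨τ, hτ, hs⟩ := h.exists_sub_mem (u i) hv le_rfl
  set s : B := u i - ⟨τ, h.le (adjoin_coe_le _ hτ)⟩ with hsdef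
  have hs' : (s : K) ∈ orderFiltration F.ring (x 2 : K) v₂ := hs
  have hder : h.coord'.der 1 s = h.coord'.der 1 (u i) := by
    rw [hsdef, map_sub, sub_eq_self]
    exact Subtype.ext (derivation_eq_zero_of_mem_adjoin (h.derivation_two (by decide)) hτ)
  have hsu : ¬ IsUnit s := not_isUnit_of_mem_orderFiltration h.isMonomial h.le_ring h.pos₂
    (h.coord_two ▸ hs')
  obtain ⟨D'', hD''⟩ := h.coord'.replace hsu (hder ▸ hu)
  have hz0 : ((z 0 : B) : K) ∈ orderFiltration F.ring (x 2 : K) v₁ := by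
    rw [← h.coord_two]
    exact h.isMonomial.coord_mem_orderFiltration rfl 0
  have hmon := h.isMonomial_change rfl hz0 hs' (by
    rw [h.coord'.der_coord, h.coord'.der_coord, hder]
    simpa using hu)
  refine ⟨τ, hτ, s, rfl, hs', fun f => ?_⟩
  have h1 := hD''.mem_span_monomials_sup (weight_pos h.pos₁ h.pos₂) rfl hmon v₁ f
  have e2 : ((![z 0, s, z 2] 2 : B) : K) = x 2 := h.coord_two
  rw [e2] at h1
  obtain ⟨P, hP, r, hr, e⟩ := Submodule.mem_sup.1 h1
  rw [← e]
  refine add_mem (Submodule.mem_sup_left (Submodule.span_mono ?_ hP))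
    (Submodule.mem_sup_right hr)
  rintro _ ⟨a, b, e, hlt, rfl⟩
  simp only [Matrix.cons_val_zero, Matrix.cons_val_one] at hlt
  -- The coordinate z_0 already has weight v₁, so it does not occur in terms of weight below v₁.
  have ha : a = 0 := by
    by_contra ha
    have := Nat.le_mul_of_pos_right v₁ (Nat.pos_of_ne_zero ha)
    omega
  subst ha
  exact ⟨b, e, by omega, by simp⟩

/-- Here s = u_2 - τ can replace the coordinate of weight v₂, and u_1 is a polynomial P(s, t) up to
order v₁. Subtracting t^{w₁}P from x_1 is permitted because it is a polynomial in x_2' = t^{w₂}s and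
t. -/
theorem exists_weights_of_isUnit [CharZero k] (hv : v₂ ≤ v₁)
    (hslope : ∀ a, a * v₂ < v₁ → a * w₂ + v₁ ^ 2 ≤ w₁) (hu : IsUnit (h.coord'.der 1 (u 1))) :
    ∃ (d : ℕ) (X : Fin 3 → A), d ≤ v₁ - v₂ ∧ IsRegularSystem X ∧ X 2 = x 2 ∧
      IsExceptionalDivisor X ![w₁ + v₁ - d, w₂ + v₂ + d, 1] F := by
  obtain ⟨τ, hτ, s, hs, hs', hspan⟩ := h.exists_coordinate hv 1 hu
  obtain ⟨P, hP, r, hr, e⟩ := Submodule.mem_sup.1 (hspan (u 0))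
  have hpow : ∀ w : ℕ, (x 2 : K) ^ w ∈ Algebra.adjoin k {(x 2 : K)} := fun w =>
    pow_mem (Algebra.self_mem_adjoin_singleton k _) w
  have hX₁ : (x 1 : K) - (x 2 : K) ^ w₂ * τ = (x 2 : K) ^ w₂ * s := by
    rw [h.coord_one, hs, mul_sub]
  refine h.exists_weights (d := 0) (Nat.zero_le _) (mul_mem (hpow w₂) hτ)
    (η := (x 2 : K) ^ w₁ * P) ?_ ?_ ?_
  · rw [hX₁]
    set S := Algebra.adjoin k {(x 2 : K) ^ w₂ * s, (x 2 : K)}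
    have hle : Submodule.span k {g : K | ∃ b e : ℕ, v₂ * b + e < v₁ ∧
        g = (s : K) ^ b * (x 2 : K) ^ e} ≤
        (Subalgebra.toSubmodule S).comap (LinearMap.mulLeft k ((x 2 : K) ^ w₁)) := by
      refine Submodule.span_le.2 ?_
      rintro _ ⟨b, e, hlt, rfl⟩
      change (x 2 : K) ^ w₁ * ((s : K) ^ b * (x 2 : K) ^ e) ∈ S
      -- The bound b w₂ ≤ w₁ lets t^{w₁}s^b absorb b factors t^{w₂}, leaving a nonnegative power of
      -- t.
      have h1 := hslope b (by rw [mul_comm]; omega)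
      obtain ⟨c, hc⟩ := Nat.exists_eq_add_of_le (show b * w₂ ≤ w₁ by omega)
      have h2 : (x 2 : K) ^ w₁ * ((s : K) ^ b * (x 2 : K) ^ e) =
          ((x 2 : K) ^ w₂ * s) ^ b * (x 2 : K) ^ (c + e) := by
        rw [hc]
        ring
      rw [h2]
      exact mul_mem (pow_mem (Algebra.subset_adjoin (by simp)) b)
        (pow_mem (Algebra.subset_adjoin (by simp)) _)
    exact hle hP
  · rw [h.coord_zero, ← mul_sub, ← e, add_sub_cancel_left]
    exact h.pow_mul_mem hr
  · rw [hX₁]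
    exact h.pow_mul_mem hs'

end BlowupTower

theorem aeval_pair_mem_adjoin (s t : K) (p : MvPolynomial (Fin 2) k) :
    MvPolynomial.aeval ![s, t] p ∈ Algebra.adjoin k {s, t} := by
  induction p using MvPolynomial.induction_on with
  | C a => simp
  | add p q hp hq => rw [map_add]; exact add_mem hp hq
  | mul_X p i hp =>
    rw [map_mul, MvPolynomial.aeval_X]
    refine mul_mem hp (Algebra.subset_adjoin ?_)
    fin_cases i <;> simp

/-- A combination of monomials `s^b t^e` of weight less than `v₁` is the sum of a polynomial in `t`
and of a polynomial divisible by `s`. -/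
theorem exists_polynomial_of_mem_span {s t : K} {v₁ v₂ : ℕ} {P : K}
    (hP : P ∈ Submodule.span k {g : K | ∃ b e : ℕ, v₂ * b + e < v₁ ∧ g = s ^ b * t ^ e}) :
    ∃ τ ∈ Algebra.adjoin k {t}, ∃ p : MvPolynomial (Fin 2) k,
      (∀ r ∈ p.support, 1 ≤ r 0 ∧ v₂ * r 0 + r 1 < v₁) ∧
      P = τ + MvPolynomial.aeval ![s, t] p := by
  classical
  induction hP using Submodule.span_induction with
  | mem g hg =>
    obtain ⟨b, e, hlt, rfl⟩ := hg
    rcases Nat.eq_zero_or_pos b with rfl | hb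
    · exact ⟨t ^ e, pow_mem (Algebra.self_mem_adjoin_singleton k _) e, 0, by simp, by simp⟩
    · refine ⟨0, zero_mem _, MvPolynomial.monomial (Finsupp.equivFunOnFinite.symm ![b, e]) 1,
        ?_, ?_⟩
      · intro r hr
        rw [MvPolynomial.support_monomial, if_neg one_ne_zero, Finset.mem_singleton] at hr
        subst hr
        exact ⟨hb, hlt⟩
      · rw [MvPolynomial.aeval_monomial, Finsupp.prod_fintype _ _ (by simp), Fin.prod_univ_two]
        simp
  | zero => exact ⟨0, zero_mem _, 0, by simp, by simp⟩
  | add f g _ _ hf hg =>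
    obtain ⟨τ, hτ, p, hp, rfl⟩ := hf
    obtain ⟨τ', hτ', q, hq, rfl⟩ := hg
    refine ⟨τ + τ', add_mem hτ hτ', p + q, fun r hr => ?_, by rw [map_add]; ring⟩
    exact (Finset.mem_union.1 (MvPolynomial.support_add hr)).elim (hp r) (hq r)
  | smul c f _ hf =>
    obtain ⟨τ, hτ, p, hp, rfl⟩ := hf
    refine ⟨c • τ, Subalgebra.smul_mem _ hτ c, c • p, fun r hr => hp r ?_, by
      rw [map_smul, smul_add]⟩
    exact MvPolynomial.support_smul hr

end WeightedBlowup

end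

/-! ### Constructing the new coordinates: a nonunit derivative. -/

noncomputable section

open Polynomial AlgebraicGeometry IsLocalRing

namespace WeightedBlowup

variable {k K : Type*} [Field k] [Field K] [Algebra k K]

theorem aeval_sub_constantCoeff_mem {R σ : Type*} [CommRing R] [Algebra k R] {I : Ideal R}
    {g : σ → R} (hg : ∀ i, g i ∈ I) (q : MvPolynomial σ k) :
    MvPolynomial.aeval g q - algebraMap k R (MvPolynomial.constantCoeff q) ∈ I := by
  induction q using MvPolynomial.induction_on with
  | C a => simp
  | add p q hp hq =>
    rw [map_add, map_add, map_add, add_sub_add_comm]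
    exact add_mem hp hq
  | mul_X p i hp =>
    rw [map_mul, map_mul, MvPolynomial.aeval_X, MvPolynomial.constantCoeff_X, mul_zero, map_zero,
      sub_zero]
    exact Ideal.mul_mem_left _ _ (hg i)

theorem constantCoeff_pderiv {σ : Type*} (i : σ) (p : MvPolynomial σ k) :
    MvPolynomial.constantCoeff (MvPolynomial.pderiv i p) = p.coeff (Finsupp.single i 1) := by
  classical
  induction p using MvPolynomial.induction_on' with
  | add p q hp hq => rw [map_add, map_add, hp, hq, MvPolynomial.coeff_add]
  | monomial r c =>
    rw [MvPolynomial.pderiv_monomial, MvPolynomial.constantCoeff_monomial,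
      MvPolynomial.coeff_monomial]
    by_cases h : r = Finsupp.single i 1
    · subst h
      simp
    · rw [if_neg h]
      split_ifs with h1
      · have h2 : r ≤ Finsupp.single i 1 := tsub_eq_zero_iff_le.1 h1
        by_cases h3 : r i = 0
        · rw [h3, Nat.cast_zero, mul_zero]
        · refine absurd (le_antisymm h2 ?_) h
          rw [Finsupp.single_le_iff]
          omega
      · rfl

namespace BlowupTower

variable {A B : Subalgebra k K} {F : Divisor k K} {x : Fin 3 → A}
  {D : Fin 3 → Derivation k K K} {w₁ w₂ : ℕ} {u : Fin 2 → B} {z : Fin 3 → B}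
  {D' : Fin 3 → Derivation k K K} {v₁ v₂ : ℕ}
  (h : BlowupTower A B F x D w₁ w₂ u z D' v₁ v₂)

include h

theorem coe_aeval_pair (s : B) (p : MvPolynomial (Fin 2) k) :
    ((MvPolynomial.aeval ![s, z 2] p : B) : K) = MvPolynomial.aeval ![(s : K), x 2] p := by
  change B.val _ = _
  rw [← AlgHom.comp_apply, MvPolynomial.comp_aeval]
  congr 2
  ext i
  fin_cases i
  · rfl
  · exact h.coord_two

/-- If the derivative of `u₂` is not a unit, then `s` does not occur linearly in the
expansion of `u₂`. -/
theorem lt_weight_of_not_isUnit [CharZero k] (hv : v₂ < v₁) (h₀ : IsUnit (h.coord'.der 1 (u 0)))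
    (h₁ : ¬ IsUnit (h.coord'.der 1 (u 1))) {τ₀ τ₁ : K}
    (hτ₀ : τ₀ ∈ Algebra.adjoin k {(x 2 : K)}) (hτ₁ : τ₁ ∈ Algebra.adjoin k {(x 2 : K)}) {s : B}
    (hs : (s : K) = u 0 - τ₀) (hs' : (s : K) ∈ orderFiltration F.ring (x 2 : K) v₂)
    {p : MvPolynomial (Fin 2) k}
    (hp : (u 1 : K) - (τ₁ + MvPolynomial.aeval ![(s : K), x 2] p) ∈
      orderFiltration F.ring (x 2 : K) v₁)
    (hp' : ∀ r ∈ p.support, 1 ≤ r 0) : ∀ r ∈ p.support, v₂ < v₂ * r 0 + r 1 := by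
  intro r hr
  by_contra hcon
  have hr0 := hp' r hr
  have hpos := h.pos₂
  have hr0' : r 0 = 1 := by
    by_contra hne
    have := Nat.mul_le_mul_left v₂ (show 2 ≤ r 0 by omega)
    omega
  have hr1 : r 1 = 0 := by rw [hr0'] at hcon; omega
  have hrs : r = Finsupp.single 0 1 := by
    ext i
    fin_cases i
    · simpa using hr0'
    · simpa using hr1
  have hder₂ : h.coord'.der 1 (z 2) = 0 := by simp [h.coord'.der_coord]
  have hadj : ∀ τ (hτ : τ ∈ Algebra.adjoin k {(x 2 : K)}),
      h.coord'.der 1 ⟨τ, h.le (adjoin_coe_le _ hτ)⟩ = 0 := fun τ hτ =>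
    Subtype.ext (derivation_eq_zero_of_mem_adjoin (h.derivation_two (by decide)) hτ)
  have hs'' : h.coord'.der 1 s = h.coord'.der 1 (u 0) := by
    have : s = u 0 - ⟨τ₀, h.le (adjoin_coe_le _ hτ₀)⟩ := Subtype.ext hs
    rw [this, map_sub, hadj τ₀ hτ₀, sub_zero]
  set y : B := u 1 - (⟨τ₁, h.le (adjoin_coe_le _ hτ₁)⟩ + MvPolynomial.aeval ![s, z 2] p) with hy
  have hyK : (y : K) = (u 1 : K) - (τ₁ + MvPolynomial.aeval ![(s : K), x 2] p) := by
    rw [hy, ← h.coe_aeval_pair]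
    rfl
  have hyI : y ∈ weightedIdeal z ![v₁, v₂, 1] v₁ := by
    rw [h.isMonomial.mem_weightedIdeal_iff_order h.coord' (weight_pos h.pos₁ h.pos₂) rfl, hyK,
      h.coord_two]
    exact hp
  set I := Ideal.span (Set.range z) with hI
  -- Since y has weight at least v₁ > v₂, its derivative along the coordinate of weight v₂ still has
  -- positive weight.
  have hdy : h.coord'.der 1 y ∈ I := by
    have h2 := h.coord'.der_mem_weightedIdeal ![v₁, v₂, 1] 1 hyI
    rw [hI, ← weightedIdeal_one_eq_span z ![v₁, v₂, 1] (weight_pos h.pos₁ h.pos₂)]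
    refine weightedIdeal_antitone _ _ ?_ h2
    change 1 ≤ v₁ - v₂
    omega
  rw [hy, map_sub, map_add, hadj τ₁ hτ₁, zero_add, aeval_derivation, Fin.sum_univ_two] at hdy
  simp only [Matrix.cons_val_zero, Matrix.cons_val_one, hder₂, hs'', mul_zero, add_zero] at hdy
  rw [← h.coord'.mem_span_iff] at h₁
  have h3 := sub_mem h₁ hdy
  rw [sub_sub_cancel] at h3
  obtain ⟨d, hd⟩ := h₀.exists_right_inv
  -- Dividing by the unit derivative of u_1 puts ∂p/∂s in the maximal ideal; its constant term is
  -- the coefficient of s in p, which is nonzero by assumption.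
  have h4 : MvPolynomial.aeval ![s, z 2] (MvPolynomial.pderiv 0 p) ∈ I := by
    have := Ideal.mul_mem_right d _ h3
    rwa [mul_assoc, hd, mul_one] at this
  have hsI : s ∈ I := (h.coord'.mem_span_iff s).2
    (not_isUnit_of_mem_orderFiltration h.isMonomial h.le_ring h.pos₂ (h.coord_two ▸ hs'))
  have h5 := aeval_sub_constantCoeff_mem (k := k) (I := I) (g := ![s, z 2]) (by
    intro i
    fin_cases i
    · exact hsI
    · exact Ideal.subset_span ⟨2, rfl⟩) (MvPolynomial.pderiv 0 p)
  have h6 := sub_mem h4 h5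
  rw [sub_sub_cancel, constantCoeff_pderiv, ← hrs] at h6
  exact (h.coord'.mem_span_iff _).1 h6
    ((IsUnit.mk0 _ (MvPolynomial.mem_support_iff.1 hr)).map (algebraMap k B))

/-- The roles are exchanged: s = u_1 - τ₀ has weight v₂ and U = u_2 - τ₁ = p(s, t) + y. With initial
term s t^j, the order of U is at least v₂ + j, while s is recovered from U up to order v₁ - j; this
trades j between the two weights, so d = j. If p = 0 the exchange is complete and d = v₁ - v₂. -/
theorem exists_weights_of_not_isUnit [CharZero k] (hv : v₂ < v₁)
    (hslope : ∀ a, a * v₂ < v₁ → a * w₂ + v₁ ^ 2 ≤ w₁)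
    (h₀ : IsUnit (h.coord'.der 1 (u 0))) (h₁ : ¬ IsUnit (h.coord'.der 1 (u 1)))
    (hsteep : ∀ τ₀ ∈ Algebra.adjoin k {(x 2 : K)}, ∀ τ₁ ∈ Algebra.adjoin k {(x 2 : K)}, ∀ s : B,
      (s : K) = u 0 - τ₀ → (s : K) ∈ orderFiltration F.ring (x 2 : K) v₂ →
      ∀ p : MvPolynomial (Fin 2) k, (u 1 : K) - (τ₁ + MvPolynomial.aeval ![(s : K), x 2] p) ∈
        orderFiltration F.ring (x 2 : K) v₁ → (∀ r ∈ p.support, v₂ * r 0 + r 1 < v₁) →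
      ∀ ν N j : ℕ, 1 ≤ j → 0 < N → ν ≤ N →
      (∀ r ∈ p.support, ν * v₂ + N * j ≤ ν * v₂ * r 0 + N * r 1) →
      (∃ r ∈ p.support, ν * v₂ * r 0 + N * r 1 = ν * v₂ + N * j ∧ 2 ≤ r 0) →
      ν * v₂ + N * j < ν * v₁ → False) :
    ∃ (d : ℕ) (X : Fin 3 → A), d ≤ v₁ - v₂ ∧ IsRegularSystem X ∧ X 2 = x 2 ∧
      IsExceptionalDivisor X ![w₁ + v₁ - d, w₂ + v₂ + d, 1] F := by
  have ht := h.ne_zero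
  obtain ⟨τ₀, hτ₀, s, hs, hs', hspan⟩ := h.exists_coordinate hv.le 0 h₀
  obtain ⟨P, hP, y, hy, e⟩ := Submodule.mem_sup.1 (hspan (u 1))
  obtain ⟨τ₁, hτ₁, p, hp, rfl⟩ := exists_polynomial_of_mem_span hP
  have hpow : ∀ w : ℕ, (x 2 : K) ^ w ∈ Algebra.adjoin k {(x 2 : K)} := fun w =>
    pow_mem (Algebra.self_mem_adjoin_singleton k _) w
  have hy' : (u 1 : K) - (τ₁ + MvPolynomial.aeval ![(s : K), x 2] p) ∈
      orderFiltration F.ring (x 2 : K) v₁ := by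
    rw [← e, add_sub_cancel_left]
    exact hy
  have hX₀ : (x 0 : K) - (x 2 : K) ^ w₁ * τ₀ = (x 2 : K) ^ w₁ * s := by
    rw [h.coord_zero, hs, mul_sub]
  set U : K := MvPolynomial.aeval ![(s : K), x 2] p + y with hU
  have hX₁ : (x 1 : K) - (x 2 : K) ^ w₂ * τ₁ = (x 2 : K) ^ w₂ * U := by
    rw [h.coord_one, ← e, hU]
    ring
  by_cases hp0 : p = 0
  · refine h.exists_weights (d := v₁ - v₂) le_rfl (mul_mem (hpow w₂) hτ₁)
      (Algebra.adjoin_mono (by simp) (mul_mem (hpow w₁) hτ₀)) ?_ ?_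
    · rw [hX₀, Nat.sub_sub_self hv.le]
      exact h.pow_mul_mem hs'
    · rw [hX₁, hU, hp0, map_zero, zero_add, Nat.add_sub_cancel' hv.le]
      exact h.pow_mul_mem hy
  obtain ⟨c, hc⟩ := Nat.exists_eq_add_of_le hv.le
  obtain ⟨j, hj, hjc, q, hq, hq0, hq1, hqr⟩ := exists_initial_exponent hc
    (MvPolynomial.support_nonempty.2 hp0) (fun r hr => (hp r hr).1) (fun r hr => (hp r hr).2)
    (h.lt_weight_of_not_isUnit hv h₀ h₁ hτ₀ hτ₁ hs hs' hy' fun r hr => (hp r hr).1)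
    (hsteep τ₀ hτ₀ τ₁ hτ₁ s hs hs' p hy' fun r hr => (hp r hr).2)
  -- Besides its initial term, U consists of exponents on or above the critical line and of y, whose
  -- second weight is j v₁; since j < v₁ - v₂, also y has first weight above v₂ + j.
  have hUd : U - p.coeff q • ((s : K) * (x 2 : K) ^ j) ∈
      doubleFiltration k (s : K) y (x 2 : K) v₁ v₂ j c (v₂ + j + 1) (j * v₁) := by
    have e1 : U - p.coeff q • ((s : K) * (x 2 : K) ^ j) =
        ∑ r ∈ p.support.erase q, p.coeff r • ((s : K) ^ r 0 * (x 2 : K) ^ r 1) + y := by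
      rw [hU, MvPolynomial.aeval_def, MvPolynomial.eval₂_eq', ← Finset.add_sum_erase _ _ hq]
      simp only [Fin.prod_univ_two, Matrix.cons_val_zero, Matrix.cons_val_one, hq0, hq1,
        Algebra.smul_def]
      ring
    rw [e1]
    refine add_mem (Submodule.sum_mem _ fun r hr => Submodule.smul_mem _ _ ?_) ?_
    · obtain ⟨hrq, hr⟩ := Finset.mem_erase.1 hr
      obtain ⟨h2, h3⟩ := hqr r hr hrq
      have := monomial_mem_doubleFiltration (k := k) (s := (s : K)) (y := y) (t := (x 2 : K))
        (v₁ := v₁) (v₂ := v₂) (j := j) (c := c) (n := v₂ + j + 1) (r := j * v₁) (r 0) 0 (r 1)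
        (by push_cast; rw [mul_zero, add_zero]; exact_mod_cast h2)
        (by push_cast; rw [mul_zero, add_zero, ← mul_assoc]; exact_mod_cast h3)
      simpa using this
    · have := monomial_mem_doubleFiltration (k := k) (s := (s : K)) (y := y) (t := (x 2 : K))
        (v₁ := v₁) (v₂ := v₂) (j := j) (c := c) (n := v₂ + j + 1) (r := j * v₁) 0 1 0
        (by push_cast; omega) (by push_cast; simp)
      simpa using this
  -- The inversion is carried through c - j steps, that is, up to order v₂ + (c - j) = v₁ - j.
  obtain ⟨g, hg, r, hr, hgr⟩ := Submodule.mem_sup.1 (mem_span_sup_doubleFiltration ht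
    (MvPolynomial.mem_support_iff.1 hq) hUd hc hjc h.pos₂ (c - j) (by omega))
  have hle := fun n r => doubleFiltration_le_orderFiltration (k := k) (j := j) (c := c) ht
    h.mem_ring hs' hy n r
  have hr' : r ∈ orderFiltration F.ring (x 2 : K) (v₁ - j : ℕ) := by
    have := hle _ _ hr
    have e2 : ((v₁ - j : ℕ) : ℤ) = v₂ + (c - j : ℕ) := by omega
    rwa [e2]
  refine h.exists_weights (d := j) (by omega) (mul_mem (hpow w₂) hτ₁)
    (η := (x 2 : K) ^ w₁ * τ₀ + (x 2 : K) ^ w₁ * g) ?_ ?_ ?_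
  · refine add_mem (Algebra.adjoin_mono (by simp) (mul_mem (hpow w₁) hτ₀)) ?_
    rw [hX₁]
    set S := Algebra.adjoin k {(x 2 : K) ^ w₂ * U, (x 2 : K)}
    have hle : Submodule.span k {g : K | ∃ (a : ℕ) (e : ℤ), a * v₂ < v₁ ∧
        (v₂ : ℤ) ≤ e + (v₂ + j) * a ∧ g = U ^ a * (x 2 : K) ^ e} ≤
        (Subalgebra.toSubmodule S).comap (LinearMap.mulLeft k ((x 2 : K) ^ w₁)) := by
      refine Submodule.span_le.2 ?_
      rintro _ ⟨a, e, h2, h3, rfl⟩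
      change (x 2 : K) ^ w₁ * (U ^ a * (x 2 : K) ^ e) ∈ S
      have h4 := hslope a h2
      have h5 : a ≤ v₁ := by
        have := Nat.le_mul_of_pos_right a h.pos₂
        omega
      have h6 : (v₂ + j) * a ≤ v₁ ^ 2 := by
        rw [sq]
        exact Nat.mul_le_mul (by omega) h5
      -- The power of t can be as negative as v₂ - (v₂ + j)a, at least -v₁². The summand v₁² in the
      -- slope bound makes the total exponent nonnegative.
      obtain ⟨b, hb⟩ := Int.eq_ofNat_of_zero_le (show 0 ≤ (w₁ : ℤ) + e - w₂ * a by
        have h4' : (a : ℤ) * w₂ + v₁ ^ 2 ≤ w₁ := by exact_mod_cast h4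
        have h6' : ((v₂ : ℤ) + j) * a ≤ v₁ ^ 2 := by exact_mod_cast h6
        have := Int.natCast_nonneg v₂
        linarith)
      have h7 : (x 2 : K) ^ w₁ * (U ^ a * (x 2 : K) ^ e) =
          ((x 2 : K) ^ w₂ * U) ^ a * (x 2 : K) ^ b := by
        have h8 : (x 2 : K) ^ w₁ * (x 2 : K) ^ e = (x 2 : K) ^ (w₂ * a) * (x 2 : K) ^ b := by
          rw [← zpow_natCast, ← zpow_natCast, ← zpow_natCast, ← zpow_add₀ ht, ← zpow_add₀ ht]
          congr 1
          push_cast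
          linarith
        rw [mul_pow, ← pow_mul]
        linear_combination U ^ a * h8
      rw [h7]
      exact mul_mem (pow_mem (Algebra.subset_adjoin (by simp)) a)
        (pow_mem (Algebra.subset_adjoin (by simp)) _)
    exact hle hg
  · have e3 : (x 0 : K) - ((x 2 : K) ^ w₁ * τ₀ + (x 2 : K) ^ w₁ * g) = (x 2 : K) ^ w₁ * r := by
      rw [← sub_sub, hX₀, ← hgr]
      ring
    rw [e3]
    exact h.pow_mul_mem hr'
  · rw [hX₁]
    refine h.pow_mul_mem ?_
    have e4 : U = (U - p.coeff q • ((s : K) * (x 2 : K) ^ j)) +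
      p.coeff q • ((s : K) * (x 2 : K) ^ j) := by ring
    rw [e4]
    refine add_mem (orderFiltration_antitone ht h.mem_ring ?_ (hle _ _ hUd))
      (Submodule.smul_mem _ _ ?_)
    · push_cast
      omega
    · push_cast
      exact mul_mem_orderFiltration ht hs' (pow_mem_orderFiltration_self ht j)

end BlowupTower

end WeightedBlowup

end

/-! ### Excluding steep faces by means of the auxiliary divisor G. -/

noncomputable section

open Polynomial AlgebraicGeometry IsLocalRing

namespace WeightedBlowup

variable {k K : Type*} [Field k] [Field K] [Algebra k K]

namespace BlowupTower

variable {A B : Subalgebra k K} {F : Divisor k K} {x : Fin 3 → A}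
  {D : Fin 3 → Derivation k K K} {w₁ w₂ : ℕ} {u : Fin 2 → B} {z : Fin 3 → B}
  {D' : Fin 3 → Derivation k K K} {v₁ v₂ : ℕ}
  (h : BlowupTower A B F x D w₁ w₂ u z D' v₁ v₂)

include h

/-- The divisor `E` is monomial with respect to the coordinates adapted to the tower. -/
theorem exists_coordSystem_isMonomial [CharZero k] (hw₁ : 0 < w₁) (hw₂ : 0 < w₂) {E : Divisor k K}
    (hE : E.ring = localRingAt (h.coord.genericPoint (weight_pos hw₁ hw₂))) {τ₀ τ₁ : K}
    (hτ₀ : τ₀ ∈ Algebra.adjoin k {(x 2 : K)}) (hτ₁ : τ₁ ∈ Algebra.adjoin k {(x 2 : K)}) :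
    ∃ (X : Fin 3 → A) (D₁ : Fin 3 → Derivation k K K), CoordSystem A X D₁ ∧ X 2 = x 2 ∧
      (X 0 : K) = x 0 - (x 2 : K) ^ w₁ * τ₀ ∧ (X 1 : K) = x 1 - (x 2 : K) ^ w₂ * τ₁ ∧
      IsMonomial E X ![w₁, w₂, 1] := by
  have hw := weight_pos hw₁ hw₂
  have hmon := h.coord.isMonomial hw rfl E hE
  have hpow : ∀ w : ℕ, ∀ τ ∈ Algebra.adjoin k {(x 2 : K)},
      (x 2 : K) ^ w * τ ∈ Algebra.adjoin k {(x 2 : K)} := fun w τ hτ =>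
    mul_mem (pow_mem (Algebra.self_mem_adjoin_singleton k _) w) hτ
  set T₀ : A := ⟨_, adjoin_coe_le _ (hpow w₁ τ₀ hτ₀)⟩ with hT₀
  set T₁ : A := ⟨_, adjoin_coe_le _ (hpow w₂ τ₁ hτ₁)⟩ with hT₁
  have hfilt : ∀ w : ℕ, ∀ τ ∈ Algebra.adjoin k {(x 2 : K)},
      (x 2 : K) ^ w * τ ∈ orderFiltration E.ring (x 2 : K) w := by
    intro w τ hτ
    have := mul_mem_orderFiltration h.ne_zero
      (pow_mem_orderFiltration_self (R := E.ring) h.ne_zero w)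
      (mem_orderFiltration_zero.2 (hmon.le (adjoin_coe_le _ hτ)))
    rwa [add_zero] at this
  have h0 : ((x 0 - T₀ : A) : K) ∈ orderFiltration E.ring (x 2 : K) w₁ :=
    sub_mem (hmon.coord_mem_orderFiltration rfl 0) (hfilt w₁ τ₀ hτ₀)
  have h1 : ((x 1 - T₁ : A) : K) ∈ orderFiltration E.ring (x 2 : K) w₂ :=
    sub_mem (hmon.coord_mem_orderFiltration rfl 1) (hfilt w₂ τ₁ hτ₁)
  have hspan : Ideal.span (Set.range ![x 0 - T₀, x 1 - T₁, x 2]) = Ideal.span (Set.range x) := by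
    refine h.coord.span_eq_of_sub_mem_adjoin (fun i => ?_) rfl ?_ ?_
    · fin_cases i
      · exact not_isUnit_of_mem_orderFiltration hmon hmon.le hw₁ h0
      · exact not_isUnit_of_mem_orderFiltration hmon hmon.le hw₂ h1
      · exact (h.coord.mem_span_iff _).1 (Ideal.subset_span ⟨2, rfl⟩)
    · change (x 1 : K) - (x 1 - (x 2 : K) ^ w₂ * τ₁) ∈ _
      rw [sub_sub_cancel]
      exact hpow w₂ τ₁ hτ₁
    · change (x 0 : K) - (x 0 - (x 2 : K) ^ w₁ * τ₀) ∈ _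
      rw [sub_sub_cancel]
      exact Algebra.adjoin_mono (by simp) (hpow w₁ τ₀ hτ₀)
  obtain ⟨D₁, hD₁⟩ := h.coord.change hspan
  refine ⟨_, D₁, hD₁, rfl, rfl, rfl, ?_⟩
  refine IsMonomial.of_jacobian h.coord hw rfl hE hmon.le rfl h0 h1 isUnit_one ?_
  have hD : ∀ i : Fin 3, i ≠ 2 → ∀ j : Fin 3, ∀ τ ∈ Algebra.adjoin k {(x 2 : K)},
      D i ((x j : K) - τ) = if i = j then 1 else 0 := by
    intro i hi j τ hτ
    have h2 : D i (x 2) = 0 := by rw [h.coord.map_coord, if_neg hi]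
    rw [map_sub, h.coord.map_coord, derivation_eq_zero_of_mem_adjoin h2 hτ, sub_zero]
  have e0 : ((x 0 - T₀ : A) : K) = (x 0 : K) - (x 2 : K) ^ w₁ * τ₀ := rfl
  have e1 : ((x 1 - T₁ : A) : K) = (x 1 : K) - (x 2 : K) ^ w₂ * τ₁ := rfl
  simp only [Matrix.cons_val_zero, Matrix.cons_val_one, e0, e1]
  rw [hD 0 (by decide) 0 _ (hpow w₁ τ₀ hτ₀), hD 1 (by decide) 0 _ (hpow w₁ τ₀ hτ₀),
    hD 0 (by decide) 1 _ (hpow w₂ τ₁ hτ₁), hD 1 (by decide) 1 _ (hpow w₂ τ₁ hτ₁)]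
  simp

/-- The initial form of `u₂` cannot be steep if the log discrepancies are as in the theorem. -/
theorem no_steep [CharZero k] (hA : Algebra.EssFiniteType k A) {𝔞 : RIdeal A}
    (hmld : mld A 𝔞 = 1) (hw₁ : 0 < w₁) (hw₂ : 0 < w₂) {E : Divisor k K}
    (hE : E.ring = localRingAt (h.coord.genericPoint (weight_pos hw₁ hw₂)))
    {e m : Fin 𝔞.length → ℕ}
    (he : ∀ i, ∀ f ∈ 𝔞.ideal i, (f : K) ∈ orderFiltration E.ring (x 2 : K) (e i))
    (hem : ∀ i, ∀ f ∈ 𝔞.ideal i, (f : K) ∈ orderFiltration F.ring (x 2 : K) (e i + m i : ℕ))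
    (hsume : ∑ i, 𝔞.exponent i * e i = w₁ + w₂)
    (hsumm : (v₁ + v₂ : ℝ) ≤ ∑ i, 𝔞.exponent i * m i)
    (hslope : ∀ a, a * v₂ < v₁ → a * w₂ + v₁ ^ 2 ≤ w₁)
    {τ₀ τ₁ : K} (hτ₀ : τ₀ ∈ Algebra.adjoin k {(x 2 : K)})
    (hτ₁ : τ₁ ∈ Algebra.adjoin k {(x 2 : K)}) {s : B} (hs : (s : K) = u 0 - τ₀)
    (hs' : (s : K) ∈ orderFiltration F.ring (x 2 : K) v₂) {p : MvPolynomial (Fin 2) k}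
    (hy : (u 1 : K) - (τ₁ + MvPolynomial.aeval ![(s : K), x 2] p) ∈
      orderFiltration F.ring (x 2 : K) v₁) (hpv : ∀ r ∈ p.support, v₂ * r 0 + r 1 < v₁)
    {ν N j : ℕ} (hj : 1 ≤ j) (hN : 0 < N) (hν : ν ≤ N)
    (hp : ∀ r ∈ p.support, ν * v₂ + N * j ≤ ν * v₂ * r 0 + N * r 1)
    (hp' : ∃ r ∈ p.support, ν * v₂ * r 0 + N * r 1 = ν * v₂ + N * j ∧ 2 ≤ r 0)
    (hνv : ν * v₂ + N * j < ν * v₁) : False := by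
  have hAF : A ≤ F.ring := h.le.trans h.le_ring
  obtain ⟨X, D₁, hX, hX2, hX0, hX1, hEX⟩ := h.exists_coordSystem_isMonomial hw₁ hw₂ hE hτ₀ hτ₁
  -- An exponent of degree at least 2 in s has weight below v₁, so the slope bound applies with a =
  -- 2 and gives 2w₂ + v₁² ≤ w₁.
  have hv2 : 2 * v₂ < v₁ := by
    obtain ⟨r, hr, -, hr2⟩ := hp'
    have h1 := hpv r hr
    have h2 := Nat.mul_le_mul_left v₂ hr2
    omega
  have hjv : j < v₁ := by
    have h1 := Nat.mul_le_mul_right v₁ hν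
    exact Nat.lt_of_mul_lt_mul_left (a := N) (by omega)
  have hw := hslope 2 hv2
  have hv₁ : v₁ ≤ v₁ ^ 2 := Nat.le_self_pow two_ne_zero v₁
  -- The first weight of G is w₀ = w₁ - (j + 1); it is positive because j < v₁ ≤ v₁².
  obtain ⟨w₀, hn⟩ := Nat.exists_eq_add_of_le (show j + 1 ≤ w₁ by omega)
  rw [add_comm] at hn
  have hw₀ : 0 < w₀ := by omega
  have hpos := weight_pos hw₀ hw₂
  obtain ⟨G, hG⟩ := hX.exists_divisor h.isFractionRing hA hpos rfl
  obtain ⟨g, hg, hsumg⟩ := exists_ord_of_canonicalOrder_le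
    (one_le_logDiscrepancy hmld (hX.hasCentre hpos rfl hG)) (hX.canonicalOrder_le hpos rfl hG)
  set y : B := u 1 - (⟨τ₁, h.le (adjoin_coe_le _ hτ₁)⟩ + MvPolynomial.aeval ![s, z 2] p) with hyd
  have hyK : (y : K) = (u 1 : K) - (τ₁ + MvPolynomial.aeval ![(s : K), x 2] p) := by
    rw [hyd, ← h.coe_aeval_pair]
    rfl
  -- The weights are interchanged: s has order v₂ and the remainder y takes weight v₁. Passing from
  -- u to s, y is triangular, so the Jacobian is unchanged.
  have hF : IsMonomial F ![s, y, z 2] ![v₂, v₁, 1] := by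
    refine h.isMonomial_change (add_comm _ _) hs' (hyK ▸ hy) ?_
    obtain ⟨c, hc⟩ := exists_derivation_eq_mul_of_mem_adjoin
      (aeval_pair_mem_adjoin (s := (s : K)) (t := (x 2 : K)) p)
    have ds : ∀ i : Fin 3, i ≠ 2 → D' i s = D' i (u 0) := fun i hi => by
      rw [hs, map_sub, derivation_eq_zero_of_mem_adjoin (h.derivation_two hi) hτ₀, sub_zero]
    have dy : ∀ i : Fin 3, i ≠ 2 → D' i y = D' i (u 1) - c * D' i (u 0) := fun i hi => by
      rw [hyK, map_sub, map_add, derivation_eq_zero_of_mem_adjoin (h.derivation_two hi) hτ₁,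
        zero_add, hc _ (h.derivation_two hi), ds i hi]
    convert h.jacobian using 1
    apply Subtype.ext
    change D' 0 s * D' 1 y - D' 0 y * D' 1 s =
      D' 0 (u 0) * D' 1 (u 1) - D' 0 (u 1) * D' 1 (u 0)
    rw [ds 0 (by decide), ds 1 (by decide), dy 0 (by decide), dy 1 (by decide)]
    ring
  refine no_steep_initial_form hX hw₂ hw₀ hn hj (by omega) hEX (hX.isMonomial hpos rfl G hG) hF
    hAF (p := p) ?_ ?_ ?_ hN hν hp hp' hνv (hX2 ▸ he) (hX2 ▸ hem) hg hsume hsumm ?_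
  · rw [hX2]
    exact h.coord_two
  · rw [hX0, hX2, h.coord_zero, ← mul_sub, ← hs]
    rfl
  · rw [hX1, hX2, h.coord_one, ← mul_sub]
    change _ = (x 2 : K) ^ w₂ * ((y : K) + MvPolynomial.aeval ![(s : K), x 2] p)
    rw [hyK]
    ring
  · simpa using hsumg

end BlowupTower

end WeightedBlowup

end

/-! ### From the hypotheses to the tower, and the conclusion. -/

noncomputable section

open Polynomial AlgebraicGeometry IsLocalRing

namespace WeightedBlowup

variable {k K : Type*} [Field k] [Field K] [Algebra k K]

/-- The floor of (v₁ - 1)/v₂ is the largest integer a with a v₂ < v₁, so the hypothesis is a bound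
for all such a. -/
theorem slope_bound_of_floor_le {v₁ v₂ w₁ w₂ : ℕ} (hv₂ : 0 < v₂) (hw₂ : 0 < w₂)
    (h : ((⌊((v₁ : ℚ) - 1) / v₂⌋ : ℤ) : ℚ) ≤ ((w₁ : ℚ) - (v₁ : ℚ) ^ 2) / w₂) (a : ℕ)
    (ha : a * v₂ < v₁) : a * w₂ + v₁ ^ 2 ≤ w₁ := by
  have h1 : (a : ℤ) ≤ ⌊((v₁ : ℚ) - 1) / v₂⌋ := by
    rw [Int.le_floor, le_div_iff₀ (by exact_mod_cast hv₂)]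
    have : (a * v₂ + 1 : ℚ) ≤ v₁ := by exact_mod_cast ha
    push_cast
    linarith
  have h2 : (a : ℚ) ≤ ((w₁ : ℚ) - (v₁ : ℚ) ^ 2) / w₂ := by
    refine le_trans ?_ h
    exact_mod_cast h1
  rw [le_div_iff₀ (by exact_mod_cast hw₂)] at h2
  have : (a * w₂ + v₁ ^ 2 : ℚ) ≤ w₁ := by linarith
  exact_mod_cast this

/-- Two coordinate systems with the same third coordinate have an invertible partial Jacobian. -/
theorem CoordSystem.isUnit_jacobian {B : Subalgebra k K} {z y : Fin 3 → B}
    {D : Fin 3 → Derivation k K K} (h : CoordSystem B z D)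
    (hy : Ideal.span (Set.range y) = Ideal.span (Set.range z)) (hy2 : y 2 = z 2) :
    IsUnit (h.der 0 (y 0) * h.der 1 (y 1) - h.der 0 (y 1) * h.der 1 (y 0)) := by
  have h1 := h.isUnit_det hy
  rw [Matrix.det_fin_three] at h1
  simp only [Matrix.of_apply, hy2, h.der_coord] at h1
  simpa using h1

/-- The tower formed by a weighted blow-up of the germ `A` and a weighted blow-up at the point of
the strict transform of the curve `x₁ = x₂ = 0`. -/
theorem exists_blowupTower [CharZero k] {A : Subalgebra k K} (hA : IsSmoothGerm 3 A)
    {x : Fin 3 → A} (hx : IsRegularSystem x) {D : Fin 3 → Derivation k K K}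
    (hD : CoordSystem A x D) {w₁ w₂ : ℕ} (hw₁ : 0 < w₁) (hw₂ : 0 < w₂)
    {P : weightedBlowup x ![w₁, w₂, 1]} (hP : P ∈ exceptionalLocus x ![w₁, w₂, 1])
    (hP' : P ∈ strictTransform x ![w₁, w₂, 1] (Ideal.span {x 0, x 1}))
    {z : Fin 3 → localRingAt P} (hz : IsRegularSystem z) (hzx : (z 2 : K) = x 2)
    {v₁ v₂ : ℕ} (hv₁ : 0 < v₁) (hv₂ : 0 < v₂) {F : Divisor k K}
    (hF : IsExceptionalDivisor z ![v₁, v₂, 1] F) :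
    ∃ (u : Fin 2 → localRingAt P) (D' : Fin 3 → Derivation k K K),
      BlowupTower A (localRingAt P) F x D w₁ w₂ u z D' v₁ v₂ := by
  have hw := BlowupTower.weight_pos hw₁ hw₂
  have hv := BlowupTower.weight_pos hv₁ hv₂
  obtain ⟨hloc, -, hzm⟩ := hz
  have hden := isDenominator_two_of_mem_strictTransform hw rfl hP'
  have hB := hD.localRingAt hw rfl hden hloc hP hP'
  set y : Fin 3 → localRingAt P := fun i => ⟨blowupCoord x ![w₁, w₂, 1] i, blowupCoord_mem hden i⟩
    with hy
  have hspan : Ideal.span (Set.range z) = Ideal.span (Set.range y) := by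
    ext a
    rw [hzm, hB.mem_span_iff, mem_maximalIdeal, mem_nonunits_iff]
  obtain ⟨D', hD'⟩ := hB.change hspan
  have ht := coord_two_ne_zero hD 2
  have hy2 : y 2 = z 2 := Subtype.ext (by rw [hzx]; simp [hy, blowupCoord])
  have hK := isFractionRing_of_le hA.isFractionRing (le_localRingAt P)
  refine ⟨![y 0, y 1], D', hA.isFractionRing, hx, hD, hD', le_localRingAt P, ?_, ?_, hzx,
    hD'.isUnit_jacobian hspan.symm hy2, hD'.isMonomial hv rfl F
      ((hD'.isExceptionalDivisor_iff hv F).1 hF), hv₁, hv₂⟩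
  · simp [hy, blowupCoord, mul_div_cancel₀ _ (pow_ne_zero w₁ ht)]
  · simp [hy, blowupCoord, mul_div_cancel₀ _ (pow_ne_zero w₂ ht)]

/-- The orders along `E` and `F` of the ideals when both log discrepancies are one. -/
theorem BlowupTower.exists_orders [CharZero k] {A : Subalgebra k K} {x : Fin 3 → A}
    {D : Fin 3 → Derivation k K K} {w₁ w₂ : ℕ} {P : weightedBlowup x ![w₁, w₂, 1]}
    {F : Divisor k K} {u : Fin 2 → localRingAt P} {z : Fin 3 → localRingAt P}
    {D' : Fin 3 → Derivation k K K} {v₁ v₂ : ℕ}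
    (h : BlowupTower A (localRingAt P) F x D w₁ w₂ u z D' v₁ v₂) (hw₁ : 0 < w₁) (hw₂ : 0 < w₂)
    (hP : P ∈ exceptionalLocus x ![w₁, w₂, 1])
    (hP' : P ∈ strictTransform x ![w₁, w₂, 1] (Ideal.span {x 0, x 1})) {E : Divisor k K}
    (hE : E.ring = localRingAt (h.coord.genericPoint (weight_pos hw₁ hw₂))) {𝔞 : RIdeal A}
    (haE : logDiscrepancy A 𝔞 E = 1)
    (haF : logDiscrepancy (localRingAt P) (weakTransform E (localRingAt P) 𝔞) F = 1) :
    ∃ e m : Fin 𝔞.length → ℕ,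
      (∀ i, ∀ f ∈ 𝔞.ideal i, (f : K) ∈ orderFiltration E.ring (x 2 : K) (e i)) ∧
      (∀ i, ∀ f ∈ 𝔞.ideal i, (f : K) ∈ orderFiltration F.ring (x 2 : K) (e i + m i : ℕ)) ∧
      ∑ i, 𝔞.exponent i * (e i : ℝ) = w₁ + w₂ ∧
      (v₁ + v₂ : ℝ) ≤ ∑ i, 𝔞.exponent i * (m i : ℝ) := by
  have hw := weight_pos hw₁ hw₂
  have hmon := h.coord.isMonomial hw rfl E hE
  obtain ⟨e, he, hle⟩ := exists_ord_of_canonicalOrder_le haE.ge (h.coord.canonicalOrder_le hw rfl hE)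
  obtain ⟨e', he', hge⟩ := exists_ord_of_le_canonicalOrder haE
    (hmon.le_canonicalOrder hw rfl h.coord)
  obtain rfl : e' = e := funext fun i => by exact_mod_cast (he' i).symm.trans (he i)
  obtain ⟨m, hm, hsumm⟩ := exists_ord_of_le_canonicalOrder haF
    (h.isMonomial.le_canonicalOrder (weight_pos h.pos₁ h.pos₂) rfl h.coord')
  refine ⟨e', m, fun i => (hmon.le_ord_iff hmon.le).1 (he i).ge, fun i f hf => ?_,
    le_antisymm (by simpa using hle) (by simpa using hge), ?_⟩
  -- Since f = b t^e with b in the weak transform and t of order 1 along F, the order of f is at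
  -- least e plus that of the transform.
  · obtain ⟨b, hb, hbf⟩ := div_mem_weakTransformIdeal h.coord hw rfl hP
      (isDenominator_two_of_mem_strictTransform hw rfl hP') hE (he i) hf
    have h1 := (h.isMonomial.le_ord_iff h.le_ring).1 (hm i).ge b hb
    rw [h.coord_two] at h1
    rw [← hbf, add_comm]
    push_cast
    exact mul_mem_orderFiltration h.ne_zero h1 (pow_mem_orderFiltration_self h.ne_zero _)
  · have h2 : ((v₁ + v₂ : ℕ) : ℝ) ≤ ∑ i, 𝔞.exponent i * (m i : ℝ) := hsumm
    exact_mod_cast h2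

/-- One of the derivatives of `u₁, u₂` with respect to the second coordinate is a unit. -/
theorem BlowupTower.isUnit_derivation_zero {A B : Subalgebra k K} {F : Divisor k K}
    {x : Fin 3 → A} {D : Fin 3 → Derivation k K K} {w₁ w₂ : ℕ} {u : Fin 2 → B} {z : Fin 3 → B}
    {D' : Fin 3 → Derivation k K K} {v₁ v₂ : ℕ}
    (h : BlowupTower A B F x D w₁ w₂ u z D' v₁ v₂) (h₁ : ¬ IsUnit (h.coord'.der 1 (u 1))) :
    IsUnit (h.coord'.der 1 (u 0)) := by
  by_contra h₀
  rw [← h.coord'.mem_span_iff] at h₀ h₁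
  exact (h.coord'.mem_span_iff _).1 (sub_mem (Ideal.mul_mem_left _ (h.coord'.der 0 (u 0)) h₁)
    (Ideal.mul_mem_left _ (h.coord'.der 0 (u 1)) h₀)) h.jacobian

end WeightedBlowup

end

theorem mainTheorem8 {k K : Type*} [Field k] [IsAlgClosed k] [CharZero k] [Field K] [Algebra k K]
    (A : Subalgebra k K) (hA : WeightedBlowup.IsSmoothGerm 3 A)
    (𝔞 : WeightedBlowup.RIdeal A) (hmld : WeightedBlowup.mld A 𝔞 = 1)
    (x : Fin 3 → A) (hx : WeightedBlowup.IsRegularSystem x)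
    (w₁ w₂ : ℕ) (hw₂ : 0 < w₂) (hw : w₂ ≤ w₁)
    (E : WeightedBlowup.Divisor k K)
    (hE : WeightedBlowup.IsExceptionalDivisor x ![w₁, w₂, 1] E)
    (haE : WeightedBlowup.logDiscrepancy A 𝔞 E = 1)
    (y : WeightedBlowup.weightedBlowup x ![w₁, w₂, 1])
    (hyx : y ∈ WeightedBlowup.exceptionalLocus x ![w₁, w₂, 1])
    (hyC : y ∈ WeightedBlowup.strictTransform x ![w₁, w₂, 1] (Ideal.span {x 0, x 1}))
    (z : Fin 3 → WeightedBlowup.localRingAt y) (hz : WeightedBlowup.IsRegularSystem z)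
    (hzx : (z 2 : K) = x 2)
    (v₁ v₂ : ℕ) (hv₂ : 0 < v₂) (hv : v₂ ≤ v₁)
    (F : WeightedBlowup.Divisor k K)
    (hF : WeightedBlowup.IsExceptionalDivisor z ![v₁, v₂, 1] F)
    (haF : WeightedBlowup.logDiscrepancy (WeightedBlowup.localRingAt y)
      (WeightedBlowup.weakTransform E (WeightedBlowup.localRingAt y) 𝔞) F = 1)
    (hslope : ((⌊((v₁ : ℚ) - 1) / v₂⌋ : ℤ) : ℚ) ≤ ((w₁ : ℚ) - (v₁ : ℚ) ^ 2) / w₂) :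
    ∃ (d : ℕ) (x' : Fin 3 → A), d ≤ v₁ - v₂ ∧ WeightedBlowup.IsRegularSystem x' ∧
      x' 2 = x 2 ∧
      WeightedBlowup.IsExceptionalDivisor x' ![w₁ + v₁ - d, w₂ + v₂ + d, 1] F := by
  have hw₁ : 0 < w₁ := hw₂.trans_le hw
  obtain ⟨D, hD⟩ := hA.exists_coordSystem hx
  obtain ⟨u, D', h⟩ := WeightedBlowup.exists_blowupTower hA hx hD hw₁ hw₂ hyx hyC hz hzx (hv₂.trans_le hv) hv₂ hF
  have hE' := (hD.isExceptionalDivisor_iff (WeightedBlowup.BlowupTower.weight_pos hw₁ hw₂) E).1 hE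
  have hslope' := WeightedBlowup.slope_bound_of_floor_le hv₂ hw₂ hslope
  rcases hv.eq_or_lt with hv' | hv'
  · exact h.exists_weights_of_eq hv'.symm
  -- The derivative of u_2 along the coordinate of weight v₂ decides which of u_1, u_2 can serve as
  -- that coordinate.
  by_cases h₁ : IsUnit (h.coord'.der 1 (u 1))
  · exact h.exists_weights_of_isUnit hv hslope' h₁
  obtain ⟨e, m, he, hem, hsume, hsumm⟩ := h.exists_orders hw₁ hw₂ hyx hyC hE' haE haF
  exact h.exists_weights_of_not_isUnit hv' hslope' (h.isUnit_derivation_zero h₁) h₁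
    fun τ₀ hτ₀ τ₁ hτ₁ s hs hs' p hp hpv ν N j hj hN hν hp₁ hp₂ hνv =>
      h.no_steep hA.essFiniteType hmld hw₁ hw₂ hE' he hem hsume hsumm hslope' hτ₀ hτ₁ hs hs' hp hpv
        hj hN hν hp₁ hp₂ hνv
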